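/- **Conventions.** Classical data are bit strings; $x\|y$ denotes an unambiguous (injective, efficiently computable and invertible) encoding of a pair of bit strings as a bit string. QPT means computable by a uniform, classically controlled quantum program with gates $H$, $T$, CNOT, computational-basis measurements and fresh $|0\rangle$ qubits, whose number of steps is bounded by a polynomial in the input length. A function of $\lambda$ is negligible if it decays faster than every inverse polynomial. **Schemes.** A (stateful) digital signature scheme with revocable signing keys (DSR-Key), with message space $\{0,1\}^*$, consists of QPT algorithms $\mathsf{Setup}(1^\lambda)\to(\mathsf{pp},\mathsf{ck})$, $\mathsf{KeyGen}(\mathsf{pp})\to(\mathsf{sigk}_0,\mathsf{vk})$, $\mathsf{Sign}(\mathsf{pp},\mathsf{sigk}_i,m)\to(\mathsf{sigk}_{i+1},\sigma)$, $\mathsf{Ver}(\mathsf{pp},\mathsf{vk},m,\sigma)\to\top/\bot$, $\mathsf{Del}(\mathsf{sigk}_i)\to\mathsf{cert}$, $\mathsf{Cert}(\mathsf{pp},\mathsf{vk},\mathsf{ck},\mathsf{cert},S)\to\top/\bot$, where $S$ is a finite set of messages, the signing keys are quantum, and all other data are classical. Its properties are the following. * *Many-time correctness.* For every polynomially bounded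 $p=p(\lambda)$ and all messages $m_1,\dots,m_p$, which may be arbitrary functions of $\lambda$ and of the public parameter $\mathsf{pp}$: if $(\mathsf{pp},\mathsf{ck})\leftarrow\mathsf{Setup}(1^\lambda)$, $(\mathsf{sigk}_0,\mathsf{vk})\leftarrow\mathsf{KeyGen}(\mathsf{pp})$ and $(\mathsf{sigk}_i,\sigma_i)\leftarrow\mathsf{Sign}(\mathsf{pp},\mathsf{sigk}_{i-1},m_i)$ for $i=1,\dots,p$, then $\mathsf{Ver}(\mathsf{pp},\mathsf{vk},m_i,\sigma_i)=\top$ for all $i\le p$, except with negligible probability. *One-time:* the same for $p=1$. * *Many-time deletion correctness.* In the same situation (including $p=0$), if $\mathsf{cert}\leftarrow\mathsf{Del}(\mathsf{sigk}_p)$, then $\mathsf{Cert}(\mathsf{pp},\mathsf{vk},\mathsf{ck},\mathsf{cert},\{m_1,\dots,m_p\})=\top$, except with negligible probability. *One-time:* the same for $p\le 1$. * *EUF-CMA security.* Every QPT adversary that is given $1^\lambda,\mathsf{pp},\mathsf{vk}$ and the stateful signing oracle (which answers each query $m$ by a signature made with the current signing key, and then updates the key) outputs, with at most negligible probability, a pair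 $(m^*,\sigma^*)$ such that $m^*$ was not queried and $\mathsf{Ver}(\mathsf{pp},\mathsf{vk},m^*,\sigma^*)=\top$. *One-time:* the same for adversaries that make at most one query. * *Many-time deletion security.* For every QPT adversary $\mathcal A$, if $(\mathsf{pp},\mathsf{ck})\leftarrow\mathsf{Setup}(1^\lambda)$ and $(\mathsf{vk},\mathsf{cert},S,m^*,\sigma^*)\leftarrow\mathcal A(1^\lambda,\mathsf{pp})$, then the probability that $\mathsf{Cert}(\mathsf{pp},\mathsf{vk},\mathsf{ck},\mathsf{cert},S)=\top$, $m^*\notin S$ and $\mathsf{Ver}(\mathsf{pp},\mathsf{vk},m^*,\sigma^*)=\top$ is negligible. *One-time:* the same for this event together with $|S|\le1$. **Chain construction.** Given a DSR-Key scheme $\mathsf{OT}$, define $\mathsf{MT}$ as follows. $\mathsf{MT.Setup}=\mathsf{OT.Setup}$. $\mathsf{MT.KeyGen}(\mathsf{pp})$ runs $(\mathsf{sk}_0,\mathsf{vk}_0)\leftarrow\mathsf{OT.KeyGen}(\mathsf{pp})$, and outputs $\mathsf{sigk}_0=(\mathsf{sk}_0,\emptyset,\emptyset)$ and $\mathsf{vk}=\mathsf{vk}_0$.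 In general $$\mathsf{sigk}_i=\bigl(\mathsf{sk}_i,\ (\mathsf{sk}'_j)_{0\le j<i},\ (m_j,\mathsf{vk}_j,\sigma_j)_{1\le j\le i}\bigr).$$ $\mathsf{MT.Sign}(\mathsf{pp},\mathsf{sigk}_i,m)$ runs $(\mathsf{sk}_{i+1},\mathsf{vk}_{i+1})\leftarrow\mathsf{OT.KeyGen}(\mathsf{pp})$ and $(\mathsf{sk}'_i,\sigma_{i+1})\leftarrow\mathsf{OT.Sign}(\mathsf{pp},\mathsf{sk}_i,m\|\mathsf{vk}_{i+1})$, puts $m_{i+1}=m$, and outputs $\mathsf{sigk}_{i+1}$ and the signature $(m_j,\mathsf{vk}_j,\sigma_j)_{1\le j\le i+1}$. $\mathsf{MT.Ver}(\mathsf{pp},\mathsf{vk},m,\sigma)$ parses $\sigma=(m_j,\mathsf{vk}_j,\sigma_j)_{1\le j\le i}$, puts $\mathsf{vk}_0=\mathsf{vk}$, and accepts iff $i\ge1$, $m=m_i$, and $\mathsf{OT.Ver}(\mathsf{pp},\mathsf{vk}_{j-1},m_j\|\mathsf{vk}_j,\sigma_j)=\top$ for all $1\le j\le i$. $\mathsf{MT.Del}(\mathsf{sigk}_i)$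 runs $\mathsf{OT.Del}$ on $\mathsf{sk}'_0,\dots,\mathsf{sk}'_{i-1},\mathsf{sk}_i$, and outputs the resulting $\mathsf{cert}_0,\dots,\mathsf{cert}_i$ together with $(m_j,\mathsf{vk}_j,\sigma_j)_{1\le j\le i}$. $\mathsf{MT.Cert}(\mathsf{pp},\mathsf{vk},\mathsf{ck},\mathsf{cert},S)$ parses $\mathsf{cert}$ in this form, puts $\mathsf{vk}_0=\mathsf{vk}$, and accepts iff $S=\{m_1,\dots,m_i\}$, $\mathsf{OT.Cert}(\mathsf{pp},\mathsf{vk}_{j-1},\mathsf{ck},\mathsf{cert}_{j-1},\{m_j\|\mathsf{vk}_j\})=\top$ for all $1\le j\le i$, and $\mathsf{OT.Cert}(\mathsf{pp},\mathsf{vk}_i,\mathsf{ck},\mathsf{cert}_i,\emptyset)=\top$. **Theorem.** If $\mathsf{OT}$ is a DSR-Key scheme that satisfies one-time correctness, one-time EUF-CMA security, one-time deletion correctness and one-time deletion security, then $\mathsf{MT}$ is a DSR-Key scheme (in particular its six algorithms are QPT) that satisfies many-time correctness, EUF-CMA security, many-time deletion correctness and many-time deletion security. -/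

import Mathlib

/-! ### Classical data: bit strings, pairs and lists of bit strings -/

/-- Classical data are bit strings, elements of `{0,1}^*`. -/
abbrev Str := List Bool

/-- The unambiguous pairing `x ‖ y` of two bit strings: every bit of `x` is preceded by `1`, the end
of `x` is marked by `0`, and `y` follows. -/
def pairStr : Str → Str → Str
  | [], y => false :: y
  | b :: x, y => true :: b :: pairStr x y

/-- The two components of a pair (a total function, with default values on strings that are not
pairs). -/
def unpairStr : Str → Str × Str
  | true :: b :: w => (b :: (unpairStr w).1, (unpairStr w).2)
  | false :: w => ([], w)
  | _ => ([], [])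

theorem unpairStr_pairStr (x y : Str) : unpairStr (pairStr x y) = (x, y) := by
  induction x with
  | nil => simp [pairStr, unpairStr]
  | cons b x ih => simp [pairStr, unpairStr, ih]

theorem length_snd_unpairStr_le (w : Str) : (unpairStr w).2.length ≤ w.length := by
  induction w using unpairStr.induct with
  | case1 b w ih => simp only [unpairStr, List.length_cons]; omega
  | case2 w => simp [unpairStr]
  | case3 w h1 h2 => simp [unpairStr]

theorem length_snd_unpairStr_lt (c : Bool) (w : Str) :
    (unpairStr (c :: w)).2.length < (c :: w).length := by
  match c, w with
  | true, [] => simp [unpairStr]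
  | true, b :: w =>
    have := length_snd_unpairStr_le w
    simp only [unpairStr, List.length_cons]; omega
  | false, w => simp [unpairStr]

/-- A list of bit strings, as one bit string. -/
def encodeList : List Str → Str
  | [] => []
  | x :: xs => pairStr x (encodeList xs)

/-- The list of bit strings that a bit string stands for (a total function). -/
def decodeList : Str → List Str
  | [] => []
  | c :: w => (unpairStr (c :: w)).1 :: decodeList (unpairStr (c :: w)).2
  termination_by w => w.length
  decreasing_by exact length_snd_unpairStr_lt c w

theorem decodeList_encodeList (xs : List Str) : decodeList (encodeList xs) = xs := by
  induction xs with
  | nil => simp [encodeList, decodeList]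
  | cons x xs ih =>
    have h : ∀ w : Str, w ≠ [] → decodeList w = (unpairStr w).1 :: decodeList (unpairStr w).2 := by
      intro w hw
      cases w with
      | nil => exact absurd rfl hw
      | cons c w => rw [decodeList]
    have hne : pairStr x (encodeList xs) ≠ [] := by cases x <;> simp [pairStr]
    rw [encodeList, h _ hne, unpairStr_pairStr, ih]

/-! ### Quantum registers -/

/-- Amplitude vectors of `n` qubits. -/
abbrev Ket (n : ℕ) := EuclideanSpace ℂ (Fin n → Bool)

/-- Pure states of `n` qubits: unit vectors of `(ℂ²)^{⊗ n}`. Mixed states occur as probability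
distributions over pure states. -/
def QState (n : ℕ) := {ψ : Ket n // ‖ψ‖ = 1}

theorem ket_norm_eq_one_iff {n : ℕ} (ψ : Ket n) : ‖ψ‖ = 1 ↔ ∑ s, ‖ψ s‖ ^ 2 = 1 := by
  rw [← EuclideanSpace.norm_sq_eq]
  constructor
  · intro h; rw [h]; norm_num
  · intro h
    exact (pow_eq_one_iff_of_nonneg (norm_nonneg _) two_ne_zero).mp h

namespace QState

variable {n m : ℕ}

theorem sum_sq (ψ : QState n) : ∑ s, ‖ψ.1 s‖ ^ 2 = 1 := (ket_norm_eq_one_iff _).mp ψ.2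

/-- The one-qubit state `|0⟩`. -/
noncomputable def zero : QState 1 :=
  ⟨EuclideanSpace.single (fun _ => false) 1, by simp⟩

/-- The tensor product of two states. -/
noncomputable def tensor (ψ : QState n) (φ : QState m) : QState (n + m) :=
  ⟨WithLp.toLp 2 fun s => ψ.1 (fun i => s (Fin.castAdd m i)) * φ.1 (fun j => s (Fin.natAdd n j)), by
    rw [ket_norm_eq_one_iff]
    rw [← (Fin.appendEquiv n m).sum_comp, Fintype.sum_prod_type]
    simp only [Fin.appendEquiv, Equiv.coe_fn_mk, Fin.append_left, Fin.append_right, norm_mul,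
      mul_pow, ← Finset.mul_sum]
    simp [sum_sq]⟩

/-- The basis string with bit `i` flipped. -/
def flip (i : Fin n) (s : Fin n → Bool) : Fin n → Bool := Function.update s i (!s i)

theorem flip_flip (i : Fin n) (s : Fin n → Bool) : flip i (flip i s) = s := by
  simp [flip]

theorem sum_flip (i : Fin n) (F : (Fin n → Bool) → ℝ) : ∑ s, F (flip i s) = ∑ s, F s :=
  Equiv.sum_comp (Function.Involutive.toPerm (flip i) (flip_flip i)) F

/-- The Hadamard gate on qubit `i`. -/
noncomputable def hadamard (i : Fin n) (ψ : QState n) : QState n :=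
  ⟨WithLp.toLp 2 fun s =>
      ((Real.sqrt 2 : ℝ) : ℂ)⁻¹ * ((if s i then -1 else 1) * ψ.1 s + ψ.1 (flip i s)), by
    rw [ket_norm_eq_one_iff]
    set F : (Fin n → Bool) → ℝ := fun s =>
      ‖((Real.sqrt 2 : ℝ) : ℂ)⁻¹ * ((if s i then -1 else 1) * ψ.1 s + ψ.1 (flip i s))‖ ^ 2 with hF
    have key : ∀ s, F s + F (flip i s) = ‖ψ.1 s‖ ^ 2 + ‖ψ.1 (flip i s)‖ ^ 2 := by
      intro s
      have h2 : ‖((Real.sqrt 2 : ℝ) : ℂ)⁻¹‖ ^ 2 = 1 / 2 := by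
        rw [norm_inv, Complex.norm_real, Real.norm_of_nonneg (Real.sqrt_nonneg _), inv_pow,
          Real.sq_sqrt (by norm_num)]
        norm_num
      have hpar := parallelogram_law_with_norm ℝ (ψ.1 s) (ψ.1 (flip i s))
      have hi : flip i s i = !s i := by simp [flip]
      simp only [hF, norm_mul, mul_pow, h2, flip_flip, hi]
      cases hs : s i
      · have e : ‖-1 * ψ.1 (flip i s) + ψ.1 s‖ = ‖ψ.1 s - ψ.1 (flip i s)‖ := by congr 1; ring
        simp only [Bool.not_false, if_true, Bool.false_eq_true, if_false, one_mul, e]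
        nlinarith [hpar]
      · have e : ‖-1 * ψ.1 s + ψ.1 (flip i s)‖ = ‖ψ.1 s - ψ.1 (flip i s)‖ := by
          rw [← norm_neg]; congr 1; ring
        have e' : ‖ψ.1 (flip i s) + ψ.1 s‖ = ‖ψ.1 s + ψ.1 (flip i s)‖ := by rw [add_comm]
        simp only [Bool.not_true, if_true, Bool.false_eq_true, if_false, one_mul, e, e']
        nlinarith [hpar]
    have h1 : ∑ s, (F s + F (flip i s)) = 2 := by
      rw [Finset.sum_congr rfl fun s _ => key s, Finset.sum_add_distrib,
        sum_flip i (fun s => ‖ψ.1 s‖ ^ 2), sum_sq]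
      norm_num
    rw [Finset.sum_add_distrib, sum_flip i F] at h1
    change ∑ s, F s = 1
    linarith⟩

/-- The `T` gate `diag(1, e^{iπ/4})` on qubit `i`. -/
noncomputable def tGate (i : Fin n) (ψ : QState n) : QState n :=
  ⟨WithLp.toLp 2 fun s =>
      (if s i then Complex.exp (((Real.pi / 4 : ℝ) : ℂ) * Complex.I) else 1) * ψ.1 s, by
    rw [ket_norm_eq_one_iff]
    refine Eq.trans ?_ (sum_sq ψ)
    refine Finset.sum_congr rfl fun s _ => ?_
    have h : ‖(if s i then Complex.exp (((Real.pi / 4 : ℝ) : ℂ) * Complex.I) else 1 : ℂ)‖ = 1 := by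
      split_ifs
      · exact Complex.norm_exp_ofReal_mul_I _
      · simp
    simp only [norm_mul, h, one_mul]⟩

/-- The action of a controlled-not gate, with control `i` and target `j`, on basis strings. -/
def cflip (i j : Fin n) (s : Fin n → Bool) : Fin n → Bool := if s i then flip j s else s

theorem cflip_cflip {i j : Fin n} (h : i ≠ j) (s : Fin n → Bool) : cflip i j (cflip i j s) = s := by
  unfold cflip
  cases hs : s i
  · simp [hs]
  · have : flip j s i = true := by simp [flip, Function.update_of_ne h, hs]
    simp [this, flip_flip]

/-- The controlled-not gate with control `i` and target `j`. -/
noncomputable def cnot (i j : Fin n) (h : i ≠ j) (ψ : QState n) : QState n :=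
  ⟨WithLp.toLp 2 fun s => ψ.1 (cflip i j s), by
    rw [ket_norm_eq_one_iff]
    refine Eq.trans ?_ (sum_sq ψ)
    exact Equiv.sum_comp (Function.Involutive.toPerm (cflip i j) (cflip_cflip h))
      (fun s => ‖ψ.1 s‖ ^ 2)⟩

/-- The projection of a state to the subspace where qubit `i` is `b`. -/
noncomputable def proj (i : Fin n) (b : Bool) (ψ : QState n) : Ket n :=
  WithLp.toLp 2 fun s => if s i = b then ψ.1 s else 0

theorem sum_norm_sq_proj (i : Fin n) (ψ : QState n) :
    ‖proj i true ψ‖ ^ 2 + ‖proj i false ψ‖ ^ 2 = 1 := by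
  rw [EuclideanSpace.norm_sq_eq, EuclideanSpace.norm_sq_eq, ← Finset.sum_add_distrib, ← sum_sq ψ]
  refine Finset.sum_congr rfl fun s _ => ?_
  cases hs : s i <;> simp [proj, hs]

open Classical in
/-- The state after outcome `b` of a measurement of qubit `i`: the normalized projection. (The value
for an outcome of probability zero is immaterial.) -/
noncomputable def post (i : Fin n) (ψ : QState n) (b : Bool) : QState n :=
  if h : proj i b ψ = 0 then ψ
  else ⟨(((‖proj i b ψ‖⁻¹ : ℝ) : ℂ)) • proj i b ψ, by
    rw [norm_smul, Complex.norm_real, norm_inv, norm_norm, inv_mul_cancel₀ (norm_ne_zero_iff.mpr h)]⟩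

/-- Measurement of qubit `i` in the computational basis: the outcome (Born rule) and the state after
the measurement. -/
noncomputable def measure (i : Fin n) (ψ : QState n) : PMF (Bool × QState n) :=
  (PMF.ofFintype (fun b => ENNReal.ofReal (‖proj i b ψ‖ ^ 2)) (by
    rw [Fintype.sum_bool, ← ENNReal.ofReal_add (sq_nonneg _) (sq_nonneg _), sum_norm_sq_proj,
      ENNReal.ofReal_one])).map fun b => (b, post i ψ b)

end QState

/-! ### Values: data with classical and quantum parts -/

/-- The contents of a storage cell: a bit string, a quantum register of `n` qubits, or a pair of
values. Different quantum registers are in a product state; qubits which are, or are to be, entangled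
lie in one register. -/
inductive Val where
  | str (s : Str) : Val
  | qreg (n : ℕ) (ψ : QState n) : Val
  | node (a b : Val) : Val

namespace Val

/-- The bit string in a cell (empty if the cell does not hold a bit string). -/
def toStr : Val → Str
  | str s => s
  | _ => []

/-- First component. -/
def left : Val → Val
  | node a _ => a
  | _ => str []

/-- Second component. -/
def right : Val → Val
  | node _ b => b
  | _ => str []

/-- Whether a value is a pair. -/
def isNode : Val → Bool
  | node _ _ => true
  | _ => false

/-- Number of bits, qubits and pairs. -/
def size : Val → ℕ
  | str s => s.length + 1
  | qreg n _ => n + 1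
  | node a b => size a + size b + 1

/-- The list `[v₁, …, v_k]` of values that `(v₁, (v₂, … (v_k, x)))` stands for. -/
def toList : Val → List Val
  | node a b => a :: toList b
  | _ => []

/-- A value that is not a quantum register is left unchanged by a quantum operation. -/
def mapQ (f : ∀ n, QState n → QState n) : Val → Val
  | qreg n ψ => qreg n (f n ψ)
  | v => v

/-- Two registers are put together to one; anything else gives the first value. -/
noncomputable def merge : Val → Val → Val
  | qreg n ψ, qreg m φ => qreg (n + m) (QState.tensor ψ φ)
  | v, _ => v

end Val

/-! ### Quantum programs and their running time -/

/-- One-qubit gates. Together with the controlled-not gate they form the standard universal set. -/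
inductive Gate where
  | H
  | T

/-- A gate on qubit `i`; nothing happens if there is no such qubit. -/
noncomputable def Gate.apply (g : Gate) (i : ℕ) (n : ℕ) (ψ : QState n) : QState n :=
  if h : i < n then
    match g with
    | .H => QState.hadamard ⟨i, h⟩ ψ
    | .T => QState.tGate ⟨i, h⟩ ψ
  else ψ

/-- A controlled-not gate with control `i` and target `j`; nothing happens if these are not two
different qubits of the register. -/
noncomputable def cnotApply (i j : ℕ) (n : ℕ) (ψ : QState n) : QState n :=
  if h : i < n ∧ j < n ∧ i ≠ j then
    QState.cnot ⟨i, h.1⟩ ⟨j, h.2.1⟩ (by simpa [Fin.ext_iff] using h.2.2) ψ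
  else ψ

/-- Basic operations on bit strings. -/
inductive StrOp where
  | copy
  | append
  | pair
  | fst
  | snd
  | head
  | tail
  | eq

/-- The meaning of the basic operations on bit strings (unary ones ignore their second argument). -/
def StrOp.eval : StrOp → Str → Str → Str
  | .copy, y, _ => y
  | .append, y, z => y ++ z
  | .pair, y, z => pairStr y z
  | .fst, y, _ => (unpairStr y).1
  | .snd, y, _ => (unpairStr y).2
  | .head, y, _ => y.take 1
  | .tail, y, _ => y.drop 1
  | .eq, y, z => [decide (y = z)]

/-- Classically controlled quantum programs over registers `0, 1, 2, …`, each of which holds a value.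
Only bit strings can be copied; quantum data can only be moved. Loops are bounded by the length of a
bit string, so that every program terminates; running times are counted separately. -/
inductive Cmd where
  /-- no operation -/
  | skip
  /-- `x := s` -/
  | const (x : ℕ) (s : Str)
  /-- `x := op(y, z)` on bit strings -/
  | op (o : StrOp) (x y z : ℕ)
  /-- `x := 1^{size of y}` -/
  | size (x y : ℕ)
  /-- `x :=` (is `y` a pair?) -/
  | isNode (x y : ℕ)
  /-- `x := y`, and `y` becomes empty -/
  | move (x y : ℕ)
  /-- `x := (y, z)`, and `y` and `z` become empty -/
  | node (x y z : ℕ)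
  /-- `(x, y) := z`, and `z` becomes empty -/
  | split (x y z : ℕ)
  /-- `x` becomes a new one-qubit register in state `|0⟩` -/
  | qnew (x : ℕ)
  /-- `x := x ⊗ y`, and `y` becomes empty -/
  | qmerge (x y : ℕ)
  /-- a gate on the qubit of `x` whose number is the length of the string in `i` -/
  | gate (g : Gate) (x i : ℕ)
  /-- a controlled-not gate on the qubits of `x` given by the strings in `i` and `j` -/
  | cnot (x i j : ℕ)
  /-- measure the qubit of `x` given by the string in `i`, and put the outcome in `y` -/
  | meas (y x i : ℕ)
  /-- `x := O(y)`, for the oracle `O` -/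
  | query (x y : ℕ)
  /-- sequential composition -/
  | seq (c d : Cmd)
  /-- `c` if the string in `x` begins with `1`, otherwise `d` -/
  | ite (x : ℕ) (c d : Cmd)
  /-- `c` is run `ℓ` times, where `ℓ` is the length of the string in `x` at the start -/
  | loop (x : ℕ) (c : Cmd)

/-- The registers, and the number of elementary steps so far. -/
structure Mem where
  reg : ℕ → Val
  steps : ℕ

namespace Mem

/-- The memory at the start: the input is in register `0`, the other registers are empty. -/
def start (v : Val) : Mem := ⟨fun x => if x = 0 then v else Val.str [], 0⟩

/-- Assignment. -/
def set (s : Mem) (x : ℕ) (v : Val) : Mem := ⟨Function.update s.reg x v, s.steps⟩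

/-- The bit string in a register. -/
def get (s : Mem) (x : ℕ) : Str := (s.reg x).toStr

/-- Counting `k` steps. -/
def tick (s : Mem) (k : ℕ) : Mem := ⟨s.reg, s.steps + k⟩

end Mem

/-- A stateful oracle with states in `Θ`, queries and answers being bit strings. -/
abbrev Oracle (Θ : Type) := Θ → Str → PMF (Θ × Str)

/-- The oracle that is used for programs without oracle: all answers are empty. -/
noncomputable def noOracle : Oracle Unit := fun _ _ => pure ((), [])

/-- `k`-fold iteration of a random step. -/
noncomputable def iterate {α : Type} (f : α → PMF α) : ℕ → α → PMF α
  | 0, a => pure a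
  | k + 1, a => do
    let b ← f a
    iterate f k b

/-- Measurement of the qubit number `i` of a value; if there is no such qubit then the outcome is the
empty string. -/
noncomputable def Val.measure (i : ℕ) : Val → PMF (Str × Val)
  | .qreg n ψ =>
    if h : i < n then (QState.measure ⟨i, h⟩ ψ).map fun r => ([r.1], .qreg n r.2)
    else pure ([], .qreg n ψ)
  | v => pure ([], v)

/-- The semantics of programs. An operation is charged one step, and one step more for every bit that
it reads. -/
noncomputable def run {Θ : Type} (O : Oracle Θ) : Cmd → Θ × Mem → PMF (Θ × Mem)
  | .skip, (θ, s) => pure (θ, s.tick 1)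
  | .const x w, (θ, s) => pure (θ, (s.set x (.str w)).tick (1 + w.length))
  | .op o x y z, (θ, s) =>
    pure (θ, (s.set x (.str (o.eval (s.get y) (s.get z)))).tick
      (1 + (s.get y).length + (s.get z).length))
  | .size x y, (θ, s) =>
    pure (θ, (s.set x (.str (List.replicate (s.reg y).size true))).tick (1 + (s.reg y).size))
  | .isNode x y, (θ, s) => pure (θ, (s.set x (.str [(s.reg y).isNode])).tick 1)
  | .move x y, (θ, s) => pure (θ, ((s.set y (.str [])).set x (s.reg y)).tick 1)
  | .node x y z, (θ, s) =>
    let a := s.reg y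
    let s₁ := s.set y (.str [])
    let b := s₁.reg z
    pure (θ, ((s₁.set z (.str [])).set x (.node a b)).tick 1)
  | .split x y z, (θ, s) =>
    let v := s.reg z
    pure (θ, (((s.set z (.str [])).set x v.left).set y v.right).tick 1)
  | .qnew x, (θ, s) => pure (θ, (s.set x (.qreg 1 QState.zero)).tick 1)
  | .qmerge x y, (θ, s) =>
    let b := s.reg y
    let s₁ := s.set y (.str [])
    pure (θ, (s₁.set x (Val.merge (s₁.reg x) b)).tick 1)
  | .gate g x i, (θ, s) =>
    pure (θ, (s.set x ((s.reg x).mapQ (g.apply (s.get i).length))).tick (1 + (s.get i).length))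
  | .cnot x i j, (θ, s) =>
    pure (θ, (s.set x ((s.reg x).mapQ (cnotApply (s.get i).length (s.get j).length))).tick
      (1 + (s.get i).length + (s.get j).length))
  | .meas y x i, (θ, s) => do
    let (w, v) ← Val.measure (s.get i).length (s.reg x)
    pure (θ, ((s.set x v).set y (.str w)).tick (1 + (s.get i).length))
  | .query x y, (θ, s) => do
    let (θ', w) ← O θ (s.get y)
    pure (θ', (s.set x (.str w)).tick (1 + (s.get y).length + w.length))
  | .seq c d, (θ, s) => do
    let t ← run O c (θ, s)
    run O d t
  | .ite x c d, (θ, s) =>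
    if (s.get x).head? = some true then run O c (θ, s.tick 1) else run O d (θ, s.tick 1)
  | .loop x c, (θ, s) => iterate (run O c) (s.get x).length (θ, s.tick 1)

/-- Run a program without oracle on an input. -/
noncomputable def exec (c : Cmd) (v : Val) : PMF Mem :=
  (run noOracle c ((), Mem.start v)).map Prod.snd

/-- The representation of inputs and outputs as values. -/
class Enc (α : Type) where
  enc : α → Val

instance : Enc Val := ⟨id⟩
instance : Enc Str := ⟨Val.str⟩
instance : Enc Bool := ⟨fun b => .str [b]⟩

/-- The security parameter is given in unary. -/
instance : Enc ℕ := ⟨fun n => .str (List.replicate n true)⟩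

/-- A finite set of strings is given by its sorted list of elements. -/
instance : Enc (Finset Str) := ⟨fun S => .str (encodeList S.sort)⟩

instance {α β : Type} [Enc α] [Enc β] : Enc (α × β) := ⟨fun p => .node (Enc.enc p.1) (Enc.enc p.2)⟩

/-- The randomized map `f` is computed by a quantum algorithm whose running time is bounded by a
polynomial in the size of the input. -/
def IsQPT {α β : Type} [Enc α] [Enc β] (f : α → PMF β) : Prop :=
  ∃ (c : Cmd) (P : Polynomial ℕ), ∀ a : α,
    (exec c (Enc.enc a)).map (fun s => s.reg 0) = (f a).map Enc.enc ∧
    ∀ s ∈ (exec c (Enc.enc a)).support, s.steps ≤ P.eval (Enc.enc a).size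

/-! ### Digital signatures with revocable signing keys -/

/-- The algorithms of a stateful digital signature scheme with revocable signing keys and message
space `{0,1}^*`. Signing keys are quantum (arbitrary values); all the other data are bit strings. -/
structure DSRKey where
  /-- `Setup(1^n) → (pp, ck)` -/
  setup : ℕ → PMF (Str × Str)
  /-- `KeyGen(pp) → (sigk₀, vk)` -/
  keyGen : Str → PMF (Val × Str)
  /-- `Sign(pp, sigkᵢ, m) → (sigkᵢ₊₁, σ)` -/
  sign : Str → Val → Str → PMF (Val × Str)
  /-- `Ver(pp, vk, m, σ)` -/
  ver : Str → Str → Str → Str → PMF Bool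
  /-- `Del(sigkᵢ) → cert` -/
  del : Val → PMF Str
  /-- `Cert(pp, vk, ck, cert, S)` -/
  cert : Str → Str → Str → Str → Finset Str → PMF Bool

/-- Negligible functions. -/
def Negligible (f : ℕ → ℝ) : Prop :=
  Asymptotics.SuperpolynomialDecay Filter.atTop (fun n : ℕ => (n : ℝ)) f

/-- The probability of an event. -/
noncomputable def prob {α : Type} (p : PMF α) (E : α → Prop) : ℝ :=
  (p.toOuterMeasure {a | E a}).toReal

/-- Functions of the security parameter that are bounded by a polynomial. -/
def PolyBounded (p : ℕ → ℕ) : Prop := ∃ P : Polynomial ℕ, ∀ n, p n ≤ P.eval n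

namespace DSRKey

/-- All six algorithms are quantum polynomial time. -/
def QPT (D : DSRKey) : Prop :=
  IsQPT D.setup ∧
  IsQPT D.keyGen ∧
  IsQPT (fun a : Str × Val × Str => D.sign a.1 a.2.1 a.2.2) ∧
  IsQPT (fun a : Str × Str × Str × Str => D.ver a.1 a.2.1 a.2.2.1 a.2.2.2) ∧
  IsQPT D.del ∧
  IsQPT (fun a : Str × Str × Str × Str × Finset Str =>
    D.cert a.1 a.2.1 a.2.2.1 a.2.2.2.1 a.2.2.2.2)

/-- Sign a list of messages one after the other; the result is the last signing key and the list of
signatures. -/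
noncomputable def signAll (D : DSRKey) (pp : Str) : List Str → Val → PMF (Val × List Str)
  | [], sk => pure (sk, [])
  | m :: ms, sk => do
    let (sk', σ) ← D.sign pp sk m
    let (sk'', σs) ← signAll D pp ms sk'
    pure (sk'', σ :: σs)

/-- Verify a list of signatures for a list of messages; do all of them pass? -/
noncomputable def verAll (D : DSRKey) (pp vk : Str) : List Str → List Str → PMF Bool
  | m :: ms, σ :: σs => do
    let b ← D.ver pp vk m σ
    let b' ← verAll D pp vk ms σs
    pure (b && b')
  | _, _ => pure true

/-- The experiment of correctness. The messages may depend on the public parameter. -/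
noncomputable def correctnessGame (D : DSRKey) (msgs : ℕ → Str → List Str) (n : ℕ) : PMF Bool := do
  let (pp, _) ← D.setup n
  let (sk, vk) ← D.keyGen pp
  let (_, σs) ← D.signAll pp (msgs n pp) sk
  D.verAll pp vk (msgs n pp) σs

/-- Correctness for `p = p(n)` messages. -/
def CorrectFor (D : DSRKey) (p : ℕ → ℕ) : Prop :=
  ∀ msgs : ℕ → Str → List Str, (∀ n pp, (msgs n pp).length = p n) →
    ∃ ν, Negligible ν ∧ ∀ n, 1 - ν n ≤ prob (D.correctnessGame msgs n) (· = true)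

/-- One-time correctness. -/
def OneTimeCorrectness (D : DSRKey) : Prop := D.CorrectFor fun _ => 1

/-- Many-time correctness. -/
def ManyTimeCorrectness (D : DSRKey) : Prop := ∀ p, PolyBounded p → D.CorrectFor p

/-- The experiment of deletion correctness. The messages may depend on the public parameter. -/
noncomputable def delCorrectnessGame (D : DSRKey) (msgs : ℕ → Str → List Str) (n : ℕ) :
    PMF Bool := do
  let (pp, ck) ← D.setup n
  let (sk, vk) ← D.keyGen pp
  let (sk', _) ← D.signAll pp (msgs n pp) sk
  let cert ← D.del sk'
  D.cert pp vk ck cert (msgs n pp).toFinset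

/-- Deletion correctness after `p = p(n)` messages. -/
def DelCorrectFor (D : DSRKey) (p : ℕ → ℕ) : Prop :=
  ∀ msgs : ℕ → Str → List Str, (∀ n pp, (msgs n pp).length = p n) →
    ∃ ν, Negligible ν ∧ ∀ n, 1 - ν n ≤ prob (D.delCorrectnessGame msgs n) (· = true)

/-- One-time deletion correctness: at most one message. -/
def OneTimeDelCorrectness (D : DSRKey) : Prop :=
  D.DelCorrectFor (fun _ => 0) ∧ D.DelCorrectFor (fun _ => 1)

/-- Many-time deletion correctness. -/
def ManyTimeDelCorrectness (D : DSRKey) : Prop := ∀ p, PolyBounded p → D.DelCorrectFor p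

/-- The stateful signing oracle. Its state is the current signing key, together with a record of the
queries so far. -/
noncomputable def signOracle (D : DSRKey) (pp : Str) : Oracle (Val × List Str) :=
  fun (sk, log) m => do
    let (sk', σ) ← D.sign pp sk m
    pure ((sk', m :: log), σ)

/-- The result of the forgery experiment: the running time of the adversary, its queries, and whether
it has won. -/
structure ForgeryOutcome where
  steps : ℕ
  queries : List Str
  win : Bool

/-- The experiment of EUF-CMA security: the adversary gets `1^n`, `pp` and `vk` and has access to the
signing oracle. It wins with a message `m` and a valid signature of it if `m` was not a query. -/
noncomputable def forgeryGame (D : DSRKey) (A : Cmd) (n : ℕ) : PMF ForgeryOutcome := do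
  let (pp, _) ← D.setup n
  let (sk, vk) ← D.keyGen pp
  let ((_, log), s) ← run (D.signOracle pp) A ((sk, []), Mem.start (Enc.enc (n, pp, vk)))
  let m := (s.reg 0).left.toStr
  let σ := (s.reg 0).right.toStr
  let b ← D.ver pp vk m σ
  pure ⟨s.steps, log, b && decide (m ∉ log)⟩

/-- The running time of the adversary in the forgery experiment is polynomial in `n`. -/
def ForgerQPT (D : DSRKey) (A : Cmd) : Prop :=
  ∃ P : Polynomial ℕ, ∀ n, ∀ o ∈ (D.forgeryGame A n).support, o.steps ≤ P.eval n

/-- (Many-time) EUF-CMA security. -/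
def EUFCMA (D : DSRKey) : Prop :=
  ∀ A : Cmd, D.ForgerQPT A → Negligible fun n => prob (D.forgeryGame A n) (·.win = true)

/-- One-time EUF-CMA security: the adversary submits at most one query. -/
def OneTimeEUFCMA (D : DSRKey) : Prop :=
  ∀ A : Cmd, D.ForgerQPT A →
    (∀ n, ∀ o ∈ (D.forgeryGame A n).support, o.queries.length ≤ 1) →
    Negligible fun n => prob (D.forgeryGame A n) (·.win = true)

/-- The result of the deletion experiment: the running time of the adversary, the set `S` that it has
put out, and whether it has won. -/
structure DeletionOutcome where
  steps : ℕ
  signed : Finset Str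
  win : Bool

/-- The experiment of deletion security: the adversary gets `1^n` and `pp`, and puts out
`(vk, cert, S, m, σ)`. It wins if the certificate is accepted for `S`, the message `m` is not in `S`,
and the signature of `m` is accepted. -/
noncomputable def deletionGame (D : DSRKey) (A : Cmd) (n : ℕ) : PMF DeletionOutcome := do
  let (pp, ck) ← D.setup n
  let s ← exec A (Enc.enc (n, pp))
  let out := s.reg 0
  let vk := out.left.toStr
  let cert := out.right.left.toStr
  let S := (decodeList out.right.right.left.toStr).toFinset
  let m := out.right.right.right.left.toStr
  let σ := out.right.right.right.right.toStr
  let b ← D.cert pp vk ck cert S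
  let b' ← D.ver pp vk m σ
  pure ⟨s.steps, S, b && decide (m ∉ S) && b'⟩

/-- The running time of the adversary in the deletion experiment is polynomial in `n`. -/
def DeleterQPT (D : DSRKey) (A : Cmd) : Prop :=
  ∃ P : Polynomial ℕ, ∀ n, ∀ o ∈ (D.deletionGame A n).support, o.steps ≤ P.eval n

/-- (Many-time) deletion security. -/
def DelSecurity (D : DSRKey) : Prop :=
  ∀ A : Cmd, D.DeleterQPT A → Negligible fun n => prob (D.deletionGame A n) (·.win = true)

/-- One-time deletion security: the set `S` has at most one element. -/
def OneTimeDelSecurity (D : DSRKey) : Prop :=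
  ∀ A : Cmd, D.DeleterQPT A →
    Negligible fun n => prob (D.deletionGame A n) fun o => o.win = true ∧ o.signed.card ≤ 1

end DSRKey

/-! ### The chain construction -/

/-- A link `(mⱼ, ot.vkⱼ, ot.σⱼ)` of the chain. -/
structure Link where
  msg : Str
  vk : Str
  sig : Str

/-- A link as a bit string. -/
def encodeLink (l : Link) : Str := pairStr l.msg (pairStr l.vk l.sig)

/-- The link that a bit string stands for. -/
def decodeLink (w : Str) : Link :=
  ⟨(unpairStr w).1, (unpairStr (unpairStr w).2).1, (unpairStr (unpairStr w).2).2⟩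

theorem decodeLink_encodeLink (l : Link) : decodeLink (encodeLink l) = l := by
  simp [decodeLink, encodeLink, unpairStr_pairStr]

/-- The chain that a bit string stands for. Chains `(mⱼ, ot.vkⱼ, ot.σⱼ)_{j = 1, …, i}` are listed in
the order `j = i, …, 1`, the newest link first. -/
def decodeChain (w : Str) : List Link := (decodeList w).map decodeLink

/-- The verification key at the end of a chain that starts from `vk₀`. -/
def tipVk (vk₀ : Str) : List Link → Str
  | [] => vk₀
  | l :: _ => l.vk

/-- Is `ot.σⱼ` a valid signature of `mⱼ ‖ ot.vkⱼ` under `ot.vkⱼ₋₁`, for every link of the chain? -/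
noncomputable def verChain (OT : DSRKey) (pp vk₀ : Str) : List Link → PMF Bool
  | [] => pure true
  | l :: ls => do
    let b ← OT.ver pp (tipVk vk₀ ls) (pairStr l.msg l.vk) l.sig
    let b' ← verChain OT pp vk₀ ls
    pure (b && b')

/-- Is `ot.certⱼ₋₁` a valid certificate of the deletion of the key of `ot.vkⱼ₋₁` for the set
`{mⱼ ‖ ot.vkⱼ}`, for every link of the chain? The certificates are listed in the order
`ot.certᵢ₋₁, …, ot.cert₀`, and there must be as many of them as there are links. -/
noncomputable def certChain (OT : DSRKey) (pp vk₀ ck : Str) : List Str → List Link → PMF Bool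
  | [], [] => pure true
  | c :: cs, l :: ls => do
    let b ← OT.cert pp (tipVk vk₀ ls) ck c {pairStr l.msg l.vk}
    let b' ← certChain OT pp vk₀ ck cs ls
    pure (b && b')
  | _, _ => pure false

/-- `Del` for all the keys of a list. -/
noncomputable def delAll (OT : DSRKey) : List Val → PMF (List Str)
  | [] => pure []
  | k :: ks => do
    let c ← OT.del k
    let cs ← delAll OT ks
    pure (c :: cs)

/-- The many-time scheme obtained from a one-time scheme by the chain construction. The signing key
`sigkᵢ` is `(ot.sigkᵢ, (used keys ot.sigk'ᵢ₋₁, …, ot.sigk'₀), chain)`, where the chain consists of the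
links `(mⱼ, ot.vkⱼ, ot.σⱼ)`, `j = i, …, 1`. A signature is the chain that ends with the signed
message. -/
noncomputable def chainScheme (OT : DSRKey) : DSRKey where
  setup := OT.setup
  keyGen pp := do
    let (sk, vk) ← OT.keyGen pp
    pure (.node sk (.node (.str []) (.str [])), vk)
  sign pp sk m := do
    let cur := sk.left
    let used := sk.right.left
    let chain := sk.right.right.toStr
    let (newSk, newVk) ← OT.keyGen pp
    let (cur', s) ← OT.sign pp cur (pairStr m newVk)
    -- `encodeList (x :: xs) = pairStr x (encodeList xs)`: a new link is put in front
    let chain' := pairStr (encodeLink ⟨m, newVk, s⟩) chain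
    pure (.node newSk (.node (.node cur' used) (.str chain')), chain')
  ver pp vk m σ :=
    match decodeChain σ with
    | [] => pure false
    | l :: ls => if m = l.msg then verChain OT pp vk (l :: ls) else pure false
  del sk := do
    let certs ← delAll OT (sk.left :: sk.right.left.toList)
    pure (pairStr (encodeList certs) sk.right.right.toStr)
  cert pp vk ck cert S :=
    let links := decodeChain (unpairStr cert).2
    match decodeList (unpairStr cert).1 with
    | [] => pure false
    | c :: cs =>
      if S = (links.map Link.msg).toFinset then do
        let b ← OT.cert pp (tipVk vk links) ck c ∅
        let b' ← certChain OT pp vk ck cs links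
        pure (b && b')
      else pure false

/-! Correctness and deletion correctness are union bounds over the links of a chain. A link is a
signature of m‖vk', where vk' belongs to a key pair generated independently of the signing key, and
the pair (current key, tip of the chain) always has the law of a fresh key pair (`chainRun_fresh`).
Once vk' is fixed, a link is therefore a one-time experiment for a fixed string, and the expected
number of failing links is at most p times the worst failure probability over all strings
(`expVal_chainSum_le`). Messages in the one-time experiment may be arbitrary functions of pp, so for
each pp one may choose a string within a factor two of this supremum (`exists_worst_message`), and
one-time correctness applies to it.

For deletion security, the certified chain and the forged chain start from the same verification
key. Follow both from the oldest link on, as long as they sign the same string m‖vk. The last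
message of the forged chain is not among the certified messages, so the chains separate before the
forged one ends. At the first difference one verification key has an accepted certificate for ∅ or
for a singleton, together with a valid signature of a string outside this set. The first difference
is computed in polynomial time from the output of the adversary, and no probability is lost
(`delWin_chainScheme_le`).

For EUF-CMA security, the same comparison of the forged chain with the chain made by the signing
oracle gives a forgery under the key at some position i (`exists_forged_position`). The reduction
guesses i, puts its challenge key there, generates all other keys itself, and asks its own oracle
only when the key at position i has to sign, hence at most once. The simulation is perfect:
`embedKernel` is the law of the state of the reduction given the state of the real chain, and it
commutes with a query (`embedKernel_oracle`), hence with whole programs (`run_bind_oracle`). The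
loss is a factor 2P(n) + 1, where P bounds the running time of the adversary and so the number of
its queries.

All algorithms, reductions included, are programs of a concrete machine. The first half of the proof
shows that polynomial time maps are closed under composition, case distinction and bounded loops;
since quantum values can only be moved, contexts that are used twice have to be `Copyable`.
`Cmd.withHook` lets subroutines answer the queries of an adversary and accounts for every additional
step. Its time stays polynomial because the adversary is charged for reading each answer, and an
answer contains the whole chain (`EmbedInv`). -/

theorem PMF.monad_bind_eq_bind {α β : Type} (p : PMF α) (f : α → PMF β) : p >>= f = p.bind f := rfl

theorem PMF.monad_pure_eq_pure {α : Type} (a : α) : (Pure.pure a : PMF α) = PMF.pure a := rfl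

/-! ### Programs with renamed registers and replaced oracle queries -/

namespace Cmd

/-- Registers are renamed by `f`, and the query `x := O(y)` is replaced by the program `Q x y`. -/
def subst (f : ℕ → ℕ) (Q : ℕ → ℕ → Cmd) : Cmd → Cmd
  | skip => skip
  | const x s => const (f x) s
  | op o x y z => op o (f x) (f y) (f z)
  | size x y => size (f x) (f y)
  | isNode x y => isNode (f x) (f y)
  | move x y => move (f x) (f y)
  | node x y z => node (f x) (f y) (f z)
  | split x y z => split (f x) (f y) (f z)
  | qnew x => qnew (f x)
  | qmerge x y => qmerge (f x) (f y)
  | gate g x i => gate g (f x) (f i)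
  | cnot x i j => cnot (f x) (f i) (f j)
  | meas y x i => meas (f y) (f x) (f i)
  | query x y => Q x y
  | seq c d => seq (subst f Q c) (subst f Q d)
  | ite x c d => ite (f x) (subst f Q c) (subst f Q d)
  | loop x c => loop (f x) (subst f Q c)

/-- All the registers of the program are less than `bound`. -/
def bound : Cmd → ℕ
  | skip => 1
  | const x _ => x + 1
  | op _ x y z => x + y + z + 1
  | size x y => x + y + 1
  | isNode x y => x + y + 1
  | move x y => x + y + 1
  | node x y z => x + y + z + 1
  | split x y z => x + y + z + 1
  | qnew x => x + 1
  | qmerge x y => x + y + 1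
  | gate _ x i => x + i + 1
  | cnot x i j => x + i + j + 1
  | meas y x i => y + x + i + 1
  | query x y => x + y + 1
  | seq c d => c.bound + d.bound
  | ite x c d => x + c.bound + d.bound
  | loop x c => x + c.bound + 1

theorem bound_pos (c : Cmd) : 0 < c.bound := by
  induction c <;> simp only [bound] <;> omega

end Cmd

/-- A semiconjugacy of random steps passes to iterates. It serves to transport configurations of the
machine and also to forget clocks. -/
theorem iterate_congr_map {α β : Type} (e : α → β) (F : α → PMF α) (G : β → PMF β)
    (h : ∀ a, G (e a) = (F a).map e) (k : ℕ) (a : α) :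
    iterate G k (e a) = (iterate F k a).map e := by
  induction k generalizing a with
  | zero => exact (PMF.pure_map _ _).symm
  | succ k ih =>
    simp only [iterate, PMF.monad_bind_eq_bind, h, PMF.map_bind, PMF.bind_map]
    congr 1
    funext b
    exact ih b

/-- An embedding `(θ, t) ↦ (g θ, E θ t)` of configurations that is compatible with reading and
writing registers, with the clock and with queries, is compatible with all programs. -/
theorem run_subst {Θ Θ' : Type} (O : Oracle Θ) (O' : Oracle Θ') (f : ℕ → ℕ) (Q : ℕ → ℕ → Cmd)
    (g : Θ → Θ') (E : Θ → Mem → Mem) (N : ℕ)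
    (hreg : ∀ θ t x, x < N → (E θ t).reg (f x) = t.reg x)
    (hset : ∀ θ t x v, x < N → E θ (t.set x v) = (E θ t).set (f x) v)
    (htick : ∀ θ t k, E θ (t.tick k) = (E θ t).tick k)
    (hQ : ∀ θ t x y, x < N → y < N → run O' (Q x y) (g θ, E θ t) =
      (run O (.query x y) (θ, t)).map fun p => (g p.1, E p.1 p.2))
    (c : Cmd) (hc : c.bound ≤ N) (θ : Θ) (t : Mem) :
    run O' (c.subst f Q) (g θ, E θ t) = (run O c (θ, t)).map fun p => (g p.1, E p.1 p.2) := by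
  have hget : ∀ θ t x, x < N → (E θ t).get (f x) = t.get x := fun θ t x hx => by
    simp only [Mem.get, hreg θ t x hx]
  induction c generalizing θ t with
  | seq c d ihc ihd =>
    simp only [Cmd.bound] at hc
    simp only [Cmd.subst, run, PMF.monad_bind_eq_bind, ihc (by omega), PMF.bind_map, PMF.map_bind]
    congr 1
    funext p
    exact ihd (by omega) p.1 p.2
  | ite x c d ihc ihd =>
    simp only [Cmd.bound] at hc
    have := c.bound_pos
    have := d.bound_pos
    simp only [Cmd.subst, run, hget _ _ x (by omega), ← htick]
    split_ifs
    · exact ihc (by omega) _ _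
    · exact ihd (by omega) _ _
  | loop x c ih =>
    simp only [Cmd.bound] at hc
    have := c.bound_pos
    simp only [Cmd.subst, run, hget _ _ x (by omega), ← htick]
    exact iterate_congr_map (fun p : Θ × Mem => (g p.1, E p.1 p.2)) (run O c)
      (run O' (c.subst f Q)) (fun p => ih (by omega) p.1 p.2) _ (θ, t.tick 1)
  | query x y => exact hQ θ t x y (by simp only [Cmd.bound] at hc; omega) (by simp only [Cmd.bound] at hc; omega)
  | meas y x i =>
    simp only [Cmd.bound] at hc
    have hx : x < N := by omega
    have hy : y < N := by omega
    have hi : i < N := by omega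
    simp only [Cmd.subst, run, PMF.monad_bind_eq_bind, PMF.map_bind, hreg _ _ x hx,
      hget _ _ i hi]
    congr 1
    funext r
    simp only [PMF.monad_pure_eq_pure, PMF.pure_map, htick, hset _ _ y _ hy, hset _ _ x _ hx]
  | skip => simp only [Cmd.subst, run, PMF.monad_pure_eq_pure, PMF.pure_map, htick]
  | _ =>
    simp only [Cmd.bound] at hc
    simp (disch := omega) only [Cmd.subst, run, PMF.monad_pure_eq_pure, PMF.pure_map, htick, hset,
      hreg, hget]
    -- Operations such as `node` and `qmerge` read a register after another one has been written;
    -- the write is then pulled back through `E` before reading.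
    first
      | done
      | (simp (disch := omega) only [← hset, hreg])

/-! ### Calling a program as a subroutine -/

namespace Cmd

/-- Registers `b + 1, …, b + k` become empty. -/
def wipe (b : ℕ) : ℕ → Cmd
  | 0 => skip
  | k + 1 => seq (wipe b k) (const (b + 1 + k) [])

/-- The program `c`, without oracle, as a subroutine that transforms the content of register `b` and
uses the registers up to `b + c.bound`, which have to be empty, as its working space. -/
def call (c : Cmd) (b : ℕ) : Cmd :=
  seq (c.subst (· + b) fun x y => meas (x + b) (c.bound + b) (y + b)) (wipe b (c.bound - 1))

end Cmd

theorem Mem.ext' {s t : Mem} (h : ∀ x, s.reg x = t.reg x) (h' : s.steps = t.steps) : s = t := by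
  cases s; cases t
  simp only [Mem.mk.injEq]
  exact ⟨funext h, h'⟩

theorem Mem.set_reg (s : Mem) (x y : ℕ) (v : Val) :
    (s.set x v).reg y = if y = x then v else s.reg y := by
  simp [Mem.set, Function.update_apply]

@[simp] theorem Mem.set_steps (s : Mem) (x : ℕ) (v : Val) : (s.set x v).steps = s.steps := rfl
@[simp] theorem Mem.tick_reg (s : Mem) (k : ℕ) : (s.tick k).reg = s.reg := rfl
@[simp] theorem Mem.tick_steps (s : Mem) (k : ℕ) : (s.tick k).steps = s.steps + k := rfl

theorem run_wipe {Θ : Type} (O : Oracle Θ) (b k : ℕ) (θ : Θ) (s : Mem) :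
    run O (Cmd.wipe b k) (θ, s) =
      PMF.pure (θ, ⟨fun x => if b < x ∧ x ≤ b + k then .str [] else s.reg x, s.steps + k + 1⟩) := by
  induction k with
  | zero =>
    simp only [Cmd.wipe, run, PMF.monad_pure_eq_pure]
    congr 2
    refine Mem.ext' (fun x => ?_) rfl
    simp only [Mem.tick_reg]
    rw [if_neg (by omega)]
  | succ k ih =>
    simp only [Cmd.wipe, run, ih, PMF.monad_bind_eq_bind, PMF.pure_bind, PMF.monad_pure_eq_pure]
    congr 2
    refine Mem.ext' (fun x => ?_) ?_
    · simp only [Mem.tick_reg, Mem.set_reg]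
      split_ifs <;> first | rfl | omega
    · simp; omega

/-- Only the result in register `b` remains, because the working registers are wiped afterwards;
this makes calls composable. The overhead `c.bound` pays for emptying `c.bound - 1` registers and
one `skip`. -/
theorem run_call {Θ : Type} (O : Oracle Θ) (c : Cmd) (b : ℕ) (θ : Θ) (M : Mem)
    (hM : ∀ x, b < x → x ≤ b + c.bound → M.reg x = .str []) :
    run O (c.call b) (θ, M) = (exec c (M.reg b)).map fun s =>
      (θ, (M.set b (s.reg 0)).tick (s.steps + c.bound)) := by
  set N := c.bound with hN
  have hpos : 0 < N := c.bound_pos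
  let E : Unit → Mem → Mem := fun _ t =>
    ⟨fun y => if b ≤ y ∧ y < b + N then t.reg (y - b) else M.reg y, t.steps + M.steps⟩
  -- A query without oracle is imitated by measuring the empty register `N + b`: the outcome is the
  -- empty string, and the cost is that of a query with empty answer.
  have key := run_subst noOracle O (· + b) (fun x y => .meas (x + b) (N + b) (y + b))
    (fun _ => θ) E N (fun _ t x hx => by
      simp only [E]
      rw [if_pos (by omega)]
      congr 1; omega)
    (fun _ t x v hx => by
      refine Mem.ext' (fun y => ?_) rfl
      simp only [E, Mem.set_reg]
      split_ifs <;> first | rfl | omega)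
    (fun _ t k => by
      refine Mem.ext' (fun y => rfl) ?_
      simp only [E, Mem.tick]; omega)
    (fun _ t x y hx hy => by
      have h1 : (E () t).reg (N + b) = .str [] := by
        simp only [E]
        rw [if_neg (by omega)]
        exact hM _ (by omega) (by omega)
      have h2 : (E () t).get (y + b) = t.get y := by
        simp only [E, Mem.get]
        rw [if_pos (by omega)]
        congr 2; omega
      simp only [run, noOracle, h1, h2, Val.measure, PMF.monad_bind_eq_bind,
        PMF.monad_pure_eq_pure, PMF.pure_bind, PMF.pure_map]
      congr 2
      refine Mem.ext' (fun z => ?_) ?_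
      · simp only [Mem.tick_reg, Mem.set_reg, E]
        split_ifs <;> first | rfl | omega | (symm; apply hM <;> omega)
      · simp [E, Mem.tick, Mem.set]; omega)
    c le_rfl () (Mem.start (M.reg b))
  have hE : E () (Mem.start (M.reg b)) = M := by
    refine Mem.ext' (fun y => ?_) (by simp [E, Mem.start])
    simp only [E, Mem.start]
    split_ifs with h h'
    · congr 1; omega
    · exact (hM y (by omega) (by omega)).symm
    · rfl
  rw [hE] at key
  simp only [Cmd.call, run, PMF.monad_bind_eq_bind, ← hN, key, PMF.bind_map, exec, PMF.map_comp]
  rw [← PMF.bind_pure_comp]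
  congr 1
  funext p
  simp only [Function.comp, run_wipe]
  congr 2
  refine Mem.ext' (fun y => ?_) ?_
  · simp only [Mem.tick_reg, Mem.set_reg, E]
    split_ifs with h1 h2 h3 h3 <;> first
      | omega
      | rfl
      | (symm; apply hM <;> omega)
      | (congr 1; omega)
  · simp [E]; omega

/-! ### Sizes of registers and invariants of programs -/

/-- Every bit of the first component takes two bits of the code. -/
theorem length_fst_unpairStr_add_le (w : Str) :
    2 * (unpairStr w).1.length + (unpairStr w).2.length ≤ w.length := by
  induction w using unpairStr.induct with
  | case1 b w ih => simp only [unpairStr, List.length_cons]; omega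
  | case2 w => simp [unpairStr]
  | case3 w h1 h2 => simp [unpairStr]

theorem length_pairStr (x y : Str) : (pairStr x y).length = 2 * x.length + y.length + 1 := by
  induction x with
  | nil => simp [pairStr]
  | cons b x ih => simp only [pairStr, List.length_cons, ih]; omega

/-- Pairing is the extreme case: it doubles its first argument and adds a separator. -/
theorem StrOp.length_eval_le (o : StrOp) (y z : Str) :
    (o.eval y z).length ≤ 2 * y.length + z.length + 1 := by
  have := length_fst_unpairStr_add_le y
  cases o <;> simp only [StrOp.eval, List.length_append, length_pairStr, List.length_take,
    List.length_drop, List.length_singleton] <;> omega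

namespace Val

theorem size_pos (v : Val) : 0 < v.size := by cases v <;> simp [size]

theorem length_toStr_lt (v : Val) : v.toStr.length < v.size := by cases v <;> simp [size, toStr]

/-- The `+ 1` covers values of size one, whose two default components have size one each. -/
theorem size_left_add_right_le (v : Val) : v.left.size + v.right.size ≤ v.size + 1 := by
  cases v <;> simp [size, left, right] <;> omega

theorem size_mapQ (f : ∀ n, QState n → QState n) (v : Val) : (v.mapQ f).size = v.size := by
  cases v <;> simp [size, mapQ]

theorem size_merge_le (v w : Val) : (merge v w).size ≤ v.size + w.size := by
  cases v <;> cases w <;> simp [size, merge] <;> omega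

theorem size_of_mem_support_measure {i : ℕ} {v : Val} {r : Str × Val}
    (h : r ∈ (v.measure i).support) : r.1.length ≤ 1 ∧ r.2.size = v.size := by
  cases v with
  | qreg n ψ =>
    simp only [measure] at h
    split_ifs at h
    · rw [PMF.mem_support_map_iff] at h
      obtain ⟨a, -, rfl⟩ := h
      simp [size]
    · rw [PMF.monad_pure_eq_pure, PMF.mem_support_pure_iff] at h
      simp [h, size]
  | _ =>
    simp only [measure, PMF.monad_pure_eq_pure, PMF.mem_support_pure_iff] at h
    simp [h]

end Val

namespace Mem

/-- The total size of the registers below `N`. -/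
def weight (N : ℕ) (s : Mem) : ℕ := ∑ x ∈ Finset.range N, (s.reg x).size

/-- Stated with both sizes added, so that no truncated subtraction occurs. -/
theorem weight_set {N x : ℕ} (hx : x < N) (s : Mem) (v : Val) :
    (s.set x v).weight N + (s.reg x).size = s.weight N + v.size := by
  have hx' : x ∈ Finset.range N := Finset.mem_range.mpr hx
  unfold weight
  rw [← Finset.add_sum_erase _ _ hx', ← Finset.add_sum_erase (Finset.range N) (fun x => (s.reg x).size) hx']
  have : ∑ y ∈ (Finset.range N).erase x, ((s.set x v).reg y).size =
      ∑ y ∈ (Finset.range N).erase x, (s.reg y).size :=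
    Finset.sum_congr rfl fun y hy => by rw [set_reg, if_neg (Finset.ne_of_mem_erase hy)]
  rw [this, set_reg, if_pos rfl]
  ring

theorem weight_tick (N : ℕ) (s : Mem) (k : ℕ) : (s.tick k).weight N = s.weight N := rfl

theorem size_reg_le_weight {N x : ℕ} (hx : x < N) (s : Mem) : (s.reg x).size ≤ s.weight N :=
  Finset.single_le_sum (f := fun x => (s.reg x).size) (fun _ _ => Nat.zero_le _)
    (Finset.mem_range.mpr hx)

theorem weight_start_le (N : ℕ) (v : Val) : (start v).weight N ≤ v.size + N := by
  have h : ∀ x, ((start v).reg x).size ≤ (if x = 0 then v.size else 0) + 1 := by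
    intro x
    simp only [start]
    split_ifs <;> simp [Val.size]
  refine (Finset.sum_le_sum fun x _ => h x).trans ?_
  rw [Finset.sum_add_distrib, Finset.sum_const, Finset.card_range, smul_eq_mul, mul_one]
  gcongr
  rw [Finset.sum_ite_eq']
  split_ifs <;> simp

end Mem

theorem iterate_support {α : Type} {F : α → PMF α} {J : α → Prop}
    (h : ∀ a, J a → ∀ b ∈ (F a).support, J b) (k : ℕ) (a : α) (ha : J a) :
    ∀ b ∈ (iterate F k a).support, J b := by
  induction k generalizing a with
  | zero =>
    intro b hb
    simp only [iterate, PMF.monad_pure_eq_pure, PMF.mem_support_pure_iff] at hb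
    exact hb ▸ ha
  | succ k ih =>
    intro b hb
    simp only [iterate, PMF.monad_bind_eq_bind, PMF.mem_support_bind_iff] at hb
    obtain ⟨c, hc, hb⟩ := hb
    exact ih c (h a ha c hc) b hb

/-- A property of oracle states and running times that is preserved by queries is preserved by
programs, and the total size of the registers grows at most by three per step. -/
theorem run_invariant {Θ : Type} (O : Oracle Θ) (I : Θ → ℕ → Prop)
    (mono : ∀ θ k k', k ≤ k' → I θ k → I θ k')
    (hO : ∀ θ k q, I θ k → ∀ p ∈ (O θ q).support, I p.1 (k + 1 + q.length + p.2.length))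
    (N C : ℕ) (c : Cmd) (hc : c.bound ≤ N) (p : Θ × Mem)
    (hp : I p.1 p.2.steps ∧ p.2.weight N ≤ C + 3 * p.2.steps) :
    ∀ p' ∈ (run O c p).support, I p'.1 p'.2.steps ∧ p'.2.weight N ≤ C + 3 * p'.2.steps := by
  induction c generalizing p with
  | seq c d ihc ihd =>
    simp only [Cmd.bound] at hc
    intro p' hp'
    simp only [run, PMF.monad_bind_eq_bind, PMF.mem_support_bind_iff] at hp'
    obtain ⟨q, hq, hp'⟩ := hp'
    exact ihd (by omega) q (ihc (by omega) p hp q hq) p' hp'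
  | ite x c d ihc ihd =>
    simp only [Cmd.bound] at hc
    intro p' hp'
    have h1 : I p.1 (p.2.tick 1).steps ∧ (p.2.tick 1).weight N ≤ C + 3 * (p.2.tick 1).steps :=
      ⟨mono _ _ _ (by simp) hp.1, by simp only [Mem.weight_tick, Mem.tick_steps]; omega⟩
    simp only [run] at hp'
    split_ifs at hp'
    · exact ihc (by omega) _ h1 p' hp'
    · exact ihd (by omega) _ h1 p' hp'
  | loop x c ih =>
    simp only [Cmd.bound] at hc
    intro p' hp'
    have h1 : I p.1 (p.2.tick 1).steps ∧ (p.2.tick 1).weight N ≤ C + 3 * (p.2.tick 1).steps :=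
      ⟨mono _ _ _ (by simp) hp.1, by simp only [Mem.weight_tick, Mem.tick_steps]; omega⟩
    simp only [run] at hp'
    exact iterate_support (J := fun p : Θ × Mem => I p.1 p.2.steps ∧ p.2.weight N ≤ C + 3 * p.2.steps)
      (fun q hq => ih (by omega) q hq) _ (p.1, p.2.tick 1) h1 p' hp'
  | query x y =>
    simp only [Cmd.bound] at hc
    intro p' hp'
    simp only [run, PMF.monad_bind_eq_bind, PMF.mem_support_bind_iff, PMF.monad_pure_eq_pure,
      PMF.mem_support_pure_iff] at hp'
    obtain ⟨q, hq, rfl⟩ := hp'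
    refine ⟨mono _ _ _ ?_ (hO _ _ _ hp.1 q hq), ?_⟩
    · simp only [Mem.tick_steps, Mem.set_steps]; omega
    · have h1 := Mem.weight_set (show x < N by omega) p.2 (.str q.2)
      simp only [Mem.weight_tick, Mem.tick_steps, Mem.set_steps]
      simp only [Val.size] at h1
      omega
  | meas y x i =>
    simp only [Cmd.bound] at hc
    intro p' hp'
    simp only [run, PMF.monad_bind_eq_bind, PMF.mem_support_bind_iff, PMF.monad_pure_eq_pure,
      PMF.mem_support_pure_iff] at hp'
    obtain ⟨q, hq, rfl⟩ := hp'
    have h0 := Val.size_of_mem_support_measure hq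
    refine ⟨mono _ _ _ ?_ hp.1, ?_⟩
    · simp only [Mem.tick_steps, Mem.set_steps]; omega
    · have h1 := Mem.weight_set (show x < N by omega) p.2 q.2
      have h2 := Mem.weight_set (show y < N by omega) (p.2.set x q.2) (.str q.1)
      simp only [Mem.weight_tick, Mem.tick_steps, Mem.set_steps]
      simp only [Val.size] at h2
      omega
  | _ =>
    simp only [Cmd.bound] at hc
    intro p' hp'
    simp only [run, PMF.monad_pure_eq_pure, PMF.mem_support_pure_iff] at hp'
    subst hp'
    refine ⟨mono _ _ _ ?_ hp.1, ?_⟩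
    · simp only [Mem.tick_steps, Mem.set_steps]; omega
    · simp only [Mem.weight_tick, Mem.tick_steps, Mem.set_steps]
      -- Three units of weight per step always suffice: `node`, for example, adds one pair and
      -- leaves two empty strings behind, and a string operation has read all the bits that it at
      -- most doubles.
      first
      | omega
      | rename_i x s
        have h1 := Mem.weight_set (show x < N by omega) p.2 (.str s)
        simp only [Val.size] at h1
        omega
      | rename_i o x y z
        have h1 := Mem.weight_set (show x < N by omega) p.2 (.str (o.eval (p.2.get y) (p.2.get z)))
        have h2 := o.length_eval_le (p.2.get y) (p.2.get z)
        simp only [Val.size] at h1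
        omega
      | rename_i x y
        have h1 := Mem.weight_set (show x < N by omega) p.2
          (.str (List.replicate (p.2.reg y).size true))
        simp only [Val.size, List.length_replicate] at h1
        omega
      | rename_i x y
        have h1 := Mem.weight_set (show x < N by omega) p.2 (.str [(p.2.reg y).isNode])
        simp only [Val.size, List.length_singleton] at h1
        omega
      | rename_i x y
        have h1 := Mem.weight_set (show y < N by omega) p.2 (.str [])
        have h2 := Mem.weight_set (show x < N by omega) (p.2.set y (.str [])) (p.2.reg y)
        simp only [Val.size, List.length_nil] at h1
        omega
      | rename_i x y z
        have h1 := Mem.weight_set (show y < N by omega) p.2 (.str [])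
        have h2 := Mem.weight_set (show z < N by omega) (p.2.set y (.str [])) (.str [])
        have h3 := Mem.weight_set (show x < N by omega) ((p.2.set y (.str [])).set z (.str []))
          ((p.2.reg y).node ((p.2.set y (.str [])).reg z))
        simp only [Val.size, List.length_nil] at h1 h2 h3
        omega
      | rename_i x y z
        have h1 := Mem.weight_set (show z < N by omega) p.2 (.str [])
        have h2 := Mem.weight_set (show x < N by omega) (p.2.set z (.str [])) (p.2.reg z).left
        have h3 := Mem.weight_set (show y < N by omega)
          ((p.2.set z (.str [])).set x (p.2.reg z).left) (p.2.reg z).right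
        have h4 := (p.2.reg z).size_left_add_right_le
        simp only [Val.size, List.length_nil] at h1
        omega
      | rename_i x
        have h1 := Mem.weight_set (show x < N by omega) p.2 (.qreg 1 QState.zero)
        simp only [Val.size] at h1
        omega
      | rename_i x y
        have h1 := Mem.weight_set (show y < N by omega) p.2 (.str [])
        have h2 := Mem.weight_set (show x < N by omega) (p.2.set y (.str []))
          (Val.merge ((p.2.set y (.str [])).reg x) (p.2.reg y))
        have h3 := Val.size_merge_le ((p.2.set y (.str [])).reg x) (p.2.reg y)
        simp only [Val.size, List.length_nil] at h1
        omega
      | rename_i g x i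
        have h1 := Mem.weight_set (show x < N by omega) p.2
          ((p.2.reg x).mapQ (g.apply (p.2.get i).length))
        rw [Val.size_mapQ] at h1
        omega
      | rename_i x i j
        have h1 := Mem.weight_set (show x < N by omega) p.2
          ((p.2.reg x).mapQ (cnotApply (p.2.get i).length (p.2.get j).length))
        rw [Val.size_mapQ] at h1
        omega

/-- Time bounds size, so that time bounds alone control compositions of programs. The term `c.bound`
accounts for the registers that are empty at the start. -/
theorem size_exec_le {c : Cmd} {v : Val} {s : Mem} (hs : s ∈ (exec c v).support) :
    (s.reg 0).size ≤ v.size + c.bound + 3 * s.steps := by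
  rw [exec, PMF.mem_support_map_iff] at hs
  obtain ⟨p, hp, rfl⟩ := hs
  have h := run_invariant noOracle (fun _ _ => True) (fun _ _ _ _ h => h) (fun _ _ _ _ _ _ => trivial)
    c.bound (v.size + c.bound) c le_rfl ((), Mem.start v)
    ⟨trivial, (Mem.weight_start_le _ _).trans (Nat.le_add_right _ _)⟩ p hp
  exact (Mem.size_reg_le_weight c.bound_pos _).trans h.2

/-! ### Changing the oracle -/

theorem iterate_bind_comm {α β : Type} (φ : α → PMF β) (F : α → PMF α) (G : β → PMF β)
    (h : ∀ a, (F a).bind φ = (φ a).bind G) (k : ℕ) (a : α) :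
    (iterate F k a).bind φ = (φ a).bind (iterate G k) := by
  induction k generalizing a with
  | zero => simp [iterate, PMF.monad_pure_eq_pure, PMF.pure_bind]
  | succ k ih =>
    simp only [iterate, PMF.monad_bind_eq_bind, PMF.bind_bind, ih]
    rw [← PMF.bind_bind, h, PMF.bind_bind]

/-- If a random map `φ` of the states commutes with the answers of two oracles, then it commutes with
running programs with these oracles. -/
theorem run_bind_oracle {Θ₁ Θ₂ : Type} (O₁ : Oracle Θ₁) (O₂ : Oracle Θ₂) (φ : Θ₁ → PMF Θ₂)
    (h : ∀ θ w, (O₁ θ w).bind (fun r => (φ r.1).map fun θ' => (θ', r.2)) =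
      (φ θ).bind fun θ' => O₂ θ' w) (c : Cmd) (θ : Θ₁) (s : Mem) :
    (run O₁ c (θ, s)).bind (fun p => (φ p.1).map fun θ' => (θ', p.2)) =
      (φ θ).bind fun θ' => run O₂ c (θ', s) := by
  induction c generalizing θ s with
  | seq c d ihc ihd =>
    simp only [run, PMF.monad_bind_eq_bind, PMF.bind_bind]
    simp only [ihd]
    rw [← PMF.bind_bind, ← ihc, PMF.bind_bind]
    congr 1
    funext p
    rw [PMF.bind_map]
    rfl
  | ite x c d ihc ihd =>
    simp only [run]
    split_ifs
    · exact ihc _ _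
    · exact ihd _ _
  | loop x c ih =>
    simp only [run]
    rw [iterate_bind_comm (fun p : Θ₁ × Mem => (φ p.1).map fun θ' => (θ', p.2)) (run O₁ c)
      (run O₂ c) (fun p => by rw [ih p.1 p.2, PMF.bind_map]; rfl), PMF.bind_map]
    rfl
  | query x y =>
    simp only [run, PMF.monad_bind_eq_bind, PMF.monad_pure_eq_pure, PMF.bind_bind, PMF.pure_bind]
    rw [← PMF.bind_bind, ← h, PMF.bind_bind]
    congr 1
    funext p
    rw [PMF.bind_map, ← PMF.bind_pure_comp]
    rfl
  | meas y x i =>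
    simp only [run, PMF.monad_bind_eq_bind, PMF.monad_pure_eq_pure, PMF.bind_bind, PMF.pure_bind]
    -- The measurement and the random map `φ` use independent randomness.
    rw [PMF.bind_comm]
    congr 1
  | _ =>
    simp only [run, PMF.monad_pure_eq_pure, PMF.pure_bind]
    rfl

/-! ### Polynomial bounds -/

theorem Polynomial.eval_nat_mono (P : Polynomial ℕ) : Monotone fun n => P.eval n := by
  intro m n h
  simp only [Polynomial.eval_eq_sum, Polynomial.sum]
  gcongr

theorem polyBounded_const (k : ℕ) : PolyBounded fun _ => k := ⟨.C k, fun n => by simp⟩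

theorem polyBounded_id : PolyBounded fun n => n := ⟨.X, fun n => by simp⟩

theorem Polynomial.polyBounded_eval (P : Polynomial ℕ) : PolyBounded fun n => P.eval n :=
  ⟨P, fun _ => le_rfl⟩

namespace PolyBounded

variable {p q : ℕ → ℕ}

theorem add (hp : PolyBounded p) (hq : PolyBounded q) : PolyBounded fun n => p n + q n := by
  obtain ⟨P, hP⟩ := hp
  obtain ⟨Q, hQ⟩ := hq
  exact ⟨P + Q, fun n => by rw [Polynomial.eval_add]; exact add_le_add (hP n) (hQ n)⟩

theorem mul (hp : PolyBounded p) (hq : PolyBounded q) : PolyBounded fun n => p n * q n := by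
  obtain ⟨P, hP⟩ := hp
  obtain ⟨Q, hQ⟩ := hq
  exact ⟨P * Q, fun n => by rw [Polynomial.eval_mul]; exact Nat.mul_le_mul (hP n) (hQ n)⟩

theorem comp (hp : PolyBounded p) (hq : PolyBounded q) : PolyBounded fun n => p (q n) := by
  obtain ⟨P, hP⟩ := hp
  obtain ⟨Q, hQ⟩ := hq
  exact ⟨P.comp Q, fun n => by
    rw [Polynomial.eval_comp]; exact (hP _).trans (P.eval_nat_mono (hQ n))⟩

end PolyBounded

/-! ### Programs as maps of values -/

/-- The result and the running time of a program without oracle. -/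
noncomputable def Cmd.sem (c : Cmd) (v : Val) : PMF (Val × ℕ) :=
  (exec c v).map fun s => (s.reg 0, s.steps)

theorem size_sem_le {c : Cmd} {v : Val} {r : Val × ℕ} (hr : r ∈ (c.sem v).support) :
    r.1.size ≤ v.size + c.bound + 3 * r.2 := by
  rw [Cmd.sem, PMF.mem_support_map_iff] at hr
  obtain ⟨s, hs, rfl⟩ := hr
  exact size_exec_le hs

theorem run_call_sem {Θ : Type} (O : Oracle Θ) (c : Cmd) (b : ℕ) (θ : Θ) (M : Mem)
    (hM : ∀ x, b < x → x ≤ b + c.bound → M.reg x = .str []) :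
    run O (c.call b) (θ, M) = (c.sem (M.reg b)).map fun r =>
      (θ, (M.set b r.1).tick (r.2 + c.bound)) := by
  rw [run_call O c b θ M hM, Cmd.sem, PMF.map_comp]
  rfl

theorem Mem.start_reg (v : Val) (x : ℕ) : (start v).reg x = if x = 0 then v else .str [] := rfl

theorem Mem.start_steps (v : Val) : (start v).steps = 0 := rfl

namespace Cmd

/-- Sequential composition. -/
def comp (c d : Cmd) : Cmd := seq (c.call 0) (d.call 0)

theorem sem_comp (c d : Cmd) (v : Val) :
    (comp c d).sem v = (c.sem v).bind fun r => (d.sem r.1).map fun r' =>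
      (r'.1, r.2 + c.bound + (r'.2 + d.bound)) := by
  have h1 : ∀ x, 0 < x → x ≤ 0 + c.bound → (Mem.start v).reg x = .str [] := by
    intro x hx _
    rw [Mem.start_reg, if_neg (by omega)]
  rw [comp, sem, exec, run, PMF.monad_bind_eq_bind, run_call_sem _ _ _ _ _ h1, PMF.bind_map,
    PMF.map_bind, PMF.map_bind]
  congr 1
  funext r
  have h2 : ∀ x, 0 < x → x ≤ 0 + d.bound →
      (((Mem.start v).set 0 r.1).tick (r.2 + c.bound)).reg x = .str [] := by
    intro x hx _
    rw [Mem.tick_reg, Mem.set_reg, if_neg (by omega), Mem.start_reg, if_neg (by omega)]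
  simp only [Function.comp, run_call_sem _ _ _ _ _ h2, PMF.map_comp]
  congr 1
  funext r'
  simp [Mem.set_reg, Mem.start_steps]

/-- The program acts on the first component of a pair. -/
def first (c : Cmd) : Cmd := seq (split 1 0 0) (seq (c.call 1) (node 0 1 0))

theorem sem_first (c : Cmd) (v : Val) :
    (first c).sem v = (c.sem v.left).map fun r => (.node r.1 v.right, r.2 + c.bound + 2) := by
  rw [first, sem, exec]
  simp only [run, PMF.monad_bind_eq_bind, PMF.monad_pure_eq_pure, PMF.pure_bind]
  rw [run_call_sem, PMF.bind_map, PMF.map_bind, PMF.map_bind, ← PMF.bind_pure_comp]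
  · simp only [Function.comp, PMF.pure_map, Mem.tick_reg, Mem.set_reg, Mem.start_reg, Mem.tick_steps, Mem.set_steps, Mem.start_steps]
    simp only [if_true, one_ne_zero, zero_ne_one, if_false]
    congr 1
    funext r
    congr 2
    omega
  · intro x hx _
    simp only [Mem.tick_reg, Mem.set_reg, Mem.start_reg]
    split_ifs <;> first | rfl | omega

/-- Case distinction by a bit string in the first component of a pair. -/
def cond (c d : Cmd) : Cmd := seq (split 0 1 0) (seq (ite 0 (c.call 1) (d.call 1)) (move 0 1))

theorem sem_cond (c d : Cmd) (v : Val) :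
    (cond c d).sem v = if v.left.toStr.head? = some true
      then (c.sem v.right).map fun r => (r.1, r.2 + c.bound + 3)
      else (d.sem v.right).map fun r => (r.1, r.2 + d.bound + 3) := by
  rw [cond, sem, exec]
  simp only [run, PMF.monad_bind_eq_bind, PMF.monad_pure_eq_pure, PMF.pure_bind]
  simp only [Mem.get, Mem.tick_reg, Mem.set_reg, Mem.start_reg, if_true, zero_ne_one, if_false]
  split_ifs
  all_goals
    rw [run_call_sem, PMF.bind_map, PMF.map_bind, PMF.map_bind, ← PMF.bind_pure_comp]
    · simp only [Function.comp, PMF.pure_map, Mem.tick_reg, Mem.set_reg, Mem.start_reg, Mem.tick_steps, Mem.set_steps, Mem.start_steps]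
      simp only [if_true, one_ne_zero, zero_ne_one, if_false]
      congr 1
      funext r
      congr 2
      omega
    · intro x hx _
      simp only [Mem.tick_reg, Mem.set_reg, Mem.start_reg]
      split_ifs <;> first | rfl | omega

/-- The program acts on the second component of a pair, as often as the length of the bit string in
the first component says. -/
def rep (c : Cmd) : Cmd := seq (split 0 1 0) (seq (loop 0 (c.call 1)) (move 0 1))

/-- The clock is part of the iterated state. It starts at `2`, for `split` and the entry into the
loop, and the final `move` costs one more step. -/
theorem sem_rep (c : Cmd) (v : Val) :
    (rep c).sem v = (iterate (fun r : Val × ℕ => (c.sem r.1).map fun r' =>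
      (r'.1, r.2 + (r'.2 + c.bound))) v.left.toStr.length (v.right, 2)).map
        fun r => (r.1, r.2 + 1) := by
  rw [rep, sem, exec]
  simp only [run, PMF.monad_bind_eq_bind, PMF.monad_pure_eq_pure, PMF.pure_bind]
  simp only [Mem.get, Mem.tick_reg, Mem.set_reg, Mem.start_reg, if_true, zero_ne_one, if_false]
  let e : Val × ℕ → Unit × Mem := fun r =>
    ((), ⟨fun x => if x = 0 then v.left else if x = 1 then r.1 else .str [], r.2⟩)
  have h := iterate_congr_map e (fun r : Val × ℕ => (c.sem r.1).map fun r' =>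
      (r'.1, r.2 + (r'.2 + c.bound))) (run noOracle (c.call 1)) (fun r => by
        simp only [e]
        rw [run_call_sem, PMF.map_comp]
        · simp only [one_ne_zero, if_true, if_false]
          congr 1
          funext r'
          simp only [Function.comp]
          congr 1
          refine Mem.ext' (fun x => ?_) rfl
          simp only [Mem.tick_reg, Mem.set_reg]
          split_ifs <;> first | rfl | omega
        · intro x hx _
          simp only
          split_ifs <;> first | rfl | omega) v.left.toStr.length (v.right, 2)
  have he : e (v.right, 2) = ((), ((((Mem.start v).set 0 (Val.str [])).set 0 v.left).set 1 v.right |>.tick 1).tick 1) := by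
    simp only [e]
    congr 1
    refine Mem.ext' (fun x => ?_) rfl
    simp only [Mem.tick_reg, Mem.set_reg, Mem.start_reg]
    split_ifs <;> first | rfl | omega
  rw [← he, h, PMF.bind_map, PMF.map_bind, PMF.map_bind, ← PMF.bind_pure_comp]
  simp only [Function.comp, PMF.pure_map, e, Mem.tick_reg, Mem.set_reg, Mem.tick_steps, Mem.set_steps,
    if_true, one_ne_zero, if_false]
  rfl

end Cmd

/-! ### Closure properties of quantum polynomial time maps -/

namespace IsQPT

variable {α β γ δ : Type} [Enc α] [Enc β] [Enc γ] [Enc δ]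

theorem of_sem {f : α → PMF β} (c : Cmd) {p : ℕ → ℕ} (hp : PolyBounded p)
    (h : ∀ a : α, (c.sem (Enc.enc a)).map Prod.fst = (f a).map (Enc.enc : β → Val))
    (hs : ∀ a : α, ∀ r ∈ (c.sem (Enc.enc a)).support, r.2 ≤ p (Enc.enc a).size) : IsQPT f := by
  obtain ⟨P, hP⟩ := hp
  refine ⟨c, P, fun a => ⟨?_, fun s hs' => ?_⟩⟩
  · rw [← h, Cmd.sem, PMF.map_comp]; rfl
  · refine (hs a (s.reg 0, s.steps) ?_).trans (hP _)
    rw [Cmd.sem, PMF.mem_support_map_iff]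
    exact ⟨s, hs', rfl⟩

/-- A single monotone bound serves for the running time and, by `size_sem_le`, for the size of the
result. Monotonicity allows it to be applied to upper bounds of sizes. -/
theorem exists_sem {f : α → PMF β} (hf : IsQPT f) : ∃ (c : Cmd) (p : ℕ → ℕ), PolyBounded p ∧
    Monotone p ∧ (∀ a : α, (c.sem (Enc.enc a)).map Prod.fst = (f a).map (Enc.enc : β → Val)) ∧
    ∀ a : α, ∀ r ∈ (c.sem (Enc.enc a)).support,
      r.2 ≤ p (Enc.enc a).size ∧ r.1.size ≤ p (Enc.enc a).size := by
  obtain ⟨c, P, h⟩ := hf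
  refine ⟨c, fun n => n + c.bound + 3 * P.eval n, ?_, ?_, fun a => ?_, fun a r hr => ?_⟩
  · exact (polyBounded_id.add (polyBounded_const _)).add ((polyBounded_const 3).mul P.polyBounded_eval)
  · intro m n hmn
    have := P.eval_nat_mono hmn
    simp only at this ⊢
    omega
  · rw [← (h a).1, Cmd.sem, PMF.map_comp]; rfl
  · have h1 := size_sem_le hr
    rw [Cmd.sem, PMF.mem_support_map_iff] at hr
    obtain ⟨s, hs, rfl⟩ := hr
    have h2 := (h a).2 s hs
    simp only at h1 ⊢
    omega

/-- On encoded inputs every possible result of the program is again an encoding, so the bounds of a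
following program apply to it. -/
theorem mem_support_of_sem {f : α → PMF β} {c : Cmd} {a : α}
    (h : (c.sem (Enc.enc a)).map Prod.fst = (f a).map (Enc.enc : β → Val)) {r : Val × ℕ}
    (hr : r ∈ (c.sem (Enc.enc a)).support) : ∃ b ∈ (f a).support, Enc.enc b = r.1 := by
  have : r.1 ∈ ((c.sem (Enc.enc a)).map Prod.fst).support := by
    rw [PMF.mem_support_map_iff]; exact ⟨r, hr, rfl⟩
  rwa [h, PMF.mem_support_map_iff] at this

theorem bind_sem {f : α → PMF β} {c : Cmd} {a : α} {X : Type}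
    (h : (c.sem (Enc.enc a)).map Prod.fst = (f a).map (Enc.enc : β → Val)) (g : Val → PMF X) :
    ((c.sem (Enc.enc a)).bind fun r => g r.1) = (f a).bind fun b => g (Enc.enc b) := by
  calc ((c.sem (Enc.enc a)).bind fun r => g r.1)
      = ((c.sem (Enc.enc a)).map Prod.fst).bind g := by rw [PMF.bind_map]; rfl
    _ = _ := by rw [h, PMF.bind_map]; rfl

theorem size_le {f : α → PMF β} (hf : IsQPT f) : ∃ p : ℕ → ℕ, PolyBounded p ∧ Monotone p ∧
    ∀ a, ∀ b ∈ (f a).support, (Enc.enc b).size ≤ p (Enc.enc a).size := by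
  obtain ⟨c, p, hp, hm, h, hs⟩ := hf.exists_sem
  refine ⟨p, hp, hm, fun a b hb => ?_⟩
  have : Enc.enc b ∈ ((c.sem (Enc.enc a)).map Prod.fst).support := by
    rw [h, PMF.mem_support_map_iff]; exact ⟨b, hb, rfl⟩
  rw [PMF.mem_support_map_iff] at this
  obtain ⟨r, hr, hrb⟩ := this
  rw [← hrb]
  exact (hs a r hr).2

/-- Composition of randomized maps. -/
theorem comp {g : β → PMF γ} {f : α → PMF β} (hg : IsQPT g) (hf : IsQPT f) :
    IsQPT fun a => (f a).bind g := by
  obtain ⟨c, p, hp, -, hc, hcs⟩ := hf.exists_sem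
  obtain ⟨d, q, hq, hqm, hd, hds⟩ := hg.exists_sem
  refine of_sem (c.comp d) (p := fun n => p n + c.bound + (q (p n) + d.bound))
    ((hp.add (polyBounded_const _)).add ((hq.comp hp).add (polyBounded_const _)))
    (fun a => ?_) (fun a r hr => ?_)
  · rw [Cmd.sem_comp, PMF.map_bind]
    simp only [PMF.map_comp, Function.comp_def]
    rw [bind_sem (hc a) fun w => (d.sem w).map Prod.fst, PMF.map_bind]
    simp only [hd]
  · rw [Cmd.sem_comp, PMF.mem_support_bind_iff] at hr
    obtain ⟨r₁, hr₁, hr⟩ := hr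
    rw [PMF.mem_support_map_iff] at hr
    obtain ⟨r₂, hr₂, rfl⟩ := hr
    obtain ⟨b, -, hb⟩ := mem_support_of_sem (hc a) hr₁
    have h1 := hcs a r₁ hr₁
    rw [← hb] at hr₂ h1
    have h2 := (hds b r₂ hr₂).1.trans (hqm h1.2)
    simp only
    omega

theorem first {f : α → PMF β} (hf : IsQPT f) :
    IsQPT fun a : α × γ => (f a.1).map fun b => (b, a.2) := by
  obtain ⟨c, p, hp, hm, hc, hcs⟩ := hf.exists_sem
  refine of_sem c.first (p := fun n => p n + c.bound + 2)
    ((hp.add (polyBounded_const _)).add (polyBounded_const _)) (fun a => ?_) (fun a r hr => ?_)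
  · change (c.first.sem (.node (Enc.enc a.1) (Enc.enc a.2))).map Prod.fst = _
    rw [Cmd.sem_first, PMF.map_comp, PMF.map_comp]
    change ((c.sem (Enc.enc a.1)).map ((fun v => Val.node v (Enc.enc a.2)) ∘ Prod.fst)) = _
    rw [← PMF.map_comp, hc, PMF.map_comp]
    rfl
  · change r ∈ (c.first.sem (.node (Enc.enc a.1) (Enc.enc a.2))).support at hr
    rw [Cmd.sem_first, PMF.mem_support_map_iff] at hr
    obtain ⟨r₁, hr₁, rfl⟩ := hr
    have h1 := (hcs a.1 r₁ hr₁).1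
    have h2 : p (Enc.enc a.1).size ≤ p (Enc.enc a).size := hm (by
      change _ ≤ (Val.node (Enc.enc a.1) (Enc.enc a.2)).size
      simp only [Val.size]; omega)
    simp only
    omega

theorem cond {f g : α → PMF β} (hf : IsQPT f) (hg : IsQPT g) :
    IsQPT fun a : Bool × α => if a.1 then f a.2 else g a.2 := by
  obtain ⟨c, p, hp, hpm, hc, hcs⟩ := hf.exists_sem
  obtain ⟨d, q, hq, hqm, hd, hds⟩ := hg.exists_sem
  have hsz : ∀ a : Bool × α, (Enc.enc a.2).size ≤ (Enc.enc a).size := fun a => by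
    change _ ≤ (Val.node (Enc.enc a.1) (Enc.enc a.2)).size
    simp only [Val.size]; omega
  refine of_sem (c.cond d) (p := fun n => (p n + c.bound + 3) + (q n + d.bound + 3))
    (((hp.add (polyBounded_const _)).add (polyBounded_const _)).add
      ((hq.add (polyBounded_const _)).add (polyBounded_const _)))
    (fun a => ?_) (fun a r hr => ?_)
  · change ((c.cond d).sem (.node (.str [a.1]) (Enc.enc a.2))).map Prod.fst = _
    rw [Cmd.sem_cond]
    simp only [Val.left, Val.right, Val.toStr, List.head?_cons, Option.some.injEq]
    split_ifs
    · rw [PMF.map_comp, ← hc]; rfl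
    · rw [PMF.map_comp, ← hd]; rfl
  · change r ∈ ((c.cond d).sem (.node (.str [a.1]) (Enc.enc a.2))).support at hr
    rw [Cmd.sem_cond] at hr
    have h1 := hpm (hsz a)
    have h2 := hqm (hsz a)
    simp only [Val.left, Val.right, Val.toStr, List.head?_cons, Option.some.injEq] at hr
    split_ifs at hr <;> rw [PMF.mem_support_map_iff] at hr <;> obtain ⟨r₁, hr₁, rfl⟩ := hr
    · have := (hcs a.2 r₁ hr₁).1
      simp only
      omega
    · have := (hds a.2 r₁ hr₁).1
      simp only
      omega

/-- The size hypothesis is essential: doubling a string takes polynomial time, but its iterates grow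
exponentially. -/
theorem rep {f : α → PMF α} (hf : IsQPT f) {q : ℕ → ℕ} (hq : PolyBounded q)
    (hsize : ∀ (w : Str) (a : α), ∀ k ≤ w.length, ∀ b ∈ (iterate f k a).support,
      (Enc.enc b).size ≤ q (Enc.enc (w, a)).size) :
    IsQPT fun a : Str × α => iterate f a.1.length a.2 := by
  obtain ⟨c, p, hp, hpm, hc, hcs⟩ := hf.exists_sem
  let F : Val × ℕ → PMF (Val × ℕ) := fun r =>
    (c.sem r.1).map fun r' => (r'.1, r.2 + (r'.2 + c.bound))
  let G : Val → PMF Val := fun v => (c.sem v).map Prod.fst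
  -- First the clock is forgotten, then values are replaced by the elements that they encode.
  have hF : ∀ k (a : α) t, (iterate F k (Enc.enc a, t)).map Prod.fst =
      (iterate f k a).map (Enc.enc : _ → Val) := fun k a t => by
    rw [← iterate_congr_map Prod.fst F G (fun r => by simp only [F, G, PMF.map_comp]; rfl),
      ← iterate_congr_map Enc.enc f G hc]
  have hB : ∀ (B k : ℕ) (a : α) (t : ℕ),
      (∀ j ≤ k, ∀ b ∈ (iterate f j a).support, (Enc.enc b).size ≤ B) →
      ∀ r ∈ (iterate F k (Enc.enc a, t)).support, r.2 ≤ t + k * (p B + c.bound) := by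
    intro B k
    induction k with
    | zero =>
      intro a t _ r hr
      simp only [iterate, PMF.monad_pure_eq_pure, PMF.mem_support_pure_iff] at hr
      simp [hr]
    | succ k ih =>
      intro a t hj r hr
      simp only [iterate, PMF.monad_bind_eq_bind, PMF.mem_support_bind_iff] at hr
      obtain ⟨r₁, hr₁, hr⟩ := hr
      simp only [F, PMF.mem_support_map_iff] at hr₁
      obtain ⟨r₂, hr₂, rfl⟩ := hr₁
      obtain ⟨b, hb, hb'⟩ := mem_support_of_sem (hc a) hr₂
      have h1 := (hcs a r₂ hr₂).1
      have h2 : p (Enc.enc a).size ≤ p B := hpm (hj 0 (Nat.zero_le _) a (by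
        simp [iterate, PMF.monad_pure_eq_pure]))
      rw [← hb'] at hr
      have h3 := ih b _ (fun j hjk b' hb' => hj (j + 1) (by omega) b' (by
        simp only [iterate, PMF.monad_bind_eq_bind, PMF.mem_support_bind_iff]
        exact ⟨b, hb, hb'⟩)) r hr
      rw [add_mul, one_mul]
      omega
  refine of_sem c.rep (p := fun n => 2 + n * (p (q n) + c.bound) + 1)
    (((polyBounded_const 2).add (polyBounded_id.mul ((hp.comp hq).add (polyBounded_const _)))).add
      (polyBounded_const 1)) (fun a => ?_) (fun a r hr => ?_)
  · change (c.rep.sem (.node (.str a.1) (Enc.enc a.2))).map Prod.fst = _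
    rw [Cmd.sem_rep, PMF.map_comp, ← hF _ _ 2]
    rfl
  · change r ∈ (c.rep.sem (.node (.str a.1) (Enc.enc a.2))).support at hr
    rw [Cmd.sem_rep, PMF.mem_support_map_iff] at hr
    obtain ⟨r₁, hr₁, rfl⟩ := hr
    have h1 := hB (q (Enc.enc a).size) a.1.length a.2 2 (fun j hj b hb => hsize a.1 a.2 j hj b hb)
      r₁ hr₁
    have h2 : a.1.length ≤ (Enc.enc a).size := by
      change _ ≤ (Val.node (.str a.1) (Enc.enc a.2)).size
      simp only [Val.size]; omega
    have h3 := Nat.mul_le_mul_right (p (q (Enc.enc a).size) + c.bound) h2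
    simp only
    omega

end IsQPT

/-! ### Deterministic polynomial time maps -/

/-- Deterministic maps that are computed in polynomial time. -/
def DPT {α β : Type} [Enc α] [Enc β] (f : α → β) : Prop :=
  IsQPT fun a => PMF.pure (f a)

/-- Types whose elements are represented by classical data, so that they can be copied. -/
class Copyable (α : Type) [Enc α] : Prop where
  dup : DPT fun a : α => (a, a)

section

variable {α β γ δ : Type} [Enc α] [Enc β] [Enc γ] [Enc δ]

theorem enc_prod (p : α × β) : (Enc.enc p : Val) = .node (Enc.enc p.1) (Enc.enc p.2) := rfl
theorem enc_str (s : Str) : (Enc.enc s : Val) = .str s := rfl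
theorem enc_val (v : Val) : Enc.enc v = v := rfl
theorem enc_bool (b : Bool) : (Enc.enc b : Val) = .str [b] := rfl
theorem enc_nat (n : ℕ) : (Enc.enc n : Val) = .str (List.replicate n true) := rfl

theorem DPT.of_exec {f : α → β} (c : Cmd) {p : ℕ → ℕ} (hp : PolyBounded p)
    (h : ∀ a, ∃ s, exec c (Enc.enc a) = PMF.pure s ∧ s.reg 0 = Enc.enc (f a) ∧
      s.steps ≤ p (Enc.enc a).size) : DPT f := by
  refine IsQPT.of_sem c hp (fun a => ?_) (fun a r hr => ?_) <;> obtain ⟨s, h, h0, hs⟩ := h a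
  · simp [Cmd.sem, h, PMF.pure_map, h0]
  · rw [Cmd.sem, h, PMF.pure_map, PMF.mem_support_pure_iff] at hr
    simp [hr, hs]

theorem polyBounded_linear (a b : ℕ) : PolyBounded fun n => a * n + b :=
  ((polyBounded_const a).mul polyBounded_id).add (polyBounded_const b)

namespace DPT

theorem of_enc_eq {f : α → β} (h : ∀ a, (Enc.enc (f a) : Val) = Enc.enc a) : DPT f := by
  refine of_exec .skip (polyBounded_linear 0 1) fun a =>
    ⟨(Mem.start (Enc.enc a)).tick 1, ?_, ?_, ?_⟩
  · simp [exec, run, PMF.monad_pure_eq_pure, PMF.pure_map]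
  · rw [h]; rfl
  · simp [Mem.start_steps]

theorem id : DPT fun a : α => a := of_enc_eq fun _ => rfl

theorem swap : DPT fun a : α × β => (a.2, a.1) := by
  refine of_exec (.seq (.split 1 0 0) (.node 0 0 1)) (polyBounded_linear 0 2) fun a => ⟨?_, ?_, ?_, ?_⟩
  -- The final memory is left open here; the goal that evaluates the program is treated first and
  -- determines it.
  rotate_left
  · simp only [exec, run, PMF.monad_pure_eq_pure, PMF.monad_bind_eq_bind, PMF.pure_bind,
      PMF.pure_map]
    rfl
  · simp [Mem.set_reg, Mem.start_reg, Val.left, Val.right, enc_prod]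
  · simp [Mem.start_steps]

theorem assoc : DPT fun a : (α × β) × γ => (a.1.1, (a.1.2, a.2)) := by
  refine of_exec (.seq (.split 0 1 0) (.seq (.split 0 2 0) (.seq (.node 2 2 1) (.node 0 0 2))))
    (polyBounded_linear 0 4) fun a => ⟨?_, ?_, ?_, ?_⟩
  rotate_left
  · simp only [exec, run, PMF.monad_pure_eq_pure, PMF.monad_bind_eq_bind, PMF.pure_bind,
      PMF.pure_map]
    rfl
  · simp [Mem.set_reg, Mem.start_reg, Val.left, Val.right, enc_prod]
  · simp [Mem.start_steps]

theorem assocInv : DPT fun a : α × (β × γ) => ((a.1, a.2.1), a.2.2) := by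
  refine of_exec (.seq (.split 0 1 0) (.seq (.split 1 2 1) (.seq (.node 0 0 1) (.node 0 0 2))))
    (polyBounded_linear 0 4) fun a => ⟨?_, ?_, ?_, ?_⟩
  rotate_left
  · simp only [exec, run, PMF.monad_pure_eq_pure, PMF.monad_bind_eq_bind, PMF.pure_bind,
      PMF.pure_map]
    rfl
  · simp [Mem.set_reg, Mem.start_reg, Val.left, Val.right, enc_prod]
  · simp [Mem.start_steps]

theorem fst : DPT fun a : α × β => a.1 := by
  refine of_exec (.split 0 1 0) (polyBounded_linear 0 1) fun a => ⟨?_, ?_, ?_, ?_⟩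
  rotate_left
  · simp only [exec, run, PMF.monad_pure_eq_pure, PMF.pure_map]
    rfl
  · simp [Mem.set_reg, Mem.start_reg, Val.left, enc_prod]
  · simp [Mem.start_steps]

theorem snd : DPT fun a : α × β => a.2 := by
  refine of_exec (.split 1 0 0) (polyBounded_linear 0 1) fun a => ⟨?_, ?_, ?_, ?_⟩
  rotate_left
  · simp only [exec, run, PMF.monad_pure_eq_pure, PMF.pure_map]
    rfl
  · simp [Mem.set_reg, Mem.start_reg, Val.right, enc_prod]
  · simp [Mem.start_steps]

theorem withStr (s : Str) : DPT fun a : α => (a, s) := by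
  refine of_exec (.seq (.const 1 s) (.node 0 0 1)) (polyBounded_linear 0 (2 + s.length)) fun a => ⟨?_, ?_, ?_, ?_⟩
  rotate_left
  · simp only [exec, run, PMF.monad_pure_eq_pure, PMF.monad_bind_eq_bind, PMF.pure_bind,
      PMF.pure_map]
    rfl
  · simp [Mem.set_reg, Mem.start_reg, enc_prod, enc_str]
  · simp only [Mem.tick_steps, Mem.set_steps, Mem.start_steps]; omega

theorem op (o : StrOp) : DPT fun a : Str × Str => o.eval a.1 a.2 := by
  refine of_exec (.seq (.split 0 1 0) (.op o 0 0 1)) (polyBounded_linear 1 2) fun a => ⟨?_, ?_, ?_, ?_⟩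
  rotate_left
  · simp only [exec, run, PMF.monad_pure_eq_pure, PMF.monad_bind_eq_bind, PMF.pure_bind,
      PMF.pure_map]
    rfl
  · simp [Mem.set_reg, Mem.start_reg, Mem.get, Val.left, Val.right, Val.toStr, enc_prod, enc_str]
  · simp [Mem.start_steps, Mem.get, Mem.set_reg, Mem.start_reg, Val.left, Val.right, Val.toStr,
      enc_prod, enc_str, Val.size]
    omega

theorem withSize : DPT fun a : α => (a, List.replicate (Enc.enc a).size true) := by
  refine of_exec (.seq (.size 1 0) (.node 0 0 1)) (polyBounded_linear 1 2) fun a => ⟨?_, ?_, ?_, ?_⟩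
  rotate_left
  · simp only [exec, run, PMF.monad_pure_eq_pure, PMF.monad_bind_eq_bind, PMF.pure_bind,
      PMF.pure_map]
    rfl
  · simp [Mem.set_reg, Mem.start_reg, enc_prod, enc_str]
  · simp [Mem.start_steps, Mem.start_reg]; omega

theorem withIsNode : DPT fun v : Val => (v, v.isNode) := by
  refine of_exec (.seq (.isNode 1 0) (.node 0 0 1)) (polyBounded_linear 0 2) fun a => ⟨?_, ?_, ?_, ?_⟩
  rotate_left
  · simp only [exec, run, PMF.monad_pure_eq_pure, PMF.monad_bind_eq_bind, PMF.pure_bind,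
      PMF.pure_map]
    rfl
  · simp [Mem.set_reg, Mem.start_reg, enc_prod, enc_val, enc_bool]
  · simp [Mem.start_steps]

theorem split : DPT fun v : Val => (v.left, v.right) := by
  refine of_exec (.seq (.split 0 1 0) (.node 0 0 1)) (polyBounded_linear 0 2) fun a => ⟨?_, ?_, ?_, ?_⟩
  rotate_left
  · simp only [exec, run, PMF.monad_pure_eq_pure, PMF.monad_bind_eq_bind, PMF.pure_bind,
      PMF.pure_map]
    rfl
  · simp [Mem.set_reg, Mem.start_reg, enc_prod, enc_val]
  · simp [Mem.start_steps]

theorem toStr : DPT Val.toStr := by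
  refine of_exec (.op .copy 0 0 1) (polyBounded_linear 1 1) fun a => ⟨?_, ?_, ?_, ?_⟩
  rotate_left
  · simp only [exec, run, PMF.monad_pure_eq_pure, PMF.pure_map]
    rfl
  · simp [Mem.set_reg, Mem.start_reg, Mem.get, StrOp.eval, enc_val, enc_str]
  · have := a.length_toStr_lt
    simp [Mem.start_steps, Mem.get, Mem.start_reg, enc_val, Val.toStr]
    change _ + a.toStr.length ≤ _
    omega

theorem comp {g : β → γ} {f : α → β} (hg : DPT g) (hf : DPT f) : DPT fun a => g (f a) := by
  have h := IsQPT.comp hg hf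
  simp only [PMF.pure_bind] at h
  exact h

theorem first {f : α → β} (hf : DPT f) : DPT fun a : α × γ => (f a.1, a.2) := by
  have h := IsQPT.first (γ := γ) hf
  simp only [PMF.pure_map] at h
  exact h

end DPT

namespace IsQPT

theorem precomp {g : β → PMF γ} {f : α → β} (hg : IsQPT g) (hf : DPT f) :
    IsQPT fun a => g (f a) := by
  have h := IsQPT.comp hg hf
  simpa only [PMF.pure_bind] using h

theorem map {f : α → PMF β} {g : β → γ} (hf : IsQPT f) (hg : DPT g) : IsQPT fun a => (f a).map g :=
  IsQPT.comp hg hf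

theorem second {f : α → PMF β} (hf : IsQPT f) :
    IsQPT fun a : γ × α => (f a.2).map fun b => (a.1, b) := by
  have h := (hf.first (γ := γ).precomp DPT.swap).map DPT.swap
  simpa only [PMF.map_comp, Function.comp_def] using h

end IsQPT

theorem DPT.second {f : α → β} (hf : DPT f) : DPT fun a : γ × α => (a.1, f a.2) := by
  have h := IsQPT.second (γ := γ) hf
  simp only [PMF.pure_map] at h
  exact h

theorem DPT.copy_of_str {e : α → Str} (h : ∀ a, (Enc.enc a : Val) = .str (e a)) :
    DPT fun a : α => (a, a) := by
  refine of_exec (.seq (.op .copy 1 0 2) (.node 0 0 1)) (polyBounded_linear 1 2) fun a => ⟨?_, ?_, ?_, ?_⟩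
  rotate_left
  · simp only [exec, run, PMF.monad_pure_eq_pure, PMF.monad_bind_eq_bind, PMF.pure_bind,
      PMF.pure_map]
    rfl
  · simp [Mem.set_reg, Mem.start_reg, enc_prod, h, Mem.get, StrOp.eval, Val.toStr]
  · simp [Mem.start_steps, Mem.start_reg, Mem.get, h, Val.toStr, Val.size]
    omega

end

instance : Copyable Str := ⟨DPT.copy_of_str fun _ => rfl⟩
instance : Copyable Bool := ⟨DPT.copy_of_str fun _ => rfl⟩
instance {α β : Type} [Enc α] [Enc β] [Copyable α] [Copyable β] : Copyable (α × β) := by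
  refine ⟨?_⟩
  have h1 := ((Copyable.dup (α := α)).first (γ := β)).comp (DPT.id (α := α × β))
  have h2 := ((Copyable.dup (α := β)).second (γ := α × α)).comp h1
  -- `((a, a), (b, b))` becomes `((a, b), (a, b))`
  have h3 := DPT.assoc.comp h2
  have h4 := (DPT.assocInv.second (γ := α)).comp h3
  have h5 := ((DPT.swap.first (γ := β)).second (γ := α)).comp h4
  have h6 := (DPT.assoc.second (γ := α)).comp h5
  exact DPT.assocInv.comp h6

section

variable {α β γ δ : Type} [Enc α] [Enc β] [Enc γ] [Enc δ]

namespace IsQPT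

/-- A map that depends on a linear argument and on a copyable context, which is kept. -/
theorem withCtx [Copyable γ] {f : α × γ → PMF β} (hf : IsQPT f) :
    IsQPT fun a : α × γ => (f a).map fun b => (b, a.2) := by
  have h := (hf.first (γ := γ)).precomp
    (DPT.assocInv.comp ((Copyable.dup (α := γ)).second (γ := α)))
  exact h

/-- Case distinction by a condition on a copyable context. -/
theorem iteCtx [Copyable γ] {f g : α × γ → PMF β} {b : γ → Bool} (hb : DPT b) (hf : IsQPT f)
    (hg : IsQPT g) : IsQPT fun a : α × γ => if b a.2 then f a else g a := by
  have h0 : DPT fun a : α × γ => (b a.2, a) := by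
    have h1 := DPT.assocInv.comp ((Copyable.dup (α := γ)).second (γ := α))
    have h2 := DPT.swap.comp ((hb.second (γ := α × γ)).comp h1)
    exact h2
  exact (hf.cond hg).precomp h0

theorem bind [Copyable α] {f : α → PMF β} {g : α × β → PMF γ} (hf : IsQPT f) (hg : IsQPT g) :
    IsQPT fun a : α => (f a).bind fun b => g (a, b) := by
  have h := hg.comp ((hf.second (γ := α)).precomp Copyable.dup)
  simpa only [PMF.bind_map, Function.comp_def] using h

theorem ite [Copyable α] {f g : α → PMF β} {b : α → Bool} (hb : DPT b) (hf : IsQPT f)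
    (hg : IsQPT g) : IsQPT fun a : α => if b a then f a else g a :=
  (hf.cond hg).precomp ((hb.first (γ := α)).comp Copyable.dup)

end IsQPT

namespace DPT

theorem prodMk [Copyable α] {f : α → β} {g : α → γ} (hf : DPT f) (hg : DPT g) :
    DPT fun a => (f a, g a) :=
  ((hf.first (γ := γ)).comp (hg.second (γ := α))).comp Copyable.dup

theorem comp₂ [Copyable α] {f : β × γ → δ} {g : α → β} {h : α → γ} (hf : DPT f) (hg : DPT g)
    (hh : DPT h) : DPT fun a => f (g a, h a) := hf.comp (hg.prodMk hh)

theorem const (s : Str) : DPT fun _ : α => s := snd.comp (withStr s)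

theorem ite [Copyable α] {f g : α → β} {b : α → Bool} (hb : DPT b) (hf : DPT f) (hg : DPT g) :
    DPT fun a => if b a then f a else g a := by
  have h := IsQPT.ite hb hf hg
  have e : (fun a => PMF.pure (if b a then f a else g a)) =
      fun a => if b a then PMF.pure (f a) else PMF.pure (g a) := by
    funext a; split_ifs <;> rfl
  rw [DPT, e]
  exact h

end DPT

end

/-! ### Booleans, strings and lists of strings -/

section

variable {α β γ δ α' β' : Type} [Enc α] [Enc β] [Enc γ] [Enc δ] [Enc α'] [Enc β']

/-- A program sees only encodings, so types with equal encodings may be exchanged: a `Bool` is a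
string of one bit, a list of strings is its code, a finite set is its sorted list. -/
theorem IsQPT.congr_enc {f : α → PMF β} {f' : α' → PMF β'} (hf : IsQPT f') (e : α → α')
    (he : ∀ a, (Enc.enc (e a) : Val) = Enc.enc a)
    (h : ∀ a, (f a).map (Enc.enc : β → Val) = (f' (e a)).map (Enc.enc : β' → Val)) : IsQPT f := by
  obtain ⟨c, P, hc⟩ := hf
  refine ⟨c, P, fun a => ?_⟩
  rw [h, ← he]
  exact hc (e a)

theorem DPT.congr_enc {f : α → β} {f' : α' → β'} (hf : DPT f') (e : α → α')
    (he : ∀ a, (Enc.enc (e a) : Val) = Enc.enc a)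
    (h : ∀ a, (Enc.enc (f a) : Val) = Enc.enc (f' (e a))) : DPT f :=
  IsQPT.congr_enc hf e he fun a => by simp only [PMF.pure_map, h]

namespace DPT

theorem eq : DPT fun a : Str × Str => decide (a.1 = a.2) :=
  (op .eq).congr_enc (fun a => a) (fun _ => rfl) fun _ => rfl

theorem pair : DPT fun a : Str × Str => pairStr a.1 a.2 := op .pair

theorem append : DPT fun a : Str × Str => a.1 ++ a.2 := op .append

theorem unary (o : StrOp) : DPT fun s : Str => o.eval s [] := (op o).comp (withStr [])

theorem unpairFst : DPT fun s : Str => (unpairStr s).1 := unary .fst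

theorem unpairSnd : DPT fun s : Str => (unpairStr s).2 := unary .snd

theorem tail : DPT fun s : Str => s.drop 1 := unary .tail

theorem boolConst (b : Bool) : DPT fun _ : α => b :=
  (const (α := α) [b]).congr_enc (fun a => a) (fun _ => rfl) fun _ => rfl

theorem and [Copyable α] {f g : α → Bool} (hf : DPT f) (hg : DPT g) : DPT fun a => f a && g a := by
  have h := ite hf hg (boolConst (α := α) false)
  have e : (fun a => f a && g a) = fun a => if f a then g a else false := by
    funext a; cases f a <;> rfl
  rw [e]
  exact h

theorem not {f : α → Bool} (hf : DPT f) : DPT fun a => !f a := by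
  have h := ((ite (α := Bool) id (boolConst false) (boolConst true)).comp hf)
  have e : (fun a => !f a) = fun a => if f a then false else true := by
    funext a; cases f a <;> rfl
  rw [e]
  exact h

theorem or [Copyable α] {f g : α → Bool} (hf : DPT f) (hg : DPT g) : DPT fun a => f a || g a := by
  have h := ite hf (boolConst (α := α) true) hg
  have e : (fun a => f a || g a) = fun a => if f a then true else g a := by
    funext a; cases f a <;> rfl
  rw [e]
  exact h

end DPT

instance : Enc (List Str) := ⟨fun l => .str (encodeList l)⟩

theorem enc_list (l : List Str) : (Enc.enc l : Val) = .str (encodeList l) := rfl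

instance : Copyable (List Str) := ⟨DPT.copy_of_str fun _ => rfl⟩

theorem encodeList_append (l l' : List Str) :
    encodeList (l ++ l') = encodeList l ++ encodeList l' := by
  have h : ∀ x y z : Str, pairStr x (y ++ z) = pairStr x y ++ z := by
    intro x y z
    induction x with
    | nil => simp [pairStr]
    | cons b x ih => simp [pairStr, ih]
  induction l with
  | nil => rfl
  | cons x l ih => simp [encodeList, ih, h]

theorem encodeList_eq_nil_iff (l : List Str) : encodeList l = [] ↔ l = [] := by
  cases l with
  | nil => simp [encodeList]
  | cons x l => cases x <;> simp [encodeList, pairStr]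

theorem length_le_length_encodeList (l : List Str) : l.length ≤ (encodeList l).length := by
  induction l with
  | nil => simp
  | cons x l ih => simp only [encodeList, length_pairStr, List.length_cons]; omega

namespace DPT

theorem listAsStr : DPT encodeList := of_enc_eq fun _ => rfl

theorem cons : DPT fun a : Str × List Str => a.1 :: a.2 :=
  pair.congr_enc (fun a => (a.1, encodeList a.2)) (fun _ => rfl) fun _ => rfl

theorem nil : DPT fun _ : α => ([] : List Str) :=
  (const (α := α) []).congr_enc (fun a => a) (fun _ => rfl) fun _ => rfl

theorem listHead : DPT fun l : List Str => l.headD [] :=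
  unpairFst.congr_enc encodeList (fun _ => rfl) fun l => by
    cases l with
    | nil => simp [encodeList, unpairStr]
    | cons x l => simp [encodeList, unpairStr_pairStr]

theorem listTail : DPT fun l : List Str => l.tail :=
  unpairSnd.congr_enc encodeList (fun _ => rfl) fun l => by
    cases l with
    | nil => simp [encodeList, unpairStr, enc_list, enc_str]
    | cons x l => simp [encodeList, unpairStr_pairStr, enc_list, enc_str]

theorem listIsNil : DPT fun l : List Str => decide (l = []) :=
  (eq.comp (withStr (α := Str) [])).congr_enc encodeList (fun _ => rfl) fun l => by
    simp [encodeList_eq_nil_iff]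

theorem listSnoc : DPT fun a : List Str × Str => a.1 ++ [a.2] :=
  (append.comp ((pair.comp (withStr [])).second (γ := Str))).congr_enc
    (fun a => (encodeList a.1, a.2)) (fun _ => rfl) fun a => by
      simp [enc_list, enc_str, encodeList_append, encodeList]

end DPT

/-! ### Loops over lists -/

theorem iterate_eq_of_fixed {X : Type} {f : X → PMF X} {a : X} (h : f a = PMF.pure a) (k : ℕ) :
    iterate f k a = PMF.pure a := by
  induction k with
  | zero => rfl
  | succ k ih => simp only [iterate, PMF.monad_bind_eq_bind, h, PMF.pure_bind, ih]

/-- The loop runs once for each bit of the encoded list, which is at least once for each entry;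
superfluous rounds change nothing. The growth of the accumulator is paid for by the entry that is
removed, so the size of the accumulator plus `C + 1` times the length of the remaining list never
increases. -/
theorem IsQPT.foldlM {F : β × Str → PMF β} (hF : IsQPT F) (C : ℕ)
    (hsize : ∀ b x, ∀ b' ∈ (F (b, x)).support,
      (Enc.enc b').size ≤ (Enc.enc b).size + C * (x.length + 1)) :
    IsQPT fun a : List Str × β => a.1.foldlM (fun b x => F (b, x)) a.2 := by
  let T : β × List Str → PMF (β × List Str) := fun a =>
    if decide (a.2 = []) then PMF.pure a
    else ((F (a.1, a.2.headD [])).map fun b => (b, a.2)).map fun a => (a.1, a.2.tail)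
  have hT : IsQPT T := iteCtx DPT.listIsNil (DPT.id (α := β × List Str))
    (((hF.precomp (DPT.listHead.second (γ := β))).withCtx).map (DPT.listTail.second (γ := β)))
  have hT0 : ∀ b, T (b, []) = PMF.pure (b, []) := fun b => by simp [T]
  have hT1 : ∀ b x l, T (b, x :: l) = (F (b, x)).map fun b' => (b', l) := fun b x l => by
    simp [T, PMF.map_comp, Function.comp_def]
  have hiter : ∀ (l : List Str) (k : ℕ) (b : β), l.length ≤ k →
      iterate T k (b, l) = (l.foldlM (fun b x => F (b, x)) b).map fun b' => (b', []) := by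
    intro l
    induction l with
    | nil =>
      intro k b _
      rw [iterate_eq_of_fixed (hT0 b)]
      simp [PMF.monad_pure_eq_pure, PMF.pure_map]
    | cons x l ih =>
      intro k b hk
      obtain ⟨k, rfl⟩ : ∃ j, k = j + 1 := ⟨k - 1, by simp at hk; omega⟩
      simp only [iterate, PMF.monad_bind_eq_bind, hT1, List.foldlM_cons, PMF.bind_map, PMF.map_bind]
      congr 1
      funext b'
      exact ih k b' (by simpa using hk)
  have hrep := hT.rep (q := fun n => (C + 1) * n + 2) (polyBounded_linear _ _) (by
    intro w a k _ a' ha'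
    have := iterate_support (F := T) (J := fun a' : β × List Str =>
      (Enc.enc a'.1).size + (C + 1) * (encodeList a'.2).length ≤
        (Enc.enc a.1).size + (C + 1) * (encodeList a.2).length) (by
        rintro ⟨b, l⟩ h a' ha'
        cases l with
        | nil =>
          rw [hT0, PMF.mem_support_pure_iff] at ha'
          rw [ha']; exact h
        | cons x l =>
          rw [hT1, PMF.mem_support_map_iff] at ha'
          obtain ⟨b', hb', rfl⟩ := ha'
          have h1 := hsize b x b' hb'
          simp only [encodeList, length_pairStr] at h ⊢
          nlinarith) k a le_rfl a' ha'
    simp only [enc_prod, enc_list, enc_str, Val.size]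
    nlinarith)
  have h0 : DPT fun a : List Str × β => (encodeList a.1, (a.2, a.1)) := by
    have h1 := DPT.assoc.comp ((Copyable.dup (α := List Str)).first (γ := β))
    have h2 := (DPT.listAsStr.first (γ := List Str × β)).comp h1
    exact (DPT.swap.second (γ := Str)).comp h2
  have h := (hrep.precomp h0).map DPT.fst
  have e : (fun a : List Str × β => a.1.foldlM (fun b x => F (b, x)) a.2) = fun a =>
      (iterate T (encodeList a.1).length (a.2, a.1)).map Prod.fst := by
    funext a
    rw [hiter _ _ _ (length_le_length_encodeList _), PMF.map_comp]
    exact (PMF.map_id _).symm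
  rw [e]
  exact h

theorem PMF.foldlM_pure {X Y : Type} (f : X → Y → X) (l : List Y) (b : X) :
    l.foldlM (fun b x => PMF.pure (f b x)) b = PMF.pure (l.foldl f b) := by
  induction l generalizing b with
  | nil => rfl
  | cons x l ih => simp only [List.foldlM_cons, PMF.monad_bind_eq_bind, PMF.pure_bind, ih,
      List.foldl_cons]

theorem iterate_pure {X : Type} (f : X → X) (k : ℕ) (a : X) :
    iterate (fun a => PMF.pure (f a)) k a = PMF.pure (f^[k] a) := by
  induction k generalizing a with
  | zero => rfl
  | succ k ih => simp only [iterate, PMF.monad_bind_eq_bind, PMF.pure_bind, ih,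
      Function.iterate_succ, Function.comp]

namespace DPT

theorem foldl {f : β × Str → β} (hf : DPT f) (C : ℕ)
    (hsize : ∀ b x, (Enc.enc (f (b, x))).size ≤ (Enc.enc b).size + C * (x.length + 1)) :
    DPT fun a : List Str × β => a.1.foldl (fun b x => f (b, x)) a.2 := by
  have h := IsQPT.foldlM hf C (fun b x b' hb' => by
    rw [PMF.mem_support_pure_iff] at hb'
    rw [hb']; exact hsize b x)
  simp only [PMF.foldlM_pure] at h
  exact h

theorem rep {f : α → α} (hf : DPT f) {q : ℕ → ℕ} (hq : PolyBounded q)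
    (hsize : ∀ (w : Str) (a : α), ∀ k ≤ w.length,
      (Enc.enc (f^[k] a)).size ≤ q (Enc.enc (w, a)).size) :
    DPT fun a : Str × α => f^[a.1.length] a.2 := by
  have h := IsQPT.rep hf hq (fun w a k hk b hb => by
    rw [iterate_pure, PMF.mem_support_pure_iff] at hb
    rw [hb]; exact hsize w a k hk)
  simp only [iterate_pure] at h
  exact h

theorem reverse : DPT fun l : List Str => l.reverse := by
  have h := (foldl (β := List Str) (f := fun a => a.2 :: a.1) (cons.comp swap) 3 (fun b x => by
    simp only [enc_list, encodeList, Val.size, length_pairStr]; omega)).comp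
      (id.prodMk (nil (α := List Str)))
  have e : (fun l : List Str => l.reverse) = fun l => l.foldl (fun b x => x :: b) [] := by
    funext l; simp
  rw [e]
  exact h

theorem mem : DPT fun a : Str × List Str => decide (a.1 ∈ a.2) := by
  have hf : DPT fun a : (Str × Bool) × Str => (a.1.1, a.1.2 || decide (a.1.1 = a.2)) :=
    (fst.comp fst).prodMk ((snd.comp fst).or (eq.comp₂ (fst.comp fst) snd))
  have h := (snd.comp ((foldl hf 0 (fun b x => by simp [enc_prod, enc_bool, Val.size])))).comp
    (snd.prodMk (fst.prodMk (boolConst (α := Str × List Str) false)))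
  have e : (fun a : Str × List Str => decide (a.1 ∈ a.2)) = fun a =>
      (a.2.foldl (fun (b : Str × Bool) x => (b.1, b.2 || decide (b.1 = x))) (a.1, false)).2 := by
    funext ⟨x, l⟩
    have : ∀ b, (l.foldl (fun (b : Str × Bool) x => (b.1, b.2 || decide (b.1 = x))) (x, b)).2 =
        (b || decide (x ∈ l)) := by
      induction l with
      | nil => simp
      | cons y l ih => intro b; simp [ih, Bool.or_assoc]
    simp [this]
  rw [e]
  exact h

theorem subset : DPT fun a : List Str × List Str => decide (∀ x ∈ a.1, x ∈ a.2) := by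
  have hf : DPT fun a : (List Str × Bool) × Str => (a.1.1, a.1.2 && decide (a.2 ∈ a.1.1)) :=
    (fst.comp fst).prodMk ((snd.comp fst).and (mem.comp₂ snd (fst.comp fst)))
  have h := (snd.comp ((foldl hf 0 (fun b x => by simp [enc_prod, enc_bool, Val.size])))).comp
    (fst.prodMk (snd.prodMk (boolConst (α := List Str × List Str) true)))
  have e : (fun a : List Str × List Str => decide (∀ x ∈ a.1, x ∈ a.2)) = fun a =>
      (a.1.foldl (fun (b : List Str × Bool) x => (b.1, b.2 && decide (x ∈ b.1))) (a.2, true)).2 := by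
    funext ⟨l, l'⟩
    have : ∀ b, (l.foldl (fun (b : List Str × Bool) x => (b.1, b.2 && decide (x ∈ b.1))) (l', b)).2 =
        (b && decide (∀ x ∈ l, x ∈ l')) := by
      induction l with
      | nil => simp
      | cons y l ih => intro b; simp [ih, Bool.and_assoc]
    simp [this]
  rw [e]
  exact h

theorem listDrop : DPT fun a : Str × List Str => a.2.drop a.1.length := by
  have h := rep (f := List.tail (α := Str)) listTail (polyBounded_linear 1 0) (fun w l k _ => by
    have : ∀ k (l : List Str), (encodeList (List.tail^[k] l)).length ≤ (encodeList l).length := by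
      intro k
      induction k with
      | zero => simp
      | succ k ih =>
        intro l
        refine (ih l.tail).trans ?_
        cases l with
        | nil => simp
        | cons x l => simp only [List.tail_cons, encodeList, length_pairStr]; omega
    have := this k l
    simp only [enc_prod, enc_list, enc_str, Val.size]
    omega)
  have e : ∀ k (l : List Str), List.tail^[k] l = l.drop k := by
    intro k
    induction k with
    | zero => simp
    | succ k ih => intro l; rw [Function.iterate_succ, Function.comp, ih]; simp
  simp only [e] at h
  exact h

theorem strDrop : DPT fun a : Str × Str => a.2.drop a.1.length := by
  have e : ∀ k (l : Str), (fun s : Str => s.drop 1)^[k] l = l.drop k := by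
    intro k
    induction k with
    | zero => simp
    | succ k ih => intro l; rw [Function.iterate_succ, Function.comp, ih, List.drop_drop, add_comm]
  have h := rep tail (polyBounded_linear 1 0) (fun w l k _ => by
    rw [e]
    simp only [enc_prod, enc_str, Val.size, List.length_drop]
    omega)
  simp only [e] at h
  exact h

/-- Each component uses up at least one bit, so `|w|` rounds suffice. Twice the length of the rest
plus the length of the encoded accumulator does not grow, by `length_fst_unpairStr_add_le`; this
bounds all intermediate sizes. -/
theorem decode : DPT decodeList := by
  let T : Str × List Str → Str × List Str := fun a =>
    if decide (a.1 = []) then a else ((unpairStr a.1).2, a.2 ++ [(unpairStr a.1).1])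
  have hT : DPT T := ite (eq.comp₂ fst (const (α := Str × List Str) [])) id
    ((unpairSnd.comp fst).prodMk (listSnoc.comp₂ snd (unpairFst.comp fst)))
  have hT0 : ∀ acc, T ([], acc) = ([], acc) := fun acc => by simp [T]
  have hiter : ∀ (k : ℕ) (w : Str) (acc : List Str), w.length ≤ k →
      T^[k] (w, acc) = ([], acc ++ decodeList w) := by
    intro k
    induction k with
    | zero =>
      intro w acc hw
      obtain rfl : w = [] := by simpa using hw
      simp [decodeList]
    | succ k ih =>
      intro w acc hw
      cases w with
      | nil =>
        rw [Function.iterate_succ, Function.comp, hT0, ih _ _ (by simp)]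
      | cons c w =>
        have := length_snd_unpairStr_lt c w
        rw [Function.iterate_succ, Function.comp, decodeList]
        simp only [T, reduceCtorEq, decide_false, Bool.false_eq_true, if_false]
        rw [ih _ _ (by omega)]
        simp
  have hrep := hT.rep (polyBounded_linear 2 0) (fun w a k _ => by
    have : ∀ a : Str × List Str, 2 * (T a).1.length + (encodeList (T a).2).length ≤
        2 * a.1.length + (encodeList a.2).length := by
      rintro ⟨w, acc⟩
      cases w with
      | nil => rw [hT0]
      | cons c w =>
        have h1 := length_snd_unpairStr_lt c w
        have h2 := length_fst_unpairStr_add_le (c :: w)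
        simp only [T, reduceCtorEq, decide_false, Bool.false_eq_true, if_false, encodeList_append,
          encodeList, length_pairStr, List.length_append, List.length_nil]
        omega
    have : ∀ k (a : Str × List Str), 2 * (T^[k] a).1.length + (encodeList (T^[k] a).2).length ≤
        2 * a.1.length + (encodeList a.2).length := by
      intro k
      induction k with
      | zero => simp
      | succ k ih => intro a; exact (ih (T a)).trans (this a)
    have := this k a
    simp only [enc_prod, enc_str, enc_list, Val.size]
    omega)
  have h := (snd.comp hrep).comp
    ((id (α := Str)).prodMk (id.prodMk (nil (α := Str))))
  simp only [hiter _ _ _ le_rfl, List.nil_append] at h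
  exact h

end DPT

end

/-! ### Coins -/

/-- A uniformly random bit. -/
noncomputable def coin : PMF Bool := PMF.uniformOfFintype Bool

theorem norm_sq_proj_hadamard_zero (b : Bool) :
    ‖QState.proj 0 b (QState.hadamard 0 QState.zero)‖ ^ 2 = 1 / 2 := by
  have h2 : ‖((Real.sqrt 2 : ℝ) : ℂ)⁻¹‖ ^ 2 = 1 / 2 := by
    rw [norm_inv, Complex.norm_real, Real.norm_of_nonneg (Real.sqrt_nonneg _), inv_pow,
      Real.sq_sqrt (by norm_num)]
    norm_num
  have hu : ∀ f : Fin 1 → Bool, f = (fun _ => f 0) := fun f => by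
    funext i; rw [Subsingleton.elim i 0]
  rw [EuclideanSpace.norm_sq_eq, ← (Equiv.funUnique (Fin 1) Bool).symm.sum_comp]
  simp only [Fintype.sum_bool]
  have ht : (fun _ : Fin 1 => true) ≠ fun _ => false := fun h => by simpa using congrFun h 0
  have hf1 : QState.flip (0 : Fin 1) (fun _ => true) = fun _ => false := by
    rw [hu (QState.flip _ _)]; simp [QState.flip]
  have hf2 : QState.flip (0 : Fin 1) (fun _ => false) = fun _ => true := by
    rw [hu (QState.flip _ _)]; simp [QState.flip]
  have e : ∀ c, (Equiv.funUnique (Fin 1) Bool).symm c = fun _ => c := fun c => rfl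
  simp only [e, QState.proj, QState.hadamard, QState.zero, hf1, hf2, PiLp.single_apply, ht,
    if_true, if_false]
  cases b <;> simp

/-- The bit is the outcome of measuring the Hadamard transform of `|0⟩`. -/
theorem IsQPT.coin {α : Type} [Enc α] : IsQPT fun _ : α => coin := by
  have h0 : (Val.measure 0 (.qreg 1 (QState.hadamard 0 QState.zero))).map
      (fun r => Val.str r.1) = _root_.coin.map (Enc.enc : Bool → Val) := by
    simp only [Val.measure, zero_lt_one, dif_pos, PMF.map_comp, QState.measure]
    have : (PMF.ofFintype (fun b => ENNReal.ofReal (‖QState.proj 0 b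
        (QState.hadamard 0 QState.zero)‖ ^ 2)) (by
          rw [Fintype.sum_bool, ← ENNReal.ofReal_add (sq_nonneg _) (sq_nonneg _),
            QState.sum_norm_sq_proj, ENNReal.ofReal_one])) = _root_.coin := by
      ext b
      rw [PMF.ofFintype_apply, norm_sq_proj_hadamard_zero, _root_.coin,
        PMF.uniformOfFintype_apply, Fintype.card_bool, one_div,
        ENNReal.ofReal_inv_of_pos (by norm_num)]
      norm_num
    exact congrArg (PMF.map _) this
  refine of_sem (.seq (.const 1 []) (.seq (.qnew 0) (.seq (.gate .H 0 1) (.meas 0 0 1)))) (polyBounded_linear 0 4)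
    (fun a => ?_) (fun a r hr => ?_)
  · rw [← h0]
    simp [Cmd.sem, exec, run, PMF.monad_bind_eq_bind, PMF.monad_pure_eq_pure,
      PMF.pure_bind, PMF.map_bind, PMF.pure_map, Mem.set_reg, Mem.get, Val.toStr, Val.mapQ,
      Gate.apply]
    rfl
  · simp only [Cmd.sem, exec, run, PMF.monad_bind_eq_bind, PMF.monad_pure_eq_pure,
      PMF.pure_bind, PMF.map_bind, PMF.pure_map, PMF.mem_support_bind_iff,
      PMF.mem_support_pure_iff] at hr
    obtain ⟨x, -, rfl⟩ := hr
    simp [Mem.start_steps, Mem.get, Mem.set_reg, Val.toStr]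

/-! ### Rearrangements of tuples -/

section

variable {α β γ δ ε : Type} [Enc α] [Enc β] [Enc γ] [Enc δ] [Enc ε]

namespace DPT

theorem exchange : DPT fun a : (α × β) × (γ × δ) => ((a.1.1, a.2.1), (a.1.2, a.2.2)) := by
  refine of_exec (.seq (.split 0 1 0) (.seq (.split 0 2 0) (.seq (.split 1 3 1) (.seq (.node 0 0 1)
    (.seq (.node 2 2 3) (.node 0 0 2)))))) (polyBounded_linear 0 6) fun a => ⟨?_, ?_, ?_, ?_⟩
  rotate_left
  · simp only [exec, run, PMF.monad_pure_eq_pure, PMF.monad_bind_eq_bind, PMF.pure_bind,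
      PMF.pure_map]
    rfl
  · simp [Mem.set_reg, Mem.start_reg, Val.left, Val.right, enc_prod]
  · simp [Mem.start_steps]

/-- Separates the two quantum parts of the key, which can only be moved, from the classical context
(public parameter, message, chain), which later steps may copy. -/
theorem signInput : DPT fun a : Str × Val × Str =>
    ((a.2.1.left, a.2.1.right.left), (a.1, (a.2.2, a.2.1.right.right.toStr))) := by
  refine of_exec (.seq (.split 0 1 0) (.seq (.split 1 2 1) (.seq (.split 1 3 1) (.seq (.split 3 4 3)
    (.seq (.op .copy 4 4 5) (.seq (.node 1 1 3) (.seq (.node 2 2 4) (.seq (.node 0 0 2)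
    (.node 0 1 0))))))))) (polyBounded_linear 1 9) fun a => ⟨?_, ?_, ?_, ?_⟩
  rotate_left
  · simp only [exec, run, PMF.monad_pure_eq_pure, PMF.monad_bind_eq_bind, PMF.pure_bind,
      PMF.pure_map]
    rfl
  · simp [Mem.set_reg, Mem.start_reg, Mem.get, StrOp.eval, enc_prod, enc_str, enc_val, Val.left,
      Val.right]
  · obtain ⟨pp, sk, m⟩ := a
    have h1 := sk.size_left_add_right_le
    have h2 := sk.right.size_left_add_right_le
    have h3 := sk.right.right.length_toStr_lt
    have h4 := sk.left.size_pos
    have h5 := sk.right.left.size_pos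
    simp [Mem.start_steps, Mem.get, Mem.set_reg, Mem.start_reg, enc_prod, enc_val, enc_str]
    change 4 + (1 + sk.right.right.toStr.length + 0) ≤
      (pp.length + 1 + (sk.size + (m.length + 1) + 1) + 1) + 5
    omega

/-- The current key comes to the front, where it is used for signing, and the new verification key
joins the context. -/
theorem afterKeyGen : DPT fun a : (α × β) × ((γ × δ) × ε) =>
    ((a.2.1.1, (a.2.1.2, a.1.1)), (a.1.2, a.2.2)) := by
  refine of_exec (.seq (.split 0 1 0) (.seq (.split 0 2 0) (.seq (.split 1 3 1) (.seq (.split 1 4 1)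
    (.seq (.node 4 4 0) (.seq (.node 1 1 4) (.seq (.node 2 2 3) (.node 0 1 2))))))))
    (polyBounded_linear 0 8) fun a => ⟨?_, ?_, ?_, ?_⟩
  rotate_left
  · simp only [exec, run, PMF.monad_pure_eq_pure, PMF.monad_bind_eq_bind, PMF.pure_bind,
      PMF.pure_map]
    rfl
  · simp [Mem.set_reg, Mem.start_reg, Val.left, Val.right, enc_prod]
  · simp [Mem.start_steps]

/-- The new key becomes the current one, and the key that has just signed joins the used ones. -/
theorem afterSign : DPT fun a : ((α × β) × (γ × δ)) × ε =>
    ((a.1.2.2, (a.1.1.1, a.1.2.1)), (a.1.1.2, a.2)) := by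
  refine of_exec (.seq (.split 0 1 0) (.seq (.split 0 2 0) (.seq (.split 0 3 0) (.seq (.split 2 4 2)
    (.seq (.node 0 0 2) (.seq (.node 4 4 0) (.seq (.node 3 3 1) (.node 0 4 3))))))))
    (polyBounded_linear 0 8) fun a => ⟨?_, ?_, ?_, ?_⟩
  rotate_left
  · simp only [exec, run, PMF.monad_pure_eq_pure, PMF.monad_bind_eq_bind, PMF.pure_bind,
      PMF.pure_map]
    rfl
  · simp [Mem.set_reg, Mem.start_reg, Val.left, Val.right, enc_prod]
  · simp [Mem.start_steps]

theorem insertLast : DPT fun a : (α × β) × (γ × δ) => ((a.1.1, (a.1.2, a.2.1)), a.2.2) :=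
  (assoc.first (γ := δ)).comp assocInv

end DPT

namespace IsQPT

/-- The result of a map that depends only on a copyable context is put in front. -/
theorem freshCtx [Copyable γ] {f : γ → PMF β} (hf : IsQPT f) :
    IsQPT fun a : α × γ => (f a.2).map fun b => (b, a) := by
  have h0 : DPT fun a : α × γ => (a.2, a) :=
    DPT.swap.comp (DPT.assocInv.comp ((Copyable.dup (α := γ)).second (γ := α)))
  exact (hf.first (γ := α × γ)).precomp h0

/-- A map acts on the first one of two linear arguments, in a copyable context. -/
theorem onFst [Copyable γ] {f : α × γ → PMF β} (hf : IsQPT f) :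
    IsQPT fun a : (α × δ) × γ => (f (a.1.1, a.2)).map fun b => ((b, a.1.2), a.2) := by
  have h := ((hf.first (γ := δ × γ)).precomp (DPT.exchange.comp
    ((Copyable.dup (α := γ)).second (γ := α × δ)))).map DPT.assocInv
  simp only [PMF.map_comp, Function.comp_def] at h
  exact h

end IsQPT

end

/-! ### The algorithms of the chain construction are quantum polynomial time -/

namespace DPT

theorem linkMsg : DPT fun w : Str => (decodeLink w).msg := unpairFst

theorem linkVk : DPT fun w : Str => (decodeLink w).vk := unpairFst.comp unpairSnd

theorem linkSig : DPT fun w : Str => (decodeLink w).sig := unpairSnd.comp unpairSnd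

theorem linkSigned : DPT fun w : Str => pairStr (decodeLink w).msg (decodeLink w).vk :=
  pair.comp₂ linkMsg linkVk

theorem linkMsgs : DPT fun l : List Str => l.map fun w => (decodeLink w).msg := by
  have hf : DPT fun a : List Str × Str => a.1 ++ [(decodeLink a.2).msg] :=
    listSnoc.comp (linkMsg.second (γ := List Str))
  have h := (foldl hf 2 (fun b x => by
    have := length_fst_unpairStr_add_le x
    simp only [enc_list, encodeList_append, encodeList, Val.size, length_pairStr, decodeLink,
      List.length_append, List.length_nil]
    omega)).comp (id.prodMk (nil (α := List Str)))
  have e : ∀ (l acc : List Str), l.foldl (fun b x => b ++ [(decodeLink x).msg]) acc =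
      acc ++ l.map fun w => (decodeLink w).msg := by
    intro l
    induction l with
    | nil => simp
    | cons x l ih => intro acc; simp [ih]
  simp only [e, List.nil_append] at h
  exact h

theorem listLength : DPT fun l : List Str => List.replicate l.length true := by
  have hf : DPT fun a : Str × Str => a.1 ++ [true] := append.comp₂ fst (const _)
  have h := (foldl hf 1 (fun b x => by
    simp only [enc_str, Val.size, List.length_append, List.length_singleton]; omega)).comp
      (id.prodMk (const (α := List Str) []))
  have e : ∀ (l : List Str) (acc : Str), l.foldl (fun b _ => b ++ [true]) acc =
      acc ++ List.replicate l.length true := by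
    intro l
    induction l with
    | nil => simp
    | cons x l ih => intro acc; simp [ih, List.replicate_succ]
  simp only [e, List.nil_append] at h
  exact h

end DPT

theorem length_decodeLink_le (w : Str) : 2 * (decodeLink w).msg.length +
    2 * (decodeLink w).vk.length + (decodeLink w).sig.length ≤ w.length := by
  have h1 := length_fst_unpairStr_add_le w
  have h2 := length_fst_unpairStr_add_le (unpairStr w).2
  simp only [decodeLink]
  omega

/-- A link is verified under the key stored in the next older link. The fold therefore starts from
the oldest link and carries this key along; as the verifications are independent, their order does
not matter. -/
theorem verChain_foldlM (OT : DSRKey) (pp vk : Str) (ls : List Str) :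
    ls.reverse.foldlM (fun (b : Str × (Str × Bool)) x =>
      (OT.ver b.1 b.2.1 (pairStr (decodeLink x).msg (decodeLink x).vk) (decodeLink x).sig).map
        fun r => (b.1, ((decodeLink x).vk, b.2.2 && r))) (pp, (vk, true)) =
    (verChain OT pp vk (ls.map decodeLink)).map fun b =>
      (pp, (tipVk vk (ls.map decodeLink), b)) := by
  induction ls with
  | nil => simp [verChain, PMF.monad_pure_eq_pure, PMF.pure_map, tipVk]
  | cons x ls ih =>
    rw [List.reverse_cons, List.foldlM_append, ih]
    simp only [List.foldlM_cons, List.foldlM_nil, PMF.monad_bind_eq_bind, PMF.monad_pure_eq_pure,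
      PMF.bind_pure, PMF.bind_map, List.map_cons, verChain, tipVk, PMF.map_bind, PMF.pure_map]
    rw [PMF.bind_comm]
    congr 1
    funext b
    simp only [Function.comp, ← PMF.bind_pure_comp]
    congr 1
    funext b'
    simp [Bool.and_comm]

theorem IsQPT.chainVer {OT : DSRKey} (h : OT.QPT) :
    IsQPT (fun a : Str × Str × Str × Str => (chainScheme OT).ver a.1 a.2.1 a.2.2.1 a.2.2.2) := by
  have hv := h.2.2.2.1
  have hF : IsQPT fun a : (Str × (Str × Bool)) × Str =>
      (OT.ver a.1.1 a.1.2.1 (pairStr (decodeLink a.2).msg (decodeLink a.2).vk)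
        (decodeLink a.2).sig).map fun r => (a.1.1, ((decodeLink a.2).vk, a.1.2.2 && r)) := by
    have h1 : DPT fun a : (Str × (Str × Bool)) × Str => (a.1.1, (a.1.2.1,
        (pairStr (decodeLink a.2).msg (decodeLink a.2).vk, (decodeLink a.2).sig))) :=
      (DPT.fst.comp DPT.fst).prodMk ((DPT.fst.comp (DPT.snd.comp DPT.fst)).prodMk
        ((DPT.linkSigned.comp DPT.snd).prodMk (DPT.linkSig.comp DPT.snd)))
    have h2 : DPT fun p : ((Str × (Str × Bool)) × Str) × Bool =>
        (p.1.1.1, ((decodeLink p.1.2).vk, p.1.1.2.2 && p.2)) :=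
      (DPT.fst.comp (DPT.fst.comp DPT.fst)).prodMk ((DPT.linkVk.comp (DPT.snd.comp DPT.fst)).prodMk
        ((DPT.snd.comp (DPT.snd.comp (DPT.fst.comp DPT.fst))).and DPT.snd))
    exact IsQPT.bind (hv.precomp h1) h2
  have hfold := hF.foldlM 1 (fun b x b' hb' => by
    rw [PMF.mem_support_map_iff] at hb'
    obtain ⟨r, -, rfl⟩ := hb'
    have := length_decodeLink_le x
    simp only [enc_prod, enc_str, enc_bool, Val.size, List.length_singleton]
    omega)
  have hl : DPT fun a : Str × Str × Str × Str => decodeList a.2.2.2 :=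
    DPT.decode.comp (DPT.snd.comp (DPT.snd.comp DPT.snd))
  have hchain := ((hfold.precomp ((DPT.reverse.comp hl).prodMk (DPT.fst.prodMk
    ((DPT.fst.comp DPT.snd).prodMk (DPT.boolConst true))))).map (DPT.snd.comp DPT.snd))
  have hmsg : DPT fun a : Str × Str × Str × Str =>
      decide (a.2.2.1 = (decodeLink ((decodeList a.2.2.2).headD [])).msg) :=
    DPT.eq.comp₂ (DPT.fst.comp (DPT.snd.comp DPT.snd)) (DPT.linkMsg.comp (DPT.listHead.comp hl))
  have hfalse : IsQPT fun _ : Str × Str × Str × Str => (PMF.pure false : PMF Bool) :=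
    DPT.boolConst false
  have h := IsQPT.ite (DPT.listIsNil.comp hl) hfalse (IsQPT.ite hmsg hchain hfalse)
  convert h using 2 with a
  simp only [verChain_foldlM, PMF.map_comp, Function.comp_def]
  simp only [chainScheme, decodeChain]
  cases decodeList a.2.2.2 with
  | nil => simp [PMF.monad_pure_eq_pure]
  | cons x l =>
    simp only [List.map_cons, List.headD_cons, decide_eq_true_eq, reduceCtorEq, if_false]
    by_cases hm : a.2.2.1 = (decodeLink x).msg
    · rw [if_pos hm]
      exact (PMF.map_id _).symm.trans (if_pos (decide_eq_true hm)).symm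
    · rw [if_neg hm]
      exact (if_neg fun h' => hm (of_decide_eq_true h')).symm

/-- The recursion ends in a mismatch, which overrides all earlier verdicts. -/
theorem certChain_of_length_ne (OT : DSRKey) (pp vk ck : Str) (cs : List Str) (ls : List Link)
    (h : cs.length ≠ ls.length) : certChain OT pp vk ck cs ls = PMF.pure false := by
  induction cs generalizing ls with
  | nil => cases ls <;> simp_all [certChain, PMF.monad_pure_eq_pure]
  | cons c cs ih =>
    cases ls with
    | nil => simp [certChain, PMF.monad_pure_eq_pure]
    | cons l ls =>
      simp only [certChain, ih ls (by simpa using h), PMF.monad_bind_eq_bind,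
        PMF.monad_pure_eq_pure, PMF.pure_bind, Bool.and_false, PMF.bind_const]

/-- The list `cs'` is what the fold does not consume; in the application it is `[c]`, the
certificate of the last key. The equality of lengths keeps the default value of `headD` out of play.
-/
theorem certChain_foldlM (OT : DSRKey) (pp vk ck : Str) (cs ls cs' : List Str)
    (h : cs.length = ls.length) :
    ls.reverse.foldlM (fun (b : (Str × Str) × (Str × (List Str × Bool))) x =>
      (OT.cert b.1.1 b.2.1 b.1.2 (b.2.2.1.headD [])
          {pairStr (decodeLink x).msg (decodeLink x).vk}).map
        fun r => (b.1, ((decodeLink x).vk, (b.2.2.1.tail, b.2.2.2 && r))))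
        ((pp, ck), (vk, (cs.reverse ++ cs', true))) =
    (certChain OT pp vk ck cs (ls.map decodeLink)).map fun b =>
      ((pp, ck), (tipVk vk (ls.map decodeLink), (cs', b))) := by
  induction ls generalizing cs cs' with
  | nil =>
    obtain rfl : cs = [] := by simpa using h
    simp [certChain, PMF.monad_pure_eq_pure, PMF.pure_map, tipVk]
  | cons x ls ih =>
    cases cs with
    | nil => simp at h
    | cons c cs =>
      simp only [List.reverse_cons, List.append_assoc]
      rw [List.foldlM_append, ih cs ([c] ++ cs') (by simpa using h)]
      simp only [List.foldlM_cons, List.foldlM_nil, PMF.monad_bind_eq_bind, PMF.monad_pure_eq_pure,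
        PMF.bind_pure, PMF.bind_map, List.map_cons, certChain, tipVk, PMF.map_bind, PMF.pure_map]
      rw [PMF.bind_comm]
      congr 1
      funext b
      simp only [Function.comp, ← PMF.bind_pure_comp]
      congr 1
      funext b'
      simp [Bool.and_comm]

theorem DPT.singleton : DPT fun s : Str => ({s} : Finset Str) :=
  (pair.comp (withStr (α := Str) [])).congr_enc (fun s => s) (fun _ => rfl) fun s => by
    change Val.str (encodeList ({s} : Finset Str).sort) = _
    simp [Finset.sort_singleton, encodeList, enc_str]

theorem DPT.empty {α : Type} [Enc α] : DPT fun _ : α => (∅ : Finset Str) :=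
  (const (α := α) []).congr_enc (fun s => s) (fun _ => rfl) fun s => by
    change Val.str (encodeList (∅ : Finset Str).sort) = _
    simp [Finset.sort_empty, encodeList, enc_str]

theorem IsQPT.chainCert {OT : DSRKey} (h : OT.QPT) :
    IsQPT (fun a : Str × Str × Str × Str × Finset Str =>
      (chainScheme OT).cert a.1 a.2.1 a.2.2.1 a.2.2.2.1 a.2.2.2.2) := by
  have hv := h.2.2.2.2.2
  have hF : IsQPT fun a : ((Str × Str) × (Str × (List Str × Bool))) × Str =>
      (OT.cert a.1.1.1 a.1.2.1 a.1.1.2 (a.1.2.2.1.headD [])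
          {pairStr (decodeLink a.2).msg (decodeLink a.2).vk}).map
        fun r => (a.1.1, ((decodeLink a.2).vk, (a.1.2.2.1.tail, a.1.2.2.2 && r))) := by
    have h1 : DPT fun a : ((Str × Str) × (Str × (List Str × Bool))) × Str =>
        (a.1.1.1, (a.1.2.1, (a.1.1.2, (a.1.2.2.1.headD [],
          ({pairStr (decodeLink a.2).msg (decodeLink a.2).vk} : Finset Str))))) :=
      (DPT.fst.comp (DPT.fst.comp DPT.fst)).prodMk ((DPT.fst.comp (DPT.snd.comp DPT.fst)).prodMk
        ((DPT.snd.comp (DPT.fst.comp DPT.fst)).prodMk ((DPT.listHead.comp (DPT.fst.comp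
          (DPT.snd.comp (DPT.snd.comp DPT.fst)))).prodMk
            (DPT.singleton.comp (DPT.linkSigned.comp DPT.snd)))))
    have h2 : DPT fun p : (((Str × Str) × (Str × (List Str × Bool))) × Str) × Bool =>
        (p.1.1.1, ((decodeLink p.1.2).vk, (p.1.1.2.2.1.tail, p.1.1.2.2.2 && p.2))) :=
      (DPT.fst.comp (DPT.fst.comp DPT.fst)).prodMk ((DPT.linkVk.comp (DPT.snd.comp DPT.fst)).prodMk
        ((DPT.listTail.comp (DPT.fst.comp (DPT.snd.comp (DPT.snd.comp (DPT.fst.comp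
          DPT.fst))))).prodMk ((DPT.snd.comp (DPT.snd.comp (DPT.snd.comp (DPT.fst.comp
            DPT.fst)))).and DPT.snd)))
    exact IsQPT.bind (hv.precomp h1) h2
  have hfold := hF.foldlM 1 (fun b x b' hb' => by
    rw [PMF.mem_support_map_iff] at hb'
    obtain ⟨r, -, rfl⟩ := hb'
    have h1 := length_decodeLink_le x
    have h2 : (encodeList b.2.2.1.tail).length ≤ (encodeList b.2.2.1).length := by
      cases b.2.2.1 with
      | nil => simp
      | cons y l => simp only [List.tail_cons, encodeList, length_pairStr]; omega
    simp only [enc_prod, enc_str, enc_bool, enc_list, Val.size, List.length_singleton]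
    omega)
  -- the input, with the set given by the list of its elements
  let γ := Str × Str × Str × Str × List Str
  have hcert : DPT fun a : γ => a.2.2.2.1 := DPT.fst.comp (DPT.snd.comp (DPT.snd.comp DPT.snd))
  have hpp : DPT fun a : γ => a.1 := DPT.fst
  have hvk : DPT fun a : γ => a.2.1 := DPT.fst.comp DPT.snd
  have hck : DPT fun a : γ => a.2.2.1 := DPT.fst.comp (DPT.snd.comp DPT.snd)
  have hS : DPT fun a : γ => a.2.2.2.2 := DPT.snd.comp (DPT.snd.comp (DPT.snd.comp DPT.snd))
  have hl : DPT fun a : γ => decodeList (unpairStr a.2.2.2.1).2 :=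
    DPT.decode.comp (DPT.unpairSnd.comp hcert)
  have hc : DPT fun a : γ => decodeList (unpairStr a.2.2.2.1).1 :=
    DPT.decode.comp (DPT.unpairFst.comp hcert)
  have hchain := hfold.precomp ((DPT.reverse.comp hl).prodMk ((hpp.prodMk hck).prodMk
    (hvk.prodMk ((DPT.reverse.comp hc).prodMk (DPT.boolConst true)))))
  have htip : DPT fun p : γ × ((Str × Str) × (Str × (List Str × Bool))) =>
      (p.1.1, (p.2.2.1, (p.1.2.2.1, (p.2.2.2.1.headD [], (∅ : Finset Str))))) :=
    (hpp.comp DPT.fst).prodMk ((DPT.fst.comp (DPT.snd.comp DPT.snd)).prodMk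
      ((hck.comp DPT.fst).prodMk ((DPT.listHead.comp (DPT.fst.comp (DPT.snd.comp
        (DPT.snd.comp DPT.snd)))).prodMk DPT.empty)))
  have hand : DPT fun p : (γ × ((Str × Str) × (Str × (List Str × Bool)))) × Bool =>
      p.2 && p.1.2.2.2.2 :=
    DPT.snd.and (DPT.snd.comp (DPT.snd.comp (DPT.snd.comp (DPT.snd.comp DPT.fst))))
  have hmain := hchain.bind ((hv.precomp htip).bind hand)
  have hmsgs := DPT.linkMsgs.comp hl
  have hset := (DPT.subset.comp₂ hS hmsgs).and (DPT.subset.comp₂ hmsgs hS)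
  -- Lengths are compared in unary. The last key has a certificate but no link, hence the `tail`.
  have hlen := DPT.eq.comp₂ (DPT.tail.comp (DPT.listLength.comp hc)) (DPT.listLength.comp hl)
  have hfalse : IsQPT fun _ : γ => (PMF.pure false : PMF Bool) := DPT.boolConst false
  have hall := IsQPT.ite (DPT.listIsNil.comp hc) hfalse
    (IsQPT.ite (hset.and hlen) hmain hfalse)
  -- The set is given by its sorted list; equality with the set of messages of the links has been
  -- tested by two inclusions of lists.
  refine hall.congr_enc (fun a => (a.1, (a.2.1, (a.2.2.1, (a.2.2.2.1, a.2.2.2.2.sort)))))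
    (fun _ => rfl) fun a => ?_
  obtain ⟨pp, vk, ck, cert, S⟩ := a
  congr 1
  obtain ⟨ls, hls⟩ : ∃ ls, decodeList (unpairStr cert).2 = ls := ⟨_, rfl⟩
  simp only [chainScheme, decodeChain, hls]
  cases hcs : decodeList (unpairStr cert).1 with
  | nil => simp [PMF.monad_pure_eq_pure]
  | cons c cs =>
    have hSiff : S = ((ls.map decodeLink).map Link.msg).toFinset ↔
        (∀ x ∈ S.sort, x ∈ ls.map fun w => (decodeLink w).msg) ∧
        ∀ x ∈ ls.map (fun w => (decodeLink w).msg), x ∈ S.sort := by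
      simp only [Finset.ext_iff, List.mem_toFinset, List.map_map, Finset.mem_sort]
      constructor
      · intro h
        exact ⟨fun x hx => (h x).mp hx, fun x hx => (h x).mpr hx⟩
      · rintro ⟨h1, h2⟩ x
        exact ⟨h1 x, h2 x⟩
    have hleniff : (List.replicate (c :: cs).length true).drop 1 = List.replicate ls.length true ↔
        cs.length = ls.length := by
      simp
    simp only [reduceCtorEq, decide_false, Bool.false_eq_true, if_false, Bool.and_eq_true,
      decide_eq_true_eq, hleniff, ← hSiff]
    by_cases hS' : S = ((ls.map decodeLink).map Link.msg).toFinset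
    · by_cases hl' : cs.length = ls.length
      · rw [if_pos hS', if_pos ⟨hS', hl'⟩, List.reverse_cons, certChain_foldlM _ _ _ _ _ _ _ hl']
        simp only [PMF.monad_bind_eq_bind, PMF.monad_pure_eq_pure, PMF.bind_map, List.headD_cons,
          Function.comp_def]
        rw [PMF.bind_comm]
      · rw [if_pos hS', if_neg (fun h => hl' h.2), certChain_of_length_ne _ _ _ _ _ _ (by simpa using hl')]
        simp only [PMF.monad_bind_eq_bind, PMF.monad_pure_eq_pure, PMF.pure_bind, Bool.and_false,
          PMF.bind_const]
    · rw [if_neg hS', if_neg (fun h => hS' h.1)]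
      rfl

theorem DPT.chainKey : DPT fun a : Val × Str =>
    ((.node a.1 (.node (.str []) (.str [])), a.2) : Val × Str) := by
  refine of_exec (.seq (.split 0 1 0) (.seq (.node 2 2 3) (.seq (.node 0 0 2) (.node 0 0 1))))
    (polyBounded_linear 0 4) fun a => ⟨?_, ?_, ?_, ?_⟩
  rotate_left
  · simp only [exec, run, PMF.monad_pure_eq_pure, PMF.monad_bind_eq_bind, PMF.pure_bind,
      PMF.pure_map]
    rfl
  · simp [Mem.set_reg, Mem.start_reg, Val.left, Val.right, enc_prod, enc_val]
  · simp [Mem.start_steps]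

theorem IsQPT.chainKeyGen {OT : DSRKey} (h : OT.QPT) : IsQPT (chainScheme OT).keyGen :=
  h.2.1.map DPT.chainKey

theorem IsQPT.chainSign {OT : DSRKey} (h : OT.QPT) :
    IsQPT (fun a : Str × Val × Str => (chainScheme OT).sign a.1 a.2.1 a.2.2) := by
  -- context: public parameter, message, chain
  let γ := Str × (Str × Str)
  have h1 : IsQPT fun a : (Val × Val) × γ => (OT.keyGen a.2.1).map fun b => (b, a) :=
    (h.2.1.precomp DPT.fst).freshCtx
  have h2 := h1.map DPT.afterKeyGen
  have hin : DPT fun a : Val × (Str × γ) => (a.2.2.1, (a.1, pairStr a.2.2.2.1 a.2.1)) := by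
    have h3 : DPT fun a : Str × γ => (a.2.1, pairStr a.2.2.1 a.1) :=
      (DPT.fst.comp DPT.snd).prodMk (DPT.pair.comp₂ (DPT.fst.comp (DPT.snd.comp DPT.snd)) DPT.fst)
    exact DPT.assoc.comp ((DPT.swap.first (γ := Str)).comp
      (DPT.assocInv.comp (h3.second (γ := Val))))
  have h3 := ((h.2.2.1.precomp hin).onFst (δ := Val × Val)).map DPT.afterSign
  have hout : DPT fun a : Str × (Str × γ) =>
      pairStr (encodeLink ⟨a.2.2.2.1, a.2.1, a.1⟩) a.2.2.2.2 :=
    DPT.pair.comp₂ (DPT.pair.comp₂ (DPT.fst.comp (DPT.snd.comp (DPT.snd.comp DPT.snd)))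
      (DPT.pair.comp₂ (DPT.fst.comp DPT.snd) DPT.fst))
      (DPT.snd.comp (DPT.snd.comp (DPT.snd.comp DPT.snd)))
  -- The new chain occurs twice: as a part of the new key and as the signature.
  have h4 := (h3.comp h2).map (DPT.insertLast.comp ((hout.prodMk hout).second (γ := Val × (Val × Val))))
  refine (h4.precomp DPT.signInput).congr_enc (fun a => a) (fun _ => rfl) fun a => ?_
  simp only [chainScheme, PMF.monad_bind_eq_bind, PMF.monad_pure_eq_pure, PMF.map_bind,
    PMF.bind_map, Function.comp_def, PMF.map_comp, PMF.pure_map]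
  rfl

/-- Each round detaches one key from the value, so as many rounds as the size of the value suffice.
Every key is a part of the original value, which bounds each certificate by `q` of its size and all
of them together by a polynomial. -/
theorem IsQPT.delAll {OT : DSRKey} (h : OT.QPT) :
    IsQPT fun v : Val => delAll OT v.toList := by
  let T : Val × List Str → PMF (Val × List Str) := fun a =>
    if a.1.isNode then (OT.del a.1.left).map fun c => (a.1.right, a.2 ++ [c]) else PMF.pure a
  have hT : IsQPT T := by
    have h1 : DPT fun a : Val × (Bool × List Str) => ((a.1.left, a.1.right), a.2.2) :=
      (DPT.split.first (γ := List Str)).comp (DPT.snd.second (γ := Val))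
    have h2 : DPT fun a : (Str × Val) × List Str => (a.1.2, a.2 ++ [a.1.1]) := by
      have h3 : DPT fun a : Str × List Str => a.2 ++ [a.1] := DPT.listSnoc.comp DPT.swap
      exact (h3.second (γ := Val)).comp (DPT.assoc.comp (DPT.swap.first (γ := List Str)))
    have h3 := (((h.2.2.2.2.1.first (γ := Val)).first (γ := List Str)).precomp h1).map h2
    have h4 : DPT fun a : Val × (Bool × List Str) => (a.1, a.2.2) := DPT.snd.second (γ := Val)
    have h5 := (iteCtx (b := fun a : Bool × List Str => a.1) DPT.fst h3 h4).precomp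
      (DPT.assoc.comp (DPT.withIsNode.first (γ := List Str)))
    convert h5 using 2 with a
    simp only [T, PMF.map_comp, Function.comp_def]
  obtain ⟨q, hq, hqm, hsize⟩ := h.2.2.2.2.1.size_le
  have hrep := hT.rep (q := fun n => n + n * (2 * q n + 1)) (polyBounded_id.add (polyBounded_id.mul
    (((polyBounded_const 2).mul hq).add (polyBounded_const 1)))) (by
    intro w a k hk b hb
    have : ∀ (k : ℕ) (a b : Val × List Str) (N : ℕ), a.1.size ≤ N → b ∈ (iterate T k a).support →
        b.1.size ≤ N ∧ (encodeList b.2).length ≤ (encodeList a.2).length + k * (2 * q N + 1) := by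
      intro k
      induction k with
      | zero =>
        intro a b N ha hb
        simp only [iterate, PMF.monad_pure_eq_pure, PMF.mem_support_pure_iff] at hb
        subst hb
        simp [ha]
      | succ k ih =>
        intro a b N ha hb
        simp only [iterate, PMF.monad_bind_eq_bind, PMF.mem_support_bind_iff] at hb
        obtain ⟨c, hc, hb⟩ := hb
        simp only [T] at hc
        rw [add_mul, one_mul]
        split_ifs at hc with hn
        · rw [PMF.mem_support_map_iff] at hc
          obtain ⟨d, hd, rfl⟩ := hc
          have hsz := a.1.size_left_add_right_le
          have h1 := a.1.left.size_pos
          have h2 := a.1.right.size_pos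
          have h3 := (hsize a.1.left d hd).trans (hqm (show (Enc.enc a.1.left).size ≤ N by
            rw [enc_val]; omega))
          have h4 := ih (a.1.right, a.2 ++ [d]) b N (by simp only; omega) hb
          simp only [encodeList_append, encodeList, List.length_append, length_pairStr,
            List.length_nil, enc_str, Val.size] at h4 h3
          omega
        · rw [PMF.mem_support_pure_iff] at hc
          subst hc
          have := ih c b N ha hb
          omega
    have h1 := this k a b (Enc.enc (w, a)).size (by
      simp only [enc_prod, enc_val, Val.size]; omega) hb
    have h2 : k ≤ (Enc.enc (w, a)).size := by
      simp only [enc_prod, enc_str, Val.size]; omega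
    have h3 := Nat.mul_le_mul_right (2 * q (Enc.enc (w, a)).size + 1) h2
    have h4 : b.1.size ≤ a.1.size ∧ True := ⟨(this k a b a.1.size le_rfl hb).1, trivial⟩
    have h5 : (Enc.enc (w, a)).size = w.length + 1 + (a.1.size + ((encodeList a.2).length + 1) + 1) + 1 := rfl
    change b.1.size + ((encodeList b.2).length + 1) + 1 ≤ _
    omega)
  have h0 : DPT fun v : Val => (List.replicate v.size true, (v, ([] : List Str))) := by
    have h1 : DPT fun v : Val => (v, List.replicate v.size true) := DPT.withSize
    have h2 : DPT fun a : Str × Val => (a.1, (a.2, ([] : List Str))) := by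
      have : DPT fun v : Val => (v, ([] : List Str)) :=
        (DPT.withStr (α := Val) []).congr_enc (fun v => v) (fun _ => rfl) fun _ => rfl
      exact this.second (γ := Str)
    exact h2.comp (DPT.swap.comp h1)
  have hfin := (hrep.precomp h0).map DPT.snd
  have hiter : ∀ (k : ℕ) (v : Val) (acc : List Str), v.size ≤ k →
      (iterate T k (v, acc)).map Prod.snd = (_root_.delAll OT v.toList).map fun cs => acc ++ cs := by
    intro k
    induction k with
    | zero => intro v acc hv; have := v.size_pos; omega
    | succ k ih =>
      intro v acc hv
      have hfix : ∀ w : Val, w.isNode = false → w.toList = [] →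
          (iterate T (k + 1) (w, acc)).map Prod.snd =
            (_root_.delAll OT w.toList).map fun cs => acc ++ cs := fun w hw hw' => by
        rw [iterate_eq_of_fixed (by simp [T, hw]), hw']
        simp [_root_.delAll, PMF.pure_map, PMF.monad_pure_eq_pure]
      cases v with
      | node a b =>
        have hT1 : T (.node a b, acc) = (OT.del a).map fun c => (b, acc ++ [c]) := rfl
        simp only [iterate, PMF.monad_bind_eq_bind, PMF.monad_pure_eq_pure, PMF.map_bind, hT1,
          PMF.bind_map, Val.toList, _root_.delAll, PMF.pure_map, Function.comp_def]
        congr 1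
        funext c
        have := ih b (acc ++ [c]) (by simp only [Val.size] at hv; omega)
        rw [this, ← PMF.bind_pure_comp]
        simp [Function.comp_def]
      | str s => exact hfix _ rfl rfl
      | qreg n ψ => exact hfix _ rfl rfl
  have e : (fun v : Val => _root_.delAll OT v.toList) = fun v =>
      (iterate T v.size (v, [])).map Prod.snd := by
    funext v
    rw [hiter _ _ _ le_rfl]
    simp only [List.nil_append]
    exact (PMF.map_id _).symm
  rw [e]
  simpa only [List.length_replicate] using hfin

theorem DPT.delInput : DPT fun v : Val =>
    ((.node v.left v.right.left, v.right.right.toStr) : Val × Str) := by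
  refine of_exec (.seq (.split 0 1 0) (.seq (.split 1 2 1) (.seq (.node 0 0 1)
    (.seq (.op .copy 2 2 3) (.node 0 0 2))))) (polyBounded_linear 1 5) fun a => ⟨?_, ?_, ?_, ?_⟩
  rotate_left
  · simp only [exec, run, PMF.monad_pure_eq_pure, PMF.monad_bind_eq_bind, PMF.pure_bind,
      PMF.pure_map]
    rfl
  · simp [Mem.set_reg, Mem.start_reg, Mem.get, StrOp.eval, enc_prod, enc_val, enc_str]
  · have h1 := a.size_left_add_right_le
    have h2 := a.right.size_left_add_right_le
    have h3 := a.right.right.length_toStr_lt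
    have h4 := a.left.size_pos
    have h5 := a.right.left.size_pos
    simp [Mem.start_steps, Mem.get, Mem.set_reg, Mem.start_reg, enc_val]
    change 3 + (1 + a.right.right.toStr.length + 0) ≤ a.size + 4
    omega

theorem IsQPT.chainDel {OT : DSRKey} (h : OT.QPT) : IsQPT (chainScheme OT).del := by
  have h1 : DPT fun a : List Str × Str => pairStr (encodeList a.1) a.2 :=
    DPT.pair.comp₂ (DPT.listAsStr.comp DPT.fst) DPT.snd
  have h2 := (((IsQPT.delAll h).first (γ := Str)).precomp DPT.delInput).map h1
  convert h2 using 2 with v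
  simp only [chainScheme, PMF.monad_bind_eq_bind, PMF.monad_pure_eq_pure, PMF.map_comp,
    Val.toList]
  rfl

theorem DSRKey.QPT.chainScheme {OT : DSRKey} (h : OT.QPT) : (chainScheme OT).QPT :=
  ⟨h.1, .chainKeyGen h, .chainSign h, .chainVer h, .chainDel h, .chainCert h⟩

/-! ### Expected values -/

open scoped ENNReal

namespace PMF

/-- The expected value of a nonnegative random variable. -/
noncomputable def expVal {α : Type} (p : PMF α) (f : α → ℝ≥0∞) : ℝ≥0∞ := ∑' a, p a * f a

variable {α β : Type} (p : PMF α)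

theorem expVal_pure (a : α) (f : α → ℝ≥0∞) : (PMF.pure a).expVal f = f a := by
  rw [expVal, tsum_eq_single a]
  · simp
  · intro b hb
    simp [hb]

theorem expVal_bind (q : α → PMF β) (f : β → ℝ≥0∞) :
    (p.bind q).expVal f = p.expVal fun a => (q a).expVal f := by
  simp only [expVal, bind_apply, ← ENNReal.tsum_mul_right, ← ENNReal.tsum_mul_left]
  rw [ENNReal.tsum_comm]
  simp only [mul_assoc]

theorem expVal_map (g : α → β) (f : β → ℝ≥0∞) : (p.map g).expVal f = p.expVal fun a => f (g a) := by
  rw [← bind_pure_comp, expVal_bind]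
  simp only [Function.comp, expVal_pure]

theorem bind_apply_eq_expVal (q : α → PMF β) (b : β) :
    (p.bind q) b = p.expVal fun a => q a b := rfl

theorem expVal_add (f g : α → ℝ≥0∞) : p.expVal (fun a => f a + g a) = p.expVal f + p.expVal g := by
  simp only [expVal, mul_add, ENNReal.tsum_add]

theorem expVal_const_mul (c : ℝ≥0∞) (f : α → ℝ≥0∞) : p.expVal (fun a => c * f a) = c * p.expVal f := by
  simp only [expVal, ← ENNReal.tsum_mul_left, mul_left_comm]

theorem expVal_const (c : ℝ≥0∞) : p.expVal (fun _ => c) = c := by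
  simp only [expVal, ENNReal.tsum_mul_right, tsum_coe, one_mul]

theorem expVal_mono {f g : α → ℝ≥0∞} (h : ∀ a ∈ p.support, f a ≤ g a) : p.expVal f ≤ p.expVal g := by
  refine ENNReal.tsum_le_tsum fun a => ?_
  by_cases ha : a ∈ p.support
  · exact mul_le_mul_right (h a ha) _
  · rw [(p.apply_eq_zero_iff a).mpr ha, zero_mul, zero_mul]

theorem expVal_comm (q : PMF β) (f : α → β → ℝ≥0∞) :
    (p.expVal fun a => q.expVal fun b => f a b) = q.expVal fun b => p.expVal fun a => f a b := by
  simp only [expVal, ← ENNReal.tsum_mul_left]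
  rw [ENNReal.tsum_comm]
  simp only [mul_left_comm]

theorem expVal_le_of_le {f : α → ℝ≥0∞} {c : ℝ≥0∞} (h : ∀ a ∈ p.support, f a ≤ c) :
    p.expVal f ≤ c := (p.expVal_mono h).trans (p.expVal_const c).le

theorem expVal_prod (p : PMF (α × β)) (f : α × β → ℝ≥0∞) :
    p.expVal f = ∑' a, ∑' b, p (a, b) * f (a, b) := ENNReal.tsum_prod'

theorem bind_congr_support {q q' : α → PMF β} (h : ∀ a ∈ p.support, q a = q' a) :
    p.bind q = p.bind q' := by
  ext b
  simp only [bind_apply]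
  refine tsum_congr fun a => ?_
  by_cases ha : a ∈ p.support
  · rw [h a ha]
  · rw [(p.apply_eq_zero_iff a).mpr ha, zero_mul, zero_mul]

theorem bool_add (p : PMF Bool) : p true + p false = 1 := by
  have := p.tsum_coe
  rwa [tsum_bool, add_comm] at this

/-- The union bound for two independent tests. -/
theorem and_false_le (p q : PMF Bool) :
    (p.bind fun b => q.bind fun b' => PMF.pure (b && b')) false ≤ p false + q false := by
  simp only [bind_apply, tsum_bool, pure_apply, Bool.false_and, Bool.true_and, if_true]
  simp only [reduceCtorEq, if_false, mul_zero, mul_one, add_zero]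
  have h1 : q false + q true = 1 := by rw [add_comm]; exact q.bool_add
  rw [h1, mul_one]
  gcongr
  calc p true * q false ≤ 1 * q false := by gcongr; exact p.coe_le_one _
    _ = q false := one_mul _

theorem and_true_eq (p q : PMF Bool) :
    (p.bind fun b => q.bind fun b' => PMF.pure (b && b')) true = p true * q true := by
  simp [bind_apply, pure_apply]

end PMF

theorem prob_eq_expVal {α : Type} (p : PMF α) (E : α → Prop) [DecidablePred E] :
    prob p E = (p.expVal fun a => if E a then 1 else 0).toReal := by
  rw [prob, PMF.toOuterMeasure_apply, PMF.expVal]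
  congr 1
  refine tsum_congr fun a => ?_
  by_cases h : E a <;> simp [Set.indicator, h]

theorem prob_eq_true (p : PMF Bool) : prob p (· = true) = (p true).toReal := by
  rw [prob_eq_expVal, PMF.expVal, tsum_bool]
  simp

theorem one_sub_prob_eq_true (p : PMF Bool) : 1 - prob p (· = true) = (p false).toReal := by
  have h := congrArg ENNReal.toReal p.bool_add
  rw [ENNReal.toReal_add (p.apply_ne_top _) (p.apply_ne_top _), ENNReal.toReal_one] at h
  rw [prob_eq_true]
  linarith

/-! ### Negligible functions -/

theorem Negligible.mono {f g : ℕ → ℝ} (hg : Negligible g) (h0 : ∀ n, 0 ≤ f n) (h : ∀ n, f n ≤ g n) :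
    Negligible f :=
  Asymptotics.SuperpolynomialDecay.trans_abs_le hg fun n => by
    rw [abs_of_nonneg (h0 n), abs_of_nonneg ((h0 n).trans (h n))]
    exact h n

theorem Negligible.add {f g : ℕ → ℝ} (hf : Negligible f) (hg : Negligible g) :
    Negligible fun n => f n + g n := Asymptotics.SuperpolynomialDecay.add hf hg

theorem Negligible.polyBounded_mul {f : ℕ → ℝ} {p : ℕ → ℕ} (hf : Negligible f)
    (h0 : ∀ n, 0 ≤ f n) (hp : PolyBounded p) : Negligible fun n => (p n : ℝ) * f n := by
  obtain ⟨P, hP⟩ := hp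
  have h := Asymptotics.SuperpolynomialDecay.polynomial_mul hf (P.map (Nat.castRingHom ℝ))
  refine Negligible.mono h (fun n => mul_nonneg (Nat.cast_nonneg _) (h0 n)) fun n => ?_
  refine mul_le_mul_of_nonneg_right ?_ (h0 n)
  rw [Polynomial.eval_natCast_map]
  simpa using hP n

/-- If a nonnegative random variable has a finite expected value at each choice of a parameter, then
some choice comes within a factor two of the supremum. -/
theorem exists_iSup_le_two_mul {ι : Type} [Nonempty ι] (F : ι → ℝ≥0∞) (h : ⨆ i, F i ≠ ⊤) :
    ∃ i, ⨆ i, F i ≤ 2 * F i := by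
  by_cases h0 : ⨆ i, F i = 0
  · exact ⟨Classical.arbitrary ι, by simp [h0]⟩
  · obtain ⟨i, hi⟩ := lt_iSup_iff.mp (ENNReal.half_lt_self h0 h)
    refine ⟨i, ?_⟩
    calc ⨆ i, F i = 2 * ((⨆ i, F i) / 2) := (ENNReal.mul_div_cancel two_ne_zero ENNReal.ofNat_ne_top).symm
      _ ≤ 2 * F i := by gcongr

/-! ### The history of a chain -/

/-- The signing key of the chain construction in a structured form: the first verification key, the
current key, the used keys, and the links. -/
structure ChainState where
  vk₀ : Str
  cur : Val
  used : List Val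
  links : List Link

namespace ChainState

/-- The list of the used keys as a value. -/
def valList : List Val → Val
  | [] => .str []
  | v :: l => .node v (valList l)

theorem toList_valList (l : List Val) : (valList l).toList = l := by
  induction l with
  | nil => rfl
  | cons v l ih => simp [valList, Val.toList, ih]

/-- The chain as a bit string. -/
def encodeChain (ls : List Link) : Str := encodeList (ls.map encodeLink)

theorem decodeChain_encodeChain (ls : List Link) : decodeChain (encodeChain ls) = ls := by
  simp [decodeChain, encodeChain, decodeList_encodeList, decodeLink_encodeLink, Function.comp_def]

/-- The signing key. -/
def key (g : ChainState) : Val := .node g.cur (.node (valList g.used) (.str (encodeChain g.links)))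

/-- The current verification key. -/
def tip (g : ChainState) : Str := tipVk g.vk₀ g.links

end ChainState

open ChainState

section

variable (OT : DSRKey)

/-- Signing a message in the chain construction. -/
noncomputable def chainStep (pp : Str) (g : ChainState) (m : Str) : PMF ChainState :=
  (OT.keyGen pp).bind fun k => (OT.sign pp g.cur (pairStr m k.2)).map fun r =>
    ⟨g.vk₀, k.1, r.1 :: g.used, ⟨m, k.2, r.2⟩ :: g.links⟩

/-- The state after key generation. -/
noncomputable def chainInit (pp : Str) : PMF ChainState :=
  (OT.keyGen pp).map fun k => ⟨k.2, k.1, [], []⟩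

/-- Signing a list of messages one after the other. -/
noncomputable def chainRun (pp : Str) (ms : List Str) (g : ChainState) : PMF ChainState :=
  ms.foldlM (chainStep OT pp) g

theorem chainRun_cons (pp m : Str) (ms : List Str) (g : ChainState) :
    chainRun OT pp (m :: ms) g = (chainStep OT pp g m).bind (chainRun OT pp ms) := rfl

theorem chainRun_append_singleton (pp m : Str) (ms : List Str) (g : ChainState) :
    chainRun OT pp (ms ++ [m]) g = (chainRun OT pp ms g).bind fun g' => chainStep OT pp g' m := by
  simp only [chainRun, List.foldlM_append, List.foldlM_cons, List.foldlM_nil,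
    PMF.monad_bind_eq_bind, PMF.monad_pure_eq_pure, PMF.bind_pure]

theorem chainScheme_keyGen (pp : Str) : (chainScheme OT).keyGen pp =
    (chainInit OT pp).map fun g => (g.key, g.vk₀) := by
  simp only [chainScheme, chainInit, PMF.monad_bind_eq_bind, PMF.monad_pure_eq_pure, PMF.map_comp]
  rfl

theorem chainScheme_sign (pp m : Str) (g : ChainState) : (chainScheme OT).sign pp g.key m =
    (chainStep OT pp g m).map fun g' => (g'.key, encodeChain g'.links) := by
  simp only [chainScheme, chainStep, PMF.monad_bind_eq_bind, PMF.monad_pure_eq_pure, PMF.map_comp,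
    PMF.map_bind]
  rfl

/-- The parts of a chain that are the signatures of the last `k` messages. -/
def chainSigs : ℕ → List Link → List Str
  | 0, _ => []
  | k + 1, ls => encodeChain (ls.drop k) :: chainSigs k ls

theorem mem_support_chainStep {pp m : Str} {g g' : ChainState}
    (h : g' ∈ (chainStep OT pp g m).support) : g'.vk₀ = g.vk₀ ∧
      ∃ v s k, g'.links = ⟨m, v, s⟩ :: g.links ∧ g'.used = k :: g.used := by
  rw [chainStep, PMF.mem_support_bind_iff] at h
  obtain ⟨k, -, h⟩ := h
  rw [PMF.mem_support_map_iff] at h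
  obtain ⟨r, -, rfl⟩ := h
  exact ⟨rfl, k.2, r.2, r.1, rfl, rfl⟩

theorem mem_support_chainRun {pp : Str} {ms : List Str} {g g' : ChainState}
    (h : g' ∈ (chainRun OT pp ms g).support) : g'.vk₀ = g.vk₀ ∧
      g'.links.drop ms.length = g.links ∧ g'.links.map Link.msg = ms.reverse ++ g.links.map Link.msg ∧
      g'.used.length = ms.length + g.used.length := by
  induction ms generalizing g with
  | nil =>
    simp only [chainRun, List.foldlM_nil, PMF.monad_pure_eq_pure, PMF.mem_support_pure_iff] at h
    simp [h]
  | cons m ms ih =>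
    rw [chainRun_cons, PMF.mem_support_bind_iff] at h
    obtain ⟨g₁, h₁, h⟩ := h
    obtain ⟨hv, v, s, k, hl, hu⟩ := mem_support_chainStep OT h₁
    obtain ⟨i1, i2, i3, i4⟩ := ih h
    refine ⟨i1.trans hv, ?_, ?_, ?_⟩
    · rw [List.length_cons, ← List.drop_drop, i2, hl]; rfl
    · simp [i3, hl]
    · simp [i4, hu]; omega

/-- New links are only put in front, so every signature is a suffix of the final chain and is
recovered from it by dropping the later links. -/
theorem chainScheme_signAll (pp : Str) (ms : List Str) (g : ChainState) :
    (chainScheme OT).signAll pp ms g.key = (chainRun OT pp ms g).map fun g' =>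
      (g'.key, chainSigs ms.length g'.links) := by
  induction ms generalizing g with
  | nil => simp [DSRKey.signAll, chainRun, PMF.monad_pure_eq_pure, PMF.pure_map, chainSigs]
  | cons m ms ih =>
    simp only [DSRKey.signAll, chainScheme_sign, PMF.monad_bind_eq_bind, PMF.monad_pure_eq_pure,
      PMF.bind_map, Function.comp_def, ih, chainRun_cons, PMF.map_bind]
    congr 1
    funext g₁
    refine PMF.bind_congr_support _ fun g' hg' => ?_
    obtain ⟨-, h, -⟩ := mem_support_chainRun OT hg'
    simp [chainSigs, h]

/-- The sum of `r` over the links of a chain, the arguments of `r` being the verification key, the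
used key, the signed string and the signature. -/
noncomputable def chainSum (r : Str → Val → Str → Str → ℝ≥0∞) (vk₀ : Str) :
    List Val → List Link → ℝ≥0∞
  | k :: ks, l :: ls => r (tipVk vk₀ ls) k (pairStr l.msg l.vk) l.sig + chainSum r vk₀ ks ls
  | _, _ => 0

/-- Each signing step replaces the current key by a newly generated one, whatever has happened
before. -/
theorem chainRun_fresh (pp : Str) (ms : List Str) :
    ((chainInit OT pp).bind (chainRun OT pp ms)).map (fun g => (g.cur, g.tip)) = OT.keyGen pp := by
  induction ms using List.reverseRecOn with
  | nil =>
    simp only [chainRun, List.foldlM_nil, PMF.monad_pure_eq_pure, chainInit, PMF.bind_map,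
      Function.comp_def, PMF.map_bind, PMF.pure_map, ChainState.tip, tipVk]
    exact PMF.bind_pure _
  | append_singleton ms m _ =>
    have h : ∀ g, (chainStep OT pp g m).map (fun g => (g.cur, g.tip)) = OT.keyGen pp := by
      intro g
      simp only [chainStep, PMF.map_bind, PMF.map_comp, Function.comp_def, ChainState.tip, tipVk]
      conv_rhs => rw [← PMF.bind_pure (OT.keyGen pp)]
      congr 1
      funext k
      exact PMF.map_const _ _
    simp only [chainRun_append_singleton, PMF.map_bind, h, PMF.bind_const]

/-- Split off the last signature. Its term depends on the past only through the current key and the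
tip, which have the law of a fresh key pair. Expected values add, so independence from the earlier
links is not needed. -/
theorem expVal_chainSum_le (pp : Str) (r : Str → Val → Str → Str → ℝ≥0∞) (e : ℝ≥0∞)
    (he : ∀ w, ((OT.keyGen pp).expVal fun k => (OT.sign pp k.1 w).expVal fun s =>
      r k.2 s.1 w s.2) ≤ e) (ms : List Str) :
    (((chainInit OT pp).bind (chainRun OT pp ms)).expVal fun g =>
      chainSum r g.vk₀ g.used g.links) ≤ ms.length * e := by
  induction ms using List.reverseRecOn with
  | nil =>
    simp only [chainInit, PMF.bind_map, PMF.expVal_bind, Function.comp_def, chainRun,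
      List.foldlM_nil, PMF.monad_pure_eq_pure, PMF.expVal_pure, chainSum, PMF.expVal_const]
    simp
  | append_singleton ms m ih =>
    let Y : Val × Str → ℝ≥0∞ := fun c => (OT.keyGen pp).expVal fun k =>
      (OT.sign pp c.1 (pairStr m k.2)).expVal fun s => r c.2 s.1 (pairStr m k.2) s.2
    have hstep : ∀ g, ((chainStep OT pp g m).expVal fun g => chainSum r g.vk₀ g.used g.links) =
        Y (g.cur, g.tip) + chainSum r g.vk₀ g.used g.links := by
      intro g
      simp only [chainStep, PMF.expVal_bind, PMF.expVal_map, chainSum, PMF.expVal_add,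
        PMF.expVal_const, Y, ChainState.tip]
    have hrun : chainRun OT pp (ms ++ [m]) = fun g => (chainRun OT pp ms g).bind fun g' =>
        chainStep OT pp g' m := funext (chainRun_append_singleton OT pp m ms)
    rw [hrun, ← PMF.bind_bind, PMF.expVal_bind]
    simp only [hstep]
    rw [PMF.expVal_add]
    have h1 : (((chainInit OT pp).bind (chainRun OT pp ms)).expVal fun g => Y (g.cur, g.tip)) ≤ e := by
      rw [← PMF.expVal_map _ (fun g : ChainState => (g.cur, g.tip)) Y, chainRun_fresh]
      simp only [Y]
      -- The new key is drawn before the signing key: for each of its values the string to be signed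
      -- is fixed, and `he` applies.
      rw [PMF.expVal_comm]
      exact PMF.expVal_le_of_le _ fun k _ => he _
    calc _ ≤ e + ms.length * e := add_le_add h1 ih
      _ = _ := by rw [List.length_append, List.length_singleton]; push_cast; ring

end

theorem PMF.expVal_tsum {α ι : Type} (p : PMF α) (w : ι → ℝ≥0∞) (f : ι → α → ℝ≥0∞) :
    (p.expVal fun a => ∑' i, w i * f i a) = ∑' i, w i * p.expVal (f i) := by
  simp only [PMF.expVal, ← ENNReal.tsum_mul_left]
  rw [ENNReal.tsum_comm]
  simp only [mul_left_comm]

/-! ### Correctness and deletion correctness of the chain construction. -/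

section Correctness

variable (OT : DSRKey)

theorem chainSum_tsum {ι : Type} (w : ι → ℝ≥0∞) (r : ι → Str → Val → Str → Str → ℝ≥0∞) (vk : Str)
    (ks : List Val) (ls : List Link) :
    chainSum (fun v k m s => ∑' i, w i * r i v k m s) vk ks ls =
      ∑' i, w i * chainSum (r i) vk ks ls := by
  induction ks generalizing ls with
  | nil => simp [chainSum]
  | cons k ks ih =>
    cases ls with
    | nil => simp [chainSum]
    | cons l ls => simp only [chainSum, ih, mul_add, ENNReal.tsum_add]

theorem chainSum_drop_le (r : Str → Val → Str → Str → ℝ≥0∞) (vk : Str) (i : ℕ)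
    (ks : List Val) (ls : List Link) :
    chainSum r vk (ks.drop i) (ls.drop i) ≤ chainSum r vk ks ls := by
  induction i generalizing ks ls with
  | zero => simp
  | succ i ih =>
    cases ks with
    | nil => simp [chainSum]
    | cons k ks =>
      cases ls with
      | nil => simp [chainSum]
      | cons l ls => exact (ih ks ls).trans (by simp only [chainSum]; exact le_add_self)

/-- Among all the messages that may be signed by a fresh key, one is (up to a factor of two) the worst
one; it bounds the expected sum over the links of any chain. -/
theorem exists_worst_message (n : ℕ) (r : Str → Str → Str → Val → Str → Str → ℝ≥0∞)
    (hr : ∀ pp ck v k m s, r pp ck v k m s ≤ 1) :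
    ∃ μ : Str → Str, ∀ (p : ℕ) (ms : Str → List Str), (∀ pp, (ms pp).length = p) →
      ((OT.setup n).expVal fun a => ((chainInit OT a.1).bind (chainRun OT a.1 (ms a.1))).expVal
        fun g => chainSum (r a.1 a.2) g.vk₀ g.used g.links) ≤
      p * (2 * (OT.setup n).expVal fun a => (OT.keyGen a.1).expVal fun k =>
        (OT.sign a.1 k.1 (μ a.1)).expVal fun s => r a.1 a.2 k.2 s.1 (μ a.1) s.2) := by
  let F : Str → Str → ℝ≥0∞ := fun pp m => ∑' ck, OT.setup n (pp, ck) *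
    (OT.keyGen pp).expVal fun k => (OT.sign pp k.1 m).expVal fun s => r pp ck k.2 s.1 m s.2
  have hF : ∀ pp m, F pp m ≤ 1 := fun pp m => by
    calc F pp m ≤ ∑' ck, OT.setup n (pp, ck) * 1 := by
          refine ENNReal.tsum_le_tsum fun ck => ?_
          gcongr
          exact PMF.expVal_le_of_le _ fun k _ => PMF.expVal_le_of_le _ fun s _ => hr _ _ _ _ _ _
      _ ≤ ∑' pp, ∑' ck, OT.setup n (pp, ck) * 1 :=
          ENNReal.le_tsum (f := fun pp => ∑' ck, OT.setup n (pp, ck) * 1) pp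
      _ = 1 := by
          rw [← ENNReal.tsum_prod' (f := fun a => OT.setup n a * 1)]
          simp only [mul_one, PMF.tsum_coe]
  have hw : ∀ pp, ∃ m, ⨆ m, F pp m ≤ 2 * F pp m := fun pp =>
    exists_iSup_le_two_mul _ ((iSup_le (hF pp)).trans_lt ENNReal.one_lt_top).ne
  choose μ hμ using hw
  refine ⟨μ, fun p ms hms => ?_⟩
  rw [PMF.expVal_prod, PMF.expVal_prod, ← ENNReal.tsum_mul_left, ← ENNReal.tsum_mul_left]
  refine ENNReal.tsum_le_tsum fun pp => ?_
  simp only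
  -- For fixed `pp` the law of the chain does not depend on `ck`, so the sum over `ck` moves inside
  -- the expected value, and then into each link.
  rw [← PMF.expVal_tsum _ (fun ck => OT.setup n (pp, ck)) fun ck (g : ChainState) =>
    chainSum (r pp ck) g.vk₀ g.used g.links]
  simp only [← chainSum_tsum]
  refine (expVal_chainSum_le OT pp _ (⨆ m, F pp m) (fun w => ?_) (ms pp)).trans ?_
  · simp only [PMF.expVal_tsum]
    exact le_iSup (F pp) w
  · rw [hms]
    gcongr
    exact hμ pp

theorem verChain_false_le (pp vk : Str) (ls : List Link) (ks : List Val)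
    (h : ks.length = ls.length) : verChain OT pp vk ls false ≤
      chainSum (fun v _ m s => OT.ver pp v m s false) vk ks ls := by
  induction ls generalizing ks with
  | nil => simp [verChain, PMF.monad_pure_eq_pure]
  | cons l ls ih =>
    cases ks with
    | nil => simp at h
    | cons k ks =>
      simp only [verChain, PMF.monad_bind_eq_bind, PMF.monad_pure_eq_pure, chainSum]
      exact (PMF.and_false_le _ _).trans (by gcongr; exact ih ks (by simpa using h))

/-- Every signature is a suffix of the final chain, so it fails with probability at most the sum
over the entire chain. Each signature contributes this sum once, which gives the factor. -/
theorem verAll_chainScheme_false_le (pp vk : Str) (ms t : List Str) (ls : List Link)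
    (ks : List Val) (h : ks.length = ls.length) (hm : ls.map Link.msg = ms.reverse ++ t) :
    (chainScheme OT).verAll pp vk ms (chainSigs ms.length ls) false ≤
      ms.length * chainSum (fun v _ m s => OT.ver pp v m s false) vk ks ls := by
  induction ms generalizing t with
  | nil => simp [DSRKey.verAll, PMF.monad_pure_eq_pure]
  | cons m ms ih =>
    simp only [List.length_cons, chainSigs, DSRKey.verAll, PMF.monad_bind_eq_bind,
      PMF.monad_pure_eq_pure]
    refine (PMF.and_false_le _ _).trans ?_
    have h1 : (ls.drop ms.length).map Link.msg = m :: t := by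
      rw [List.map_drop, hm, List.reverse_cons, List.append_assoc]
      exact List.drop_left' (by simp)
    have h2 : (chainScheme OT).ver pp vk m (encodeChain (ls.drop ms.length)) =
        verChain OT pp vk (ls.drop ms.length) := by
      simp only [chainScheme, decodeChain_encodeChain]
      cases hd : ls.drop ms.length with
      | nil => simp [hd] at h1
      | cons l ls' =>
        simp only [hd, List.map_cons, List.cons.injEq] at h1
        simp [h1.1]
    rw [h2]
    have h3 := (verChain_false_le OT pp vk _ (ks.drop ms.length) (by simp [h])).trans
      (chainSum_drop_le _ vk ms.length ks ls)
    calc _ ≤ _ := add_le_add h3 (ih (m :: t) (by simp [hm]))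
      _ = _ := by push_cast; ring

theorem DSRKey.CorrectFor.negligible {D : DSRKey} {p : ℕ → ℕ} (h : D.CorrectFor p)
    (msgs : ℕ → Str → List Str) (hm : ∀ n pp, (msgs n pp).length = p n) :
    Negligible fun n => (D.correctnessGame msgs n false).toReal := by
  obtain ⟨ν, hν, h⟩ := h msgs hm
  refine hν.mono (fun n => ENNReal.toReal_nonneg) fun n => ?_
  rw [← one_sub_prob_eq_true]
  linarith [h n]

theorem DSRKey.DelCorrectFor.negligible {D : DSRKey} {p : ℕ → ℕ} (h : D.DelCorrectFor p)
    (msgs : ℕ → Str → List Str) (hm : ∀ n pp, (msgs n pp).length = p n) :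
    Negligible fun n => (D.delCorrectnessGame msgs n false).toReal := by
  obtain ⟨ν, hν, h⟩ := h msgs hm
  refine hν.mono (fun n => ENNReal.toReal_nonneg) fun n => ?_
  rw [← one_sub_prob_eq_true]
  linarith [h n]

variable {OT}

/-- One union bound over the `p` signatures and one over the links of each give a loss of p², and
the choice of a nearly worst message gives a factor two. -/
theorem chainScheme_correct (h : OT.OneTimeCorrectness) : (chainScheme OT).ManyTimeCorrectness := by
  intro p hp msgs hms
  refine ⟨fun n => ((chainScheme OT).correctnessGame msgs n false).toReal, ?_, fun n => by
    simp only [← one_sub_prob_eq_true, sub_sub_cancel, le_refl]⟩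
  choose μ hμ using fun n => exists_worst_message OT n
    (fun pp _ v _ m s => OT.ver pp v m s false) (fun _ _ _ _ _ _ => PMF.coe_le_one _ _)
  have hOT : ∀ n, OT.correctnessGame (fun n pp => [μ n pp]) n false =
      (OT.setup n).expVal fun a => (OT.keyGen a.1).expVal fun k =>
        (OT.sign a.1 k.1 (μ n a.1)).expVal fun s => OT.ver a.1 k.2 (μ n a.1) s.2 false := by
    intro n
    simp only [DSRKey.correctnessGame, DSRKey.signAll, DSRKey.verAll, PMF.monad_bind_eq_bind,
      PMF.monad_pure_eq_pure, PMF.pure_bind, PMF.bind_bind, PMF.bind_apply_eq_expVal, Bool.and_true,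
      PMF.bind_pure]
  have hle : ∀ n, (chainScheme OT).correctnessGame msgs n false ≤
      p n * (p n * (2 * OT.correctnessGame (fun n pp => [μ n pp]) n false)) := by
    intro n
    rw [hOT]
    refine le_trans ?_ (mul_le_mul_right (hμ n (p n) (msgs n) (hms n)) _)
    rw [← PMF.expVal_const_mul]
    have hsetup : (chainScheme OT).setup = OT.setup := rfl
    simp only [DSRKey.correctnessGame, PMF.monad_bind_eq_bind, hsetup, PMF.bind_apply_eq_expVal,
      chainScheme_keyGen, PMF.expVal_map, chainScheme_signAll]
    refine PMF.expVal_mono _ fun a _ => ?_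
    rw [PMF.expVal_bind, ← PMF.expVal_const_mul]
    refine PMF.expVal_mono _ fun g hg => ?_
    rw [← PMF.expVal_const_mul]
    refine PMF.expVal_mono _ fun g' hg' => ?_
    obtain ⟨k, -, rfl⟩ := (PMF.mem_support_map_iff _ _ _).mp hg
    obtain ⟨h1, -, h3, h4⟩ := mem_support_chainRun OT hg'
    have := verAll_chainScheme_false_le OT a.1 g'.vk₀ (msgs n a.1) [] g'.links g'.used
      (by simpa [h4] using (congrArg List.length h3).symm) (by simpa using h3)
    rw [h1] at this
    rwa [h1, ← hms n a.1]
  have hneg := (h.negligible (fun n pp => [μ n pp]) fun n pp => rfl)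
  refine Negligible.mono ((hneg.polyBounded_mul (fun _ => ENNReal.toReal_nonneg)
    ((hp.mul hp).mul (polyBounded_const 2)))) (fun n => ENNReal.toReal_nonneg) fun n => ?_
  have hx := PMF.apply_ne_top (OT.correctnessGame (fun n pp => [μ n pp]) n) false
  have := ENNReal.toReal_mono (by finiteness) (hle n)
  simp only [ENNReal.toReal_mul, ENNReal.toReal_natCast, ENNReal.toReal_ofNat] at this
  push_cast
  linarith

theorem delAll_certChain_false_le (pp vk ck : Str) (ks : List Val) (ls : List Link)
    (h : ks.length = ls.length) :
    ((delAll OT ks).expVal fun cs => certChain OT pp vk ck cs ls false) ≤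
      chainSum (fun v k m _ => (OT.del k).expVal fun c => OT.cert pp v ck c {m} false) vk ks ls := by
  induction ks generalizing ls with
  | nil =>
    cases ls with
    | nil => simp [delAll, PMF.monad_pure_eq_pure, PMF.expVal_pure, certChain]
    | cons l ls => simp at h
  | cons k ks ih =>
    cases ls with
    | nil => simp at h
    | cons l ls =>
      simp only [delAll, PMF.monad_bind_eq_bind, PMF.monad_pure_eq_pure, PMF.expVal_bind,
        PMF.expVal_pure, certChain, chainSum]
      calc _ ≤ (OT.del k).expVal fun c => OT.cert pp (tipVk vk ls) ck c {pairStr l.msg l.vk} false +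
            (delAll OT ks).expVal fun cs => certChain OT pp vk ck cs ls false := by
            refine PMF.expVal_mono _ fun c _ => ?_
            rw [← PMF.expVal_const (delAll OT ks)
              (OT.cert pp (tipVk vk ls) ck c {pairStr l.msg l.vk} false), ← PMF.expVal_add]
            exact PMF.expVal_mono _ fun cs _ => PMF.and_false_le _ _
        _ ≤ _ := by
            rw [PMF.expVal_add, PMF.expVal_const]
            gcongr
            exact ih ls (by simpa using h)

theorem del_cert_chainScheme_false_le (pp ck : Str) (g : ChainState) (S : Finset Str)
    (h : g.used.length = g.links.length) (hS : S = (g.links.map Link.msg).toFinset) :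
    (((chainScheme OT).del g.key).expVal fun c => (chainScheme OT).cert pp g.vk₀ ck c S false) ≤
      ((OT.del g.cur).expVal fun c => OT.cert pp g.tip ck c ∅ false) +
      chainSum (fun v k m _ => (OT.del k).expVal fun c => OT.cert pp v ck c {m} false) g.vk₀
        g.used g.links := by
  have h1 : (chainScheme OT).del g.key = (delAll OT (g.cur :: g.used)).map fun certs =>
      pairStr (encodeList certs) (encodeChain g.links) := by
    simp only [chainScheme, ChainState.key, Val.left, Val.right, toList_valList, Val.toStr]
    rfl
  rw [h1, PMF.expVal_map]
  simp only [chainScheme, unpairStr_pairStr, decodeList_encodeList, decodeChain_encodeChain, delAll,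
    PMF.monad_bind_eq_bind, PMF.monad_pure_eq_pure, PMF.expVal_bind, PMF.expVal_pure, hS, if_true]
  calc _ ≤ (OT.del g.cur).expVal fun c => OT.cert pp g.tip ck c ∅ false +
        (delAll OT g.used).expVal fun cs => certChain OT pp g.vk₀ ck cs g.links false := by
        refine PMF.expVal_mono _ fun c _ => ?_
        rw [← PMF.expVal_const (delAll OT g.used) (OT.cert pp g.tip ck c ∅ false),
          ← PMF.expVal_add]
        exact PMF.expVal_mono _ fun cs _ => PMF.and_false_le _ _
    _ ≤ _ := by
        rw [PMF.expVal_add, PMF.expVal_const]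
        gcongr
        exact delAll_certChain_false_le pp g.vk₀ ck g.used g.links h

/-- The last key is an instance of the experiment without messages, and each used key is an instance
of the experiment with one message. Every key is certified only once, so the loss is linear in `p`.
-/
theorem chainScheme_delCorrect (h : OT.OneTimeDelCorrectness) :
    (chainScheme OT).ManyTimeDelCorrectness := by
  intro p hp msgs hms
  refine ⟨fun n => ((chainScheme OT).delCorrectnessGame msgs n false).toReal, ?_, fun n => by
    simp only [← one_sub_prob_eq_true, sub_sub_cancel, le_refl]⟩
  choose μ hμ using fun n => exists_worst_message OT n
    (fun pp ck v k m _ => (OT.del k).expVal fun c => OT.cert pp v ck c {m} false)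
    (fun _ _ _ _ _ _ => PMF.expVal_le_of_le _ fun _ _ => PMF.coe_le_one _ _)
  have hOT₁ : ∀ n, OT.delCorrectnessGame (fun n pp => [μ n pp]) n false =
      (OT.setup n).expVal fun a => (OT.keyGen a.1).expVal fun k =>
        (OT.sign a.1 k.1 (μ n a.1)).expVal fun s => (OT.del s.1).expVal fun c =>
          OT.cert a.1 k.2 a.2 c {μ n a.1} false := by
    intro n
    simp only [DSRKey.delCorrectnessGame, DSRKey.signAll, PMF.monad_bind_eq_bind,
      PMF.monad_pure_eq_pure, PMF.pure_bind, PMF.bind_bind, PMF.bind_apply_eq_expVal]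
    rfl
  have hOT₀ : ∀ n, OT.delCorrectnessGame (fun _ _ => []) n false =
      (OT.setup n).expVal fun a => (OT.keyGen a.1).expVal fun k => (OT.del k.1).expVal fun c =>
          OT.cert a.1 k.2 a.2 c ∅ false := by
    intro n
    simp only [DSRKey.delCorrectnessGame, DSRKey.signAll, PMF.monad_bind_eq_bind,
      PMF.monad_pure_eq_pure, PMF.pure_bind, PMF.bind_apply_eq_expVal]
    rfl
  have hle : ∀ n, (chainScheme OT).delCorrectnessGame msgs n false ≤
      OT.delCorrectnessGame (fun _ _ => []) n false +
      p n * (2 * OT.delCorrectnessGame (fun n pp => [μ n pp]) n false) := by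
    intro n
    rw [hOT₀, hOT₁]
    refine le_trans ?_ (add_le_add_right (hμ n (p n) (msgs n) (hms n)) _)
    rw [← PMF.expVal_add]
    have hsetup : (chainScheme OT).setup = OT.setup := rfl
    simp only [DSRKey.delCorrectnessGame, PMF.monad_bind_eq_bind, hsetup, PMF.bind_apply_eq_expVal,
      chainScheme_keyGen, PMF.expVal_map, chainScheme_signAll]
    refine PMF.expVal_mono _ fun a _ => ?_
    -- The key of the experiment without messages is taken to be the last key of the chain, which
    -- has the same law.
    rw [← chainRun_fresh OT a.1 (msgs n a.1), PMF.expVal_map, ← PMF.expVal_add, PMF.expVal_bind]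
    refine PMF.expVal_mono _ fun g hg => PMF.expVal_mono _ fun g' hg' => ?_
    obtain ⟨k, -, rfl⟩ := (PMF.mem_support_map_iff _ _ _).mp hg
    obtain ⟨h1, -, h3, h4⟩ := mem_support_chainRun OT hg'
    have := del_cert_chainScheme_false_le (OT := OT) a.1 a.2 g' (msgs n a.1).toFinset
      (by simpa [h4] using (congrArg List.length h3).symm)
      (by rw [h3]; simp)
    rwa [h1] at this ⊢
  have hneg₁ := h.2.negligible (fun n pp => [μ n pp]) fun n pp => rfl
  have hneg₀ := h.1.negligible (fun _ _ => []) fun n pp => rfl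
  refine Negligible.mono (hneg₀.add (hneg₁.polyBounded_mul (fun _ => ENNReal.toReal_nonneg)
    (hp.mul (polyBounded_const 2)))) (fun n => ENNReal.toReal_nonneg) fun n => ?_
  have hx₀ := PMF.apply_ne_top (OT.delCorrectnessGame (fun _ _ => []) n) false
  have hx₁ := PMF.apply_ne_top (OT.delCorrectnessGame (fun n pp => [μ n pp]) n) false
  have := ENNReal.toReal_mono (by finiteness) (hle n)
  rw [ENNReal.toReal_add hx₀ (by finiteness)] at this
  simp only [ENNReal.toReal_mul, ENNReal.toReal_natCast, ENNReal.toReal_ofNat] at this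
  push_cast
  linarith

end Correctness

/-! ### Deletion security -/

section Forward

variable (OT : DSRKey) (pp ck : Str)

/-- The probability that all the links of a chain, listed from the oldest one on, are accepted. -/
noncomputable def verProb : Str → List Link → ℝ≥0∞
  | _, [] => 1
  | vk, l :: ls => OT.ver pp vk (pairStr l.msg l.vk) l.sig true * verProb l.vk ls

/-- The probability that the certificates for all the links of a chain, listed from the oldest one
on, and then the certificate for the last key, are accepted. -/
noncomputable def certProb : Str → List Str → List Link → ℝ≥0∞
  | _, [], _ => 0
  | vk, c :: _, [] => OT.cert pp vk ck c ∅ true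
  | vk, c :: cs, l :: ls => OT.cert pp vk ck c {pairStr l.msg l.vk} true * certProb l.vk cs ls

theorem tipVk_append_singleton (vk : Str) (l : Link) (ls : List Link) :
    tipVk vk (ls ++ [l]) = tipVk l.vk ls := by cases ls <;> rfl

theorem verChain_append_singleton (vk : Str) (l : Link) (ls : List Link) :
    verChain OT pp vk (ls ++ [l]) true =
      OT.ver pp vk (pairStr l.msg l.vk) l.sig true * verChain OT pp l.vk ls true := by
  induction ls with
  | nil => simp [verChain, PMF.monad_bind_eq_bind, PMF.monad_pure_eq_pure, tipVk]
  | cons l' ls ih =>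
    simp only [List.cons_append, verChain, PMF.monad_bind_eq_bind, PMF.monad_pure_eq_pure,
      PMF.and_true_eq, ih, tipVk_append_singleton]
    ring

/-- The order from the oldest link on is the one in which two chains with a common first key can be
compared. -/
theorem verChain_true_eq (vk : Str) (ls : List Link) :
    verChain OT pp vk ls true = verProb OT pp vk ls.reverse := by
  induction ls using List.reverseRecOn generalizing vk with
  | nil => simp [verChain, PMF.monad_pure_eq_pure, verProb]
  | append_singleton ls l ih =>
    rw [verChain_append_singleton, ih, List.reverse_append, List.reverse_singleton]
    rfl

theorem certChain_append_singleton (vk c : Str) (l : Link) (cs : List Str) (ls : List Link)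
    (h : cs.length = ls.length) : certChain OT pp vk ck (cs ++ [c]) (ls ++ [l]) true =
      OT.cert pp vk ck c {pairStr l.msg l.vk} true * certChain OT pp l.vk ck cs ls true := by
  induction ls generalizing cs with
  | nil =>
    rw [List.length_eq_zero_iff.mp h]
    simp [certChain, PMF.monad_bind_eq_bind, PMF.monad_pure_eq_pure, tipVk]
  | cons l' ls ih =>
    cases cs with
    | nil => simp at h
    | cons c' cs =>
      simp only [List.cons_append, certChain, PMF.monad_bind_eq_bind, PMF.monad_pure_eq_pure,
        PMF.and_true_eq, ih cs (by simpa using h), tipVk_append_singleton]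
      ring

/-- The tests are independent, so the probability of acceptance is a product, which may be read from
the other end. Equal lengths are needed because `certProb` ignores surplus certificates. -/
theorem certChain_true_eq (vk c : Str) (cs : List Str) (ls : List Link)
    (h : cs.length = ls.length) :
    OT.cert pp (tipVk vk ls) ck c ∅ true * certChain OT pp vk ck cs ls true =
      certProb OT pp ck vk (c :: cs).reverse ls.reverse := by
  induction ls using List.reverseRecOn generalizing vk cs with
  | nil =>
    rw [List.length_eq_zero_iff.mp h]
    simp [certChain, PMF.monad_pure_eq_pure, certProb, tipVk]
  | append_singleton ls l ih =>
    obtain ⟨cs, d, rfl⟩ : ∃ cs' d, cs = cs' ++ [d] := by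
      rcases List.eq_nil_or_concat cs with rfl | ⟨cs', d, rfl⟩
      · simp at h
      · exact ⟨cs', d, by simp⟩
    have h' : cs.length = ls.length := by simpa using h
    rw [certChain_append_singleton OT pp ck _ _ _ _ _ h', tipVk_append_singleton, mul_left_comm,
      ih _ _ h', ← List.cons_append, List.reverse_append, List.reverse_append]
    rfl

end Forward

/-! ### The first difference of two chains -/

/-- A verification key, the certificates, the links for which there are certificates, and the links of
a signature; all of them listed from the oldest one on. -/
abbrev Walk := Str × (List Str × (List Str × List Str))

namespace Walk

/-- The string that is signed in a link. -/
def signed (w : Str) : Str := pairStr (decodeLink w).msg (decodeLink w).vk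

/-- Do both chains begin with the same message and verification key? -/
def agree (s : Walk) : Bool :=
  (!decide (s.2.2.2 = []) && !decide (s.2.2.1 = [])) &&
    decide (signed (s.2.2.2.headD []) = signed (s.2.2.1.headD []))

/-- A link on which both chains agree is dropped. -/
def step (s : Walk) : Walk :=
  if s.agree then ((decodeLink (s.2.2.2.headD [])).vk, (s.2.1.tail, (s.2.2.1.tail, s.2.2.2.tail)))
  else s

/-- The certificate and the signature under the current key. -/
def result (s : Walk) : Str × (Str × (List Str × (Str × Str))) :=
  (s.1, (s.2.1.headD [], (if decide (s.2.2.1 = []) then [] else [signed (s.2.2.1.headD [])],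
    (signed (s.2.2.2.headD []), (decodeLink (s.2.2.2.headD [])).sig))))

/-- The start of the walk, from the output of an adversary. -/
def ofOutput (a : Str × (Str × Str)) : Walk :=
  (a.1, ((decodeList (unpairStr a.2.1).1).reverse, ((decodeList (unpairStr a.2.1).2).reverse,
    (decodeList a.2.2).reverse)))

theorem dpt_signed : DPT signed := DPT.linkSigned

theorem dpt_agree : DPT agree := by
  have hF : DPT fun s : Walk => s.2.2.2 := DPT.snd.comp (DPT.snd.comp DPT.snd)
  have hG : DPT fun s : Walk => s.2.2.1 := DPT.fst.comp (DPT.snd.comp DPT.snd)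
  exact ((DPT.listIsNil.comp hF).not.and (DPT.listIsNil.comp hG).not).and
    (DPT.eq.comp₂ (dpt_signed.comp (DPT.listHead.comp hF)) (dpt_signed.comp (DPT.listHead.comp hG)))

theorem dpt_step : DPT step := by
  have hF : DPT fun s : Walk => s.2.2.2 := DPT.snd.comp (DPT.snd.comp DPT.snd)
  have hG : DPT fun s : Walk => s.2.2.1 := DPT.fst.comp (DPT.snd.comp DPT.snd)
  have hC : DPT fun s : Walk => s.2.1 := DPT.fst.comp DPT.snd
  exact DPT.ite dpt_agree ((DPT.linkVk.comp (DPT.listHead.comp hF)).prodMk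
    ((DPT.listTail.comp hC).prodMk ((DPT.listTail.comp hG).prodMk (DPT.listTail.comp hF)))) DPT.id

theorem dpt_result : DPT result := by
  have hF : DPT fun s : Walk => s.2.2.2 := DPT.snd.comp (DPT.snd.comp DPT.snd)
  have hG : DPT fun s : Walk => s.2.2.1 := DPT.fst.comp (DPT.snd.comp DPT.snd)
  have hC : DPT fun s : Walk => s.2.1 := DPT.fst.comp DPT.snd
  have hS : DPT fun s : Walk => if decide (s.2.2.1 = []) then ([] : List Str)
      else [signed (s.2.2.1.headD [])] :=
    DPT.ite (DPT.listIsNil.comp hG) DPT.nil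
      (DPT.cons.comp₂ (dpt_signed.comp (DPT.listHead.comp hG)) DPT.nil)
  exact DPT.fst.prodMk ((DPT.listHead.comp hC).prodMk (hS.prodMk
    ((dpt_signed.comp (DPT.listHead.comp hF)).prodMk (DPT.linkSig.comp (DPT.listHead.comp hF)))))

theorem dpt_ofOutput : DPT ofOutput :=
  DPT.fst.prodMk ((DPT.reverse.comp (DPT.decode.comp (DPT.unpairFst.comp
    (DPT.fst.comp DPT.snd)))).prodMk ((DPT.reverse.comp (DPT.decode.comp (DPT.unpairSnd.comp
    (DPT.fst.comp DPT.snd)))).prodMk (DPT.reverse.comp (DPT.decode.comp (DPT.snd.comp DPT.snd)))))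

/-- The new key of the walk is a part of the link that is dropped. -/
theorem size_step_le (s : Walk) : (Enc.enc s.step : Val).size ≤ (Enc.enc s : Val).size := by
  have htail : ∀ l : List Str, (encodeList l.tail).length ≤ (encodeList l).length := by
    intro l
    cases l with
    | nil => simp
    | cons x l => simp only [List.tail_cons, encodeList, length_pairStr]; omega
  obtain ⟨vk, C, G, F⟩ := s
  rw [step]
  split_ifs with h
  · cases F with
    | nil => simp [agree] at h
    | cons f F =>
      have h1 := length_decodeLink_le f
      have h2 := htail C
      have h3 := htail G
      simp only [enc_prod, enc_str, enc_list, Val.size, List.headD_cons, List.tail_cons, encodeList,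
        length_pairStr] at h1 h2 h3 ⊢
      omega
  · exact le_rfl

/-- The walk to the first difference of both chains. -/
def run (s : Walk) : Walk := step^[s.2.2.2.length] s

theorem dpt_run : DPT run := by
  have hF : DPT fun s : Walk => s.2.2.2 := DPT.snd.comp (DPT.snd.comp DPT.snd)
  have h := (DPT.rep dpt_step (polyBounded_linear 1 0) (fun w s k _ => by
    have : ∀ k (s : Walk), (Enc.enc (step^[k] s) : Val).size ≤ (Enc.enc s : Val).size := by
      intro k
      induction k with
      | zero => simp
      | succ k ih =>
        intro s
        rw [Function.iterate_succ_apply]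
        exact (ih _).trans (size_step_le s)
    have := this k s
    simp only [enc_prod, Val.size] at this ⊢
    omega)).comp₂ (DPT.listLength.comp hF) (DPT.id (α := Walk))
  simp only [List.length_replicate] at h
  exact h

end Walk

/-- The three strings of the output of an adversary from which the walk starts. -/
def outputStrings (v : Val) : Str × (Str × Str) :=
  (v.left.toStr, (v.right.left.toStr, v.right.right.right.right.toStr))

theorem dpt_outputStrings : DPT outputStrings := by
  have hr : DPT Val.right := DPT.snd.comp DPT.split
  have h1 : DPT fun v : Val => (v.left.toStr, v.right) := (DPT.toStr.first (γ := Val)).comp DPT.split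
  have h2 : DPT fun v : Val => (v.left.toStr, v.right.right.right.toStr) :=
    ((DPT.toStr.comp (hr.comp hr)).second (γ := Str)).comp h1
  exact (h2.second (γ := Str)).comp h1

/-- The output of the reduction, from the output of the adversary. -/
def firstDifference (v : Val) : Str × (Str × (List Str × (Str × Str))) :=
  (Walk.ofOutput (outputStrings v)).run.result

theorem dpt_firstDifference : DPT firstDifference :=
  Walk.dpt_result.comp (Walk.dpt_run.comp (Walk.dpt_ofOutput.comp dpt_outputStrings))

/-! ### The probability of winning the deletion experiment -/

namespace DSRKey

/-- The end of the deletion experiment, from the output and the running time of the adversary. -/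
noncomputable def delOutcome (D : DSRKey) (pp ck : Str) (r : Val × ℕ) : PMF DeletionOutcome :=
  (D.cert pp r.1.left.toStr ck r.1.right.left.toStr
    (decodeList r.1.right.right.left.toStr).toFinset).bind fun b =>
  (D.ver pp r.1.left.toStr r.1.right.right.right.left.toStr
    r.1.right.right.right.right.toStr).map fun b' =>
  ⟨r.2, (decodeList r.1.right.right.left.toStr).toFinset, b && decide (r.1.right.right.right.left.toStr ∉
    (decodeList r.1.right.right.left.toStr).toFinset) && b'⟩

theorem deletionGame_eq (D : DSRKey) (A : Cmd) (n : ℕ) : D.deletionGame A n =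
    (D.setup n).bind fun a => (A.sem (Enc.enc (n, a.1))).bind fun r => D.delOutcome a.1 a.2 r := by
  simp only [deletionGame, PMF.monad_bind_eq_bind, PMF.monad_pure_eq_pure, Cmd.sem, PMF.bind_map,
    delOutcome]
  rfl

/-- The probability of winning with a given output. -/
noncomputable def delWin (D : DSRKey) (pp ck : Str) (v : Val) : ℝ≥0∞ :=
  if v.right.right.right.left.toStr ∉ (decodeList v.right.right.left.toStr).toFinset then
    D.cert pp v.left.toStr ck v.right.left.toStr (decodeList v.right.right.left.toStr).toFinset true *
      D.ver pp v.left.toStr v.right.right.right.left.toStr v.right.right.right.right.toStr true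
  else 0

/-- With `E` always true this is the many-time experiment, and with `S.card ≤ 1` it is the one-time
experiment. -/
theorem expVal_delOutcome (D : DSRKey) (pp ck : Str) (r : Val × ℕ) (E : Finset Str → Prop)
    [DecidablePred E] : ((D.delOutcome pp ck r).expVal fun o =>
      if o.win = true ∧ E o.signed then 1 else 0) =
    if E (decodeList r.1.right.right.left.toStr).toFinset then D.delWin pp ck r.1 else 0 := by
  simp only [delOutcome, PMF.expVal_bind, PMF.expVal_map, delWin]
  by_cases hE : E (decodeList r.1.right.right.left.toStr).toFinset
  · by_cases hm : r.1.right.right.right.left.toStr ∈ (decodeList r.1.right.right.left.toStr).toFinset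
    · simp [hm, PMF.expVal]
    · simp only [hE, hm, PMF.expVal, tsum_bool]
      simp
  · simp [hE, PMF.expVal]

end DSRKey

/-! ### From a successful deleter of the chain to a break at the first difference. -/

section DelSecurity

variable (OT : DSRKey) (pp ck : Str)

theorem pairStr_injective {a b c d : Str} (h : pairStr a b = pairStr c d) : a = c ∧ b = d := by
  have := congrArg unpairStr h
  rw [unpairStr_pairStr, unpairStr_pairStr] at this
  simpa using this

namespace Walk

/-- The probability that the certificates and the signature of a walk are accepted. -/
noncomputable def win (s : Walk) : ℝ≥0∞ :=
  certProb OT pp ck s.1 s.2.1 (s.2.2.1.map decodeLink) * verProb OT pp s.1 (s.2.2.2.map decodeLink)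

/-- The message of the last link of the signature occurs in no link of the other chain. -/
def IsForged (s : Walk) : Prop :=
  ∃ h : s.2.2.2 ≠ [], ∀ g ∈ s.2.2.1, (decodeLink g).msg ≠ (decodeLink (s.2.2.2.getLast h)).msg

/-- A link common to both chains cannot be the last one of the signature, since its message is
certified. Dropping it removes factors that are at most one, so the product does not decrease. -/
theorem step_of_agree {s : Walk} (hs : s.IsForged) (h : s.agree = true) :
    s.step.IsForged ∧ s.win OT pp ck ≤ s.step.win OT pp ck ∧
      s.2.2.2.length = s.step.2.2.2.length + 1 := by
  obtain ⟨vk, C, G, F⟩ := s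
  rw [step, if_pos h]
  obtain ⟨hne, hs⟩ := hs
  cases F with
  | nil => exact absurd rfl hne
  | cons f F =>
    cases G with
    | nil => simp [agree] at h
    | cons g G =>
      simp only [agree, List.headD_cons, Bool.and_eq_true, signed] at h
      obtain ⟨h1, h2⟩ := pairStr_injective (of_decide_eq_true h.2)
      simp only [List.headD_cons, List.tail_cons] at hs ⊢
      refine ⟨?_, ?_, rfl⟩
      · have hF : F ≠ [] := by
          rintro rfl
          exact hs g (by simp) (by simpa using h1.symm)
        refine ⟨hF, fun g' hg' => ?_⟩
        have := hs g' (by simp [hg'])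
        rwa [List.getLast_cons hF] at this
      · cases C with
        | nil => simp [win, certProb]
        | cons c C =>
          simp only [win, List.map_cons, certProb, verProb, List.tail_cons, h2]
          calc _ ≤ (1 * certProb OT pp ck (decodeLink g).vk C (G.map decodeLink)) *
                (1 * verProb OT pp (decodeLink g).vk (F.map decodeLink)) := by
                gcongr
                · exact PMF.coe_le_one _ _
                · exact PMF.coe_le_one _ _
            _ = _ := by rw [one_mul, one_mul]

theorem verProb_le_one (vk : Str) (ls : List Link) : verProb OT pp vk ls ≤ 1 := by
  induction ls generalizing vk with
  | nil => exact le_rfl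
  | cons l ls ih => exact mul_le_one' (PMF.coe_le_one _ _) (ih _)

theorem certProb_le_one (vk : Str) (cs : List Str) (ls : List Link) :
    certProb OT pp ck vk cs ls ≤ 1 := by
  induction cs generalizing vk ls with
  | nil => simp [certProb]
  | cons c cs ih =>
    cases ls with
    | nil => exact PMF.coe_le_one _ _
    | cons l ls => exact mul_le_one' (PMF.coe_le_one _ _) (ih _ _)

/-- At the first difference, the certificate and the signature break the one-time scheme. -/
theorem win_le_of_not_agree {s : Walk} (hs : s.IsForged) (h : s.agree = false) :
    s.win OT pp ck ≤ (if (decodeList (Enc.enc s.result : Val).right.right.left.toStr).toFinset.card ≤ 1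
      then OT.delWin pp ck (Enc.enc s.result) else 0) := by
  obtain ⟨vk, C, G, F⟩ := s
  obtain ⟨hne, hs⟩ := hs
  cases F with
  | nil => exact absurd rfl hne
  | cons f F =>
    cases C with
    | nil => simp [win, certProb]
    | cons c C =>
      cases G with
      -- The certified chain has ended: the certificate is for `∅`, and a signature of any string at
      -- all breaks the one-time scheme.
      | nil =>
        simp only [result, decide_true, if_true, enc_prod, Val.right, Val.left, enc_str, enc_list,
          Val.toStr, decodeList_encodeList, List.headD_cons, DSRKey.delWin, List.toFinset_nil,
          Finset.card_empty, zero_le, Finset.notMem_empty, not_false_eq_true, win, List.map_nil,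
          List.map_cons, certProb, verProb, signed]
        gcongr
        exact mul_le_of_le_one_right' (verProb_le_one OT pp _ _)
      | cons g G =>
        -- Both chains continue with different strings under the same key: the certificate is for
        -- one of them and the signature is of the other.
        have hd : signed f ≠ signed g := by simpa [agree] using h
        have hc : decide (g :: G = []) = false := by simp
        simp only [result, hc, Bool.false_eq_true, if_false, enc_prod, Val.right, Val.left, enc_str,
          enc_list, Val.toStr, decodeList_encodeList, List.headD_cons, DSRKey.delWin,
          List.toFinset_cons, List.toFinset_nil, insert_empty_eq, Finset.card_singleton, le_refl,
          if_true, Finset.mem_singleton, hd, not_false_eq_true, win, List.map_cons, certProb, verProb]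
        simp only [signed]
        gcongr
        · exact mul_le_of_le_one_right' (certProb_le_one OT pp ck _ _ _)
        · exact mul_le_of_le_one_right' (verProb_le_one OT pp _ _)

/-- Each effective step shortens the signature, while a forged walk never has an empty one. So a
difference is met within as many steps as the signature has links, and from then on the walk stands
still. -/
theorem win_le_run {s : Walk} (hs : s.IsForged) : s.win OT pp ck ≤
    (if (decodeList (Enc.enc s.run.result : Val).right.right.left.toStr).toFinset.card ≤ 1
      then OT.delWin pp ck (Enc.enc s.run.result) else 0) := by
  rw [run]
  obtain ⟨k, hk⟩ : ∃ k, k = s.2.2.2.length := ⟨_, rfl⟩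
  rw [← hk]
  induction k generalizing s with
  | zero => exact absurd (List.length_eq_zero_iff.mp hk.symm) hs.1
  | succ k ih =>
    rw [Function.iterate_succ_apply]
    cases h : s.agree with
    | false =>
      have h1 : s.step = s := by simp [step, h]
      rw [h1, Function.iterate_fixed h1]
      exact win_le_of_not_agree OT pp ck hs h
    | true =>
      obtain ⟨h1, h2, h3⟩ := step_of_agree OT pp ck hs h
      exact h2.trans (ih h1 (by omega))

end Walk

/-- If the left side is not zero, then the output parses as two chains, `S` is the set of messages
of the certified one, and the message outside `S` is the last one of the signature. So the walk is
forged, and the bound holds for each single output of the adversary. -/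
theorem delWin_chainScheme_le (v : Val) : (chainScheme OT).delWin pp ck v ≤
    (if (decodeList (Enc.enc (firstDifference v) : Val).right.right.left.toStr).toFinset.card ≤ 1
      then OT.delWin pp ck (Enc.enc (firstDifference v)) else 0) := by
  rcases eq_or_ne ((chainScheme OT).delWin pp ck v) 0 with h0 | h0
  · rw [h0]
    exact zero_le
  obtain ⟨hm, hc, hv⟩ : v.right.right.right.left.toStr ∉
      (decodeList v.right.right.left.toStr).toFinset ∧
      (chainScheme OT).cert pp v.left.toStr ck v.right.left.toStr
        (decodeList v.right.right.left.toStr).toFinset true ≠ 0 ∧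
      (chainScheme OT).ver pp v.left.toStr v.right.right.right.left.toStr
        v.right.right.right.right.toStr true ≠ 0 := by
    rw [DSRKey.delWin] at h0
    split_ifs at h0 with hm
    · exact absurd rfl h0
    · exact ⟨hm, left_ne_zero_of_mul h0, right_ne_zero_of_mul h0⟩
  have hver : ∃ f fs, decodeList v.right.right.right.right.toStr = f :: fs ∧
      (decodeLink f).msg = v.right.right.right.left.toStr ∧
      (chainScheme OT).ver pp v.left.toStr v.right.right.right.left.toStr
        v.right.right.right.right.toStr true =
      verChain OT pp v.left.toStr ((f :: fs).map decodeLink) true := by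
    simp only [chainScheme, decodeChain] at hv ⊢
    cases hd : decodeList v.right.right.right.right.toStr with
    | nil => simp [hd, PMF.monad_pure_eq_pure] at hv
    | cons f fs =>
      simp only [hd, List.map_cons] at hv ⊢
      split_ifs at hv ⊢ with h
      · exact ⟨f, fs, rfl, h.symm, rfl⟩
      · simp [PMF.monad_pure_eq_pure] at hv
  have hcert : ∃ c cs, decodeList (unpairStr v.right.left.toStr).1 = c :: cs ∧
      (decodeList v.right.right.left.toStr).toFinset =
        ((decodeChain (unpairStr v.right.left.toStr).2).map Link.msg).toFinset ∧
      (chainScheme OT).cert pp v.left.toStr ck v.right.left.toStr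
        (decodeList v.right.right.left.toStr).toFinset true =
      certProb OT pp ck v.left.toStr (c :: cs).reverse
        (decodeChain (unpairStr v.right.left.toStr).2).reverse := by
    simp only [chainScheme] at hc ⊢
    cases hd : decodeList (unpairStr v.right.left.toStr).1 with
    | nil => simp [hd, PMF.monad_pure_eq_pure] at hc
    | cons c cs =>
      simp only [hd] at hc ⊢
      split_ifs at hc ⊢ with h
      · simp only [PMF.monad_bind_eq_bind, PMF.monad_pure_eq_pure, PMF.and_true_eq] at hc ⊢
        refine ⟨c, cs, rfl, h, certChain_true_eq OT pp ck _ _ _ _ ?_⟩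
        by_contra hl
        rw [certChain_of_length_ne _ _ _ _ _ _ hl] at hc
        simp at hc
      · simp [PMF.monad_pure_eq_pure] at hc
  obtain ⟨f, fs, hf, hfm, hv'⟩ := hver
  obtain ⟨c, cs, hcs, hS, hc'⟩ := hcert
  have hwin : (chainScheme OT).delWin pp ck v = (Walk.ofOutput (outputStrings v)).win OT pp ck := by
    rw [DSRKey.delWin, if_pos hm, hv', hc', verChain_true_eq]
    simp only [Walk.win, Walk.ofOutput, outputStrings, hf, hcs, decodeChain, List.map_reverse]
  rw [hwin]
  refine Walk.win_le_run OT pp ck ⟨?_, fun g hg => ?_⟩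
  · simp [Walk.ofOutput, outputStrings, hf]
  · simp only [Walk.ofOutput, outputStrings, hf, List.getLast_reverse, List.head_cons, hfm]
    intro he
    rw [hS] at hm
    refine hm ?_
    simp only [Walk.ofOutput, outputStrings, List.mem_reverse] at hg
    simp only [decodeChain, List.map_map, List.mem_toFinset, List.mem_map]
    exact ⟨g, hg, he⟩

end DelSecurity

/-- The reduction runs the adversary and applies `firstDifference` to its output. The output has
polynomial size because its size is bounded through the running time, so the second phase is
polynomial as well. -/
theorem chainScheme_delSecurity {OT : DSRKey} (hQPT : OT.QPT) (h : OT.OneTimeDelSecurity) :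
    (chainScheme OT).DelSecurity := by
  intro A hA
  obtain ⟨P, hP⟩ := hA
  obtain ⟨W, p, hp, hpm, hW, hWs⟩ := dpt_firstDifference.exists_sem
  obtain ⟨q, hq, -, hqs⟩ := hQPT.1.size_le
  have hsetup : (chainScheme OT).setup = OT.setup := rfl
  have hAs : ∀ n, ∀ a ∈ (OT.setup n).support, ∀ r ∈ (A.sem (Enc.enc (n, a.1))).support,
      r.2 ≤ P.eval n := by
    intro n a ha r hr
    -- The time bound is assumed for complete outcomes only. Any completion of the run will do,
    -- since verification does not change the recorded time.
    obtain ⟨o, ho⟩ := ((chainScheme OT).delOutcome a.1 a.2 r).support_nonempty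
    have : o.steps = r.2 := by
      simp only [DSRKey.delOutcome, PMF.mem_support_bind_iff, PMF.mem_support_map_iff] at ho
      obtain ⟨_, -, _, -, rfl⟩ := ho
      rfl
    rw [← this]
    refine hP n o ?_
    rw [DSRKey.deletionGame_eq, PMF.mem_support_bind_iff]
    refine ⟨a, ha, ?_⟩
    rw [PMF.mem_support_bind_iff]
    exact ⟨r, hr, ho⟩
  have hB : OT.DeleterQPT (A.comp W) := by
    obtain ⟨R, hR⟩ : PolyBounded fun n => P.eval n + A.bound +
        (p (n + q (n + 1) + 2 + A.bound + 3 * P.eval n) + W.bound) :=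
      (P.polyBounded_eval.add (polyBounded_const _)).add ((hp.comp ((((polyBounded_id.add
        (hq.comp (polyBounded_id.add (polyBounded_const 1)))).add (polyBounded_const 2)).add
        (polyBounded_const _)).add ((polyBounded_const 3).mul P.polyBounded_eval))).add
        (polyBounded_const _))
    refine ⟨R, fun n o ho => le_trans ?_ (hR n)⟩
    simp only [DSRKey.deletionGame_eq, Cmd.sem_comp, PMF.mem_support_bind_iff,
      PMF.mem_support_map_iff, DSRKey.delOutcome] at ho
    obtain ⟨a, ha, _, ⟨r, hr, r', hr', rfl⟩, _, -, _, -, rfl⟩ := ho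
    have h1 := hAs n a ha r hr
    have h2 := size_sem_le hr
    have h3 := (hWs r.1 r' hr').1
    have h4 := hqs n a ha
    have h5 : p (Enc.enc r.1 : Val).size ≤ p (n + q (n + 1) + 2 + A.bound + 3 * P.eval n) := by
      refine hpm ?_
      simp only [enc_prod, enc_str, enc_nat, Val.size, List.length_replicate, enc_val] at h2 h4 ⊢
      omega
    simp only
    omega
  refine (h _ hB).mono (fun n => ENNReal.toReal_nonneg) fun n => ?_
  rw [prob_eq_expVal, prob_eq_expVal]
  refine ENNReal.toReal_mono ?_ ?_
  · refine ((PMF.expVal_le_of_le _ fun o _ => ?_).trans_lt ENNReal.one_lt_top).ne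
    split_ifs <;> simp
  · simp only [DSRKey.deletionGame_eq, PMF.expVal_bind, hsetup, Cmd.sem_comp, PMF.expVal_map]
    refine PMF.expVal_mono _ fun a _ => PMF.expVal_mono _ fun r _ => ?_
    have h1 := (chainScheme OT).expVal_delOutcome a.1 a.2 r fun _ => True
    simp only [and_true, if_true] at h1
    simp only [OT.expVal_delOutcome a.1 a.2 _ fun S => S.card ≤ 1]
    rw [h1]
    refine (delWin_chainScheme_le OT a.1 a.2 r.1).trans (le_of_eq ?_)
    have h2 := congrArg (fun p => p.expVal fun v : Val =>
      if (decodeList v.right.right.left.toStr).toFinset.card ≤ 1 then OT.delWin a.1 a.2 v else 0)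
      (hW r.1)
    simp only [PMF.expVal_map, PMF.expVal_pure, enc_val] at h2
    exact h2.symm

/-! ### Programs whose oracle queries are answered by subroutines -/

/-- Queries are answered as follows, on the basis of a state `v`. The program `pre` is applied to `v`
and the query; its result `(flag, (u, ρ))` says whether the oracle is asked for `u`, and `post` is
applied to the answer (or to `u` itself) and `ρ`, with the new state and the answer as its result. The
last component of the state counts the additional steps. -/
noncomputable def hookOracle {Θ : Type} (O : Oracle Θ) (pre post : Cmd) : Oracle (Θ × Val × ℕ) :=
  fun θ m => (pre.sem (.node θ.2.1 (.str m))).bind fun r =>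
    (if r.1.left.toStr.head? = some true then
      (O θ.1 r.1.right.left.toStr).map fun p =>
        (p.1, (Val.str p.2, 1 + r.1.right.left.toStr.length + p.2.length))
    else PMF.pure (θ.1, (r.1.right.left, 1))).bind fun p =>
      (post.sem (.node p.2.1 r.1.right.right)).map fun r' =>
        ((p.1, (r'.1.left, θ.2.2 + (r.2 + pre.bound + p.2.2 + r'.2 + post.bound + 9))),
          r'.1.right.toStr)

namespace Cmd

/-- The program for a query, with the state in register `0`. -/
def hook (pre post : Cmd) (K x y : ℕ) : Cmd :=
  seq (op .copy 1 (y + K) 2) (seq (node 0 0 1) (seq (pre.call 0) (seq (split 1 0 0)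
    (seq (split 2 0 0) (seq (ite 1 (query 2 2) skip) (seq (node 0 2 0) (seq (const 1 [])
    (seq (post.call 0) (seq (split 0 1 0) (seq (op .copy (x + K) 1 2) (const 1 [])))))))))))

/-- The first register that is used by the simulated program. -/
def hookBase (ini pre post fin : Cmd) : ℕ := ini.bound + pre.bound + post.bound + fin.bound + 3

/-- The program `ini` computes a state and an input, on which the program `c` is run. The queries of
`c` are answered by `pre` and `post`, and `fin` is applied to the last state and the result. -/
def withHook (c ini pre post fin : Cmd) : Cmd :=
  seq (ini.call 0) (seq (split 0 (hookBase ini pre post fin) 0)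
    (seq (c.subst (· + hookBase ini pre post fin) (hook pre post (hookBase ini pre post fin)))
      (seq (node 0 0 (hookBase ini pre post fin)) (fin.call 0))))

end Cmd

/-- A memory with given registers `0`, `1` and `2`, and with the registers of another memory from
register `K` on. -/
def Mem.layout (K : ℕ) (t : Mem) (a b c : Val) (k : ℕ) : Mem :=
  ⟨fun y => if y = 0 then a else if y = 1 then b else if y = 2 then c else
    if y < K then .str [] else t.reg (y - K), k⟩

namespace Mem

variable {K : ℕ} (t : Mem) (a b c v : Val) (k : ℕ)

theorem layout_set_zero : (t.layout K a b c k).set 0 v = t.layout K v b c k :=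
  Mem.ext' (fun x => by simp only [set_reg, layout]; split_ifs <;> rfl) rfl

theorem layout_set_one : (t.layout K a b c k).set 1 v = t.layout K a v c k :=
  Mem.ext' (fun x => by simp only [set_reg, layout]; split_ifs <;> first | rfl | omega) rfl

theorem layout_set_two : (t.layout K a b c k).set 2 v = t.layout K a b v k :=
  Mem.ext' (fun x => by simp only [set_reg, layout]; split_ifs <;> first | rfl | omega) rfl

theorem layout_set_add (h : 2 < K) (x : ℕ) :
    (t.layout K a b c k).set (x + K) v = (t.set x v).layout K a b c k :=
  Mem.ext' (fun y => by simp only [set_reg, layout]; split_ifs <;> first | rfl | omega) rfl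

theorem layout_tick (j : ℕ) : (t.layout K a b c k).tick j = t.layout K a b c (k + j) := rfl

theorem layout_zero : (t.layout K a b c k).reg 0 = a := rfl

theorem layout_one : (t.layout K a b c k).reg 1 = b := rfl

theorem layout_two : (t.layout K a b c k).reg 2 = c := rfl

theorem layout_add (h : 2 < K) (y : ℕ) : (t.layout K a b c k).reg (y + K) = t.reg y := by
  simp only [layout]
  rw [if_neg (by omega), if_neg (by omega), if_neg (by omega), if_neg (by omega),
    Nat.add_sub_cancel]

theorem tick_layout (j : ℕ) : (t.tick j).layout K a b c k = t.layout K a b c k := rfl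

end Mem

theorem Val.toStr_str (s : Str) : (Val.str s).toStr = s := rfl

theorem run_call_layout {Θ : Type} (O : Oracle Θ) (d : Cmd) {K : ℕ} (hK : d.bound < K) (θ : Θ)
    (t : Mem) (a : Val) (k : ℕ) :
    run O (d.call 0) (θ, t.layout K a (.str []) (.str []) k) = (d.sem a).map fun r =>
      (θ, t.layout K r.1 (.str []) (.str []) (k + (r.2 + d.bound))) := by
  rw [run_call_sem]
  · simp only [Mem.layout_set_zero, Mem.layout_tick, Mem.layout_zero]
  · intro x hx _
    simp only [Mem.layout]
    split_ifs <;> first | rfl | omega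

/-- Registers `1` and `2` are empty again at the end. The `9` in `hookOracle` comes from ten
operations of unit base cost outside the subroutines and the oracle branch, of which one is charged
to the simulated query itself; copying the query and the answer costs what the simulated query costs
for reading them. -/
theorem run_hook {Θ : Type} (O : Oracle Θ) (pre post : Cmd) (K x y : ℕ) (h1 : pre.bound < K)
    (h2 : post.bound < K) (h3 : 2 < K) (θ : Θ × Val × ℕ) (t : Mem) :
    run O (Cmd.hook pre post K x y)
        (θ.1, t.layout K θ.2.1 (.str []) (.str []) (t.steps + θ.2.2)) =
      (run (hookOracle O pre post) (.query x y) (θ, t)).map fun p =>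
        (p.1.1, p.2.layout K p.1.2.1 (.str []) (.str []) (p.2.steps + p.1.2.2)) := by
  obtain ⟨θ, v, k⟩ := θ
  simp only [Cmd.hook, run, PMF.monad_bind_eq_bind, PMF.monad_pure_eq_pure, PMF.pure_bind,
    Mem.get, Mem.layout_add _ _ _ _ _ h3, Mem.layout_set_one, Mem.layout_tick, Mem.layout_set_zero,
    Mem.layout_zero, Mem.layout_one, Mem.layout_two, run_call_layout _ _ h1, PMF.bind_map,
    Function.comp_def, Mem.layout_set_two, StrOp.eval, Val.toStr_str, hookOracle, PMF.map_bind,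
    PMF.bind_bind, PMF.pure_map]
  congr 1
  funext r
  split_ifs with hf
  · rw [PMF.bind_bind, PMF.bind_map]
    congr 1
    funext p
    simp only [PMF.pure_bind, Function.comp_def, Mem.layout_set_two, Mem.layout_set_zero,
      Mem.layout_set_one, Mem.layout_tick, Mem.layout_zero, Mem.layout_one, Mem.layout_two,
      run_call_layout _ _ h2, PMF.bind_map, Mem.layout_set_add _ _ _ _ _ _ h3, Mem.tick_layout,
      Val.toStr_str]
    congr 1
    funext r'
    congr 3
    simp only [Mem.tick_steps, Mem.set_steps, List.length_nil]
    omega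
  · simp only [PMF.pure_bind, Function.comp_def, Mem.layout_set_two, Mem.layout_set_zero,
      Mem.layout_set_one, Mem.layout_tick, Mem.layout_zero, Mem.layout_one, Mem.layout_two,
      run_call_layout _ _ h2, PMF.bind_map, Mem.layout_set_add _ _ _ _ _ _ h3, Mem.tick_layout,
      Val.toStr_str]
    congr 1
    funext r'
    congr 3
    simp only [Mem.tick_steps, Mem.set_steps, List.length_nil]
    omega

/-- The result and the running time of a program with hooks. -/
theorem run_withHook {Θ : Type} (O : Oracle Θ) (c ini pre post fin : Cmd) (θ : Θ) (v : Val) :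
    (run O (c.withHook ini pre post fin) (θ, Mem.start v)).map
      (fun p => (p.1, (p.2.reg 0, p.2.steps))) =
    (ini.sem v).bind fun r => (run (hookOracle O pre post) c
      ((θ, (r.1.left, r.2 + ini.bound + 1)), Mem.start r.1.right)).bind fun p =>
        (fin.sem (.node p.1.2.1 (p.2.reg 0))).map fun r' =>
          (p.1.1, (r'.1, p.2.steps + p.1.2.2 + 1 + (r'.2 + fin.bound))) := by
  have h0 : ∀ x, 0 < x → x ≤ 0 + ini.bound → (Mem.start v).reg x = .str [] := by
    intro x hx _
    rw [Mem.start_reg, if_neg (by omega)]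
  obtain ⟨K, hK⟩ : ∃ K, K = Cmd.hookBase ini pre post fin := ⟨_, rfl⟩
  have hK' : ini.bound + pre.bound + post.bound + fin.bound + 3 = K := hK.symm
  rw [Cmd.withHook, ← hK]
  simp only [run, PMF.monad_bind_eq_bind, PMF.monad_pure_eq_pure, PMF.pure_bind,
    run_call_sem _ _ _ _ _ h0, PMF.bind_map, PMF.map_bind, Function.comp_def]
  congr 1
  funext r
  have e : ((((((Mem.start v).set 0 r.1).tick (r.2 + ini.bound)).set 0 (.str [])).set 0 r.1.left).set
      K r.1.right).tick 1 = (Mem.start r.1.right).layout K r.1.left (.str []) (.str [])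
        ((Mem.start r.1.right).steps + (r.2 + ini.bound + 1)) := by
    refine Mem.ext' (fun x => ?_) (by simp [Mem.layout, Mem.start_steps, add_assoc])
    simp only [Mem.tick_reg, Mem.set_reg, Mem.layout, Mem.start_reg]
    split_ifs <;> first | rfl | omega
  have key := run_subst (hookOracle O pre post) O (· + K) (Cmd.hook pre post K)
    (fun θ : Θ × Val × ℕ => θ.1)
    (fun θ t => t.layout K θ.2.1 (.str []) (.str []) (t.steps + θ.2.2)) c.bound
    (fun θ t x _ => Mem.layout_add _ _ _ _ _ (by omega) _)
    (fun θ t x v _ => (Mem.layout_set_add _ _ _ _ _ _ (by omega) _).symm)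
    (fun θ t k => by
      rw [Mem.layout_tick, Mem.tick_layout, Mem.tick_steps]
      congr 1; omega)
    (fun θ t x y _ _ => run_hook O pre post K x y (by omega) (by omega) (by omega) θ t)
    c le_rfl (θ, (r.1.left, r.2 + ini.bound + 1)) (Mem.start r.1.right)
  simp only at key
  simp only [Mem.tick_reg, Mem.set_reg, if_true]
  rw [e, key, PMF.bind_map]
  congr 1
  funext p
  simp only [Function.comp_def]
  rw [run_call_sem]
  · simp only [PMF.map_comp]
    have hreg : ((p.2.layout K p.1.2.1 (.str []) (.str []) (p.2.steps + p.1.2.2)).set 0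
        (.str [])).reg K = p.2.reg 0 := by
      rw [Mem.layout_set_zero]
      have := Mem.layout_add (K := K) p.2 (.str []) (.str []) (.str []) (p.2.steps + p.1.2.2)
        (by omega) 0
      rwa [Nat.zero_add] at this
    have hK0 : K ≠ 0 := by omega
    rw [Mem.set_reg, if_neg hK0] at hreg
    simp only [Mem.tick_reg, Mem.set_reg, if_true, hK0, if_false, hreg, Mem.layout_zero]
    rfl
  · intro x hx hx'
    simp only [Mem.tick_reg, Mem.set_reg, Mem.layout]
    split_ifs <;> first | rfl | omega

/-- The answers to the queries, without the count of the steps. -/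
noncomputable def answerOracle {Θ : Type} (O : Oracle Θ) (pre post : Cmd) : Oracle (Θ × Val) :=
  fun θ m => ((pre.sem (.node θ.2 (.str m))).map Prod.fst).bind fun r =>
    (if r.left.toStr.head? = some true then
      (O θ.1 r.right.left.toStr).map fun p => (p.1, Val.str p.2)
    else PMF.pure (θ.1, r.right.left)).bind fun p =>
      ((post.sem (.node p.2 r.right.right)).map Prod.fst).map fun r' =>
        ((p.1, r'.left), r'.right.toStr)

/-- The count of the additional steps never influences an answer, so it may be dropped when only
probabilities matter. -/
theorem run_hookOracle_map {Θ : Type} (O : Oracle Θ) (c pre post : Cmd) (θ : Θ × Val × ℕ)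
    (s : Mem) : (run (hookOracle O pre post) c (θ, s)).map (fun p => ((p.1.1, p.1.2.1), p.2)) =
      run (answerOracle O pre post) c ((θ.1, θ.2.1), s) := by
  have h := run_bind_oracle (hookOracle O pre post) (answerOracle O pre post)
    (fun θ => PMF.pure (θ.1, θ.2.1)) (fun θ w => by
      simp only [PMF.pure_map, PMF.pure_bind, hookOracle, answerOracle, PMF.bind_bind, PMF.bind_map,
        Function.comp_def, PMF.map_comp]
      congr 1
      funext r
      split_ifs
      · simp only [PMF.bind_map, Function.comp_def]
        rfl
      · simp only [PMF.pure_bind]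
        rfl) c θ s
  simp only [PMF.pure_map, PMF.pure_bind] at h
  exact h

/-! ### Embedding a key of the one-time scheme in a chain -/

/-- The classical part of the state of the reduction: the public parameter, the verification key that
is to be embedded, its position in the chain, the present position (both in unary), and the chain. -/
abbrev EmbedCtx := Str × (Str × (Str × (Str × Str)))

section

variable (OT : DSRKey)

/-- The key at position `t`: a new one, or the embedded one, for which only the verification key is
known. -/
noncomputable def embedKey (a : Str × EmbedCtx) : PMF (Val × Str) :=
  if decide (a.2.2.2.1 = a.1) then PMF.pure (.str [], a.2.2.1) else OT.keyGen a.2.1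

/-- The first part of signing a message `m`: a new key is chosen, and the string that is to be signed
or (unless the current key is the embedded one) its signature is computed. -/
noncomputable def embedPre (a : (Val × EmbedCtx) × Str) :
    PMF (Bool × (Str × (Val × ((Str × Str) × EmbedCtx)))) :=
  (embedKey OT (true :: a.1.2.2.2.2.1, a.1.2)).bind fun k =>
    if decide (a.1.2.2.2.1 = a.1.2.2.2.2.1) then
      PMF.pure (true, (pairStr a.2 k.2, (k.1, ((a.2, k.2), a.1.2))))
    else (OT.sign a.1.2.1 a.1.1 (pairStr a.2 k.2)).map fun r =>
      (false, (r.2, (k.1, ((a.2, k.2), a.1.2))))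

/-- The second part of signing: a new link is put in front of the chain. -/
def embedPost (a : Str × (Val × ((Str × Str) × EmbedCtx))) : (Val × EmbedCtx) × Str :=
  let chain := pairStr (encodeLink ⟨a.2.2.1.1, a.2.2.1.2, a.1⟩) a.2.2.2.2.2.2.2
  ((a.2.1, (a.2.2.2.1, (a.2.2.2.2.1, (a.2.2.2.2.2.1, (true :: a.2.2.2.2.2.2.1, chain))))), chain)

/-- The end of the reduction: the link of the forged chain at the position of the embedded key. -/
def embedFinal (a : (Val × EmbedCtx) × Val) : Str × Str :=
  let w := ((decodeList a.2.right.toStr).reverse.drop a.1.2.2.2.1.length).headD []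
  (Walk.signed w, (decodeLink w).sig)

namespace DPT

variable {α β γ : Type} [Enc α] [Enc β] [Enc γ]

theorem swapIn : DPT fun a : α × (β × γ) => (a.2.1, (a.1, a.2.2)) :=
  assoc.comp ((swap.first (γ := γ)).comp assocInv)

theorem withBool (b : Bool) : DPT fun a : α => (b, a) :=
  swap.comp ((withStr (α := α) [b]).congr_enc (f := fun a : α => (a, b)) (fun a => a) (fun _ => rfl)
    fun _ => rfl)

theorem consTrue {f : α → Str} (hf : DPT f) : DPT fun a => true :: f a := by
  have h : DPT fun s : Str => true :: s := append.comp₂ (const [true]) id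
  exact h.comp hf

theorem embedPost : DPT embedPost := by
  have e : DPT fun a : Str × ((Str × Str) × EmbedCtx) =>
      ((a.2.2.1, (a.2.2.2.1, (a.2.2.2.2.1, (true :: a.2.2.2.2.2.1,
        pairStr (encodeLink ⟨a.2.1.1, a.2.1.2, a.1⟩) a.2.2.2.2.2.2)))),
        pairStr (encodeLink ⟨a.2.1.1, a.2.1.2, a.1⟩) a.2.2.2.2.2.2) := by
    have hc : DPT fun a : Str × ((Str × Str) × EmbedCtx) => a.2.2 := snd.comp snd
    have hl : DPT fun a : Str × ((Str × Str) × EmbedCtx) =>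
        pairStr (pairStr a.2.1.1 (pairStr a.2.1.2 a.1)) a.2.2.2.2.2.2 :=
      pair.comp₂ (pair.comp₂ (fst.comp (fst.comp snd)) (pair.comp₂ (snd.comp (fst.comp snd)) fst))
        (snd.comp (snd.comp (snd.comp (snd.comp hc))))
    exact ((fst.comp hc).prodMk ((fst.comp (snd.comp hc)).prodMk ((fst.comp (snd.comp
      (snd.comp hc))).prodMk ((consTrue (fst.comp (snd.comp (snd.comp (snd.comp hc))))).prodMk
      hl)))).prodMk hl
  exact assocInv.comp ((e.second (γ := Val)).comp swapIn)

theorem embedFinal : DPT embedFinal := by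
  have h1 : DPT fun a : (Val × EmbedCtx) × Val => (a.1.2.2.2.1, a.2.right.toStr) :=
    (((fst.comp (snd.comp (snd.comp snd))).first (γ := Str))).comp
      ((toStr.comp (snd.comp split)).second (γ := Val × EmbedCtx))
  have h2 : DPT fun a : Str × Str => ((decodeList a.2).reverse.drop a.1.length).headD [] :=
    listHead.comp (listDrop.comp₂ fst (reverse.comp (decode.comp snd)))
  have h3 : DPT fun w : Str => (Walk.signed w, (decodeLink w).sig) :=
    Walk.dpt_signed.prodMk linkSig
  exact h3.comp (h2.comp h1)

end DPT

variable {OT}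

theorem IsQPT.embedKey (h : OT.QPT) : IsQPT (embedKey OT) := by
  refine IsQPT.ite (b := fun a : Str × EmbedCtx => decide (a.2.2.2.1 = a.1))
    (DPT.eq.comp₂ (DPT.fst.comp (DPT.snd.comp (DPT.snd.comp DPT.snd))) DPT.fst) ?_
    (h.2.1.precomp (DPT.fst.comp DPT.snd))
  have h1 : DPT fun a : Str × EmbedCtx => (([] : Str), a.2.2.1) :=
    (DPT.const []).prodMk (DPT.fst.comp (DPT.snd.comp DPT.snd))
  exact h1.congr_enc (f := fun a : Str × EmbedCtx => (Val.str [], a.2.2.1)) (fun a => a)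
    (fun _ => rfl) fun _ => rfl

theorem IsQPT.embedPre (h : OT.QPT) : IsQPT (embedPre OT) := by
  have h1 : IsQPT fun a : Val × (EmbedCtx × Str) =>
      (_root_.embedKey OT (true :: a.2.1.2.2.2.1, a.2.1)).map fun k => (k, a) :=
    ((IsQPT.embedKey h).precomp (DPT.prodMk (α := EmbedCtx × Str)
      (DPT.consTrue (DPT.fst.comp (DPT.snd.comp (DPT.snd.comp (DPT.snd.comp DPT.fst)))))
      DPT.fst)).freshCtx
  have h2 : IsQPT fun a : (Val × EmbedCtx) × Str =>
      (_root_.embedKey OT (true :: a.1.2.2.2.2.1, a.1.2)).map fun k =>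
        ((k.1, a.1.1), (k.2, (a.1.2, a.2))) := by
    have := (h1.precomp (DPT.assoc (α := Val) (β := EmbedCtx) (γ := Str))).map DPT.exchange
    simpa only [PMF.map_comp, Function.comp_def] using this
  have hrest : DPT fun b : Str × (EmbedCtx × Str) => ((b.2.2, b.1), b.2.1) :=
    ((DPT.snd.comp DPT.snd).prodMk DPT.fst).prodMk (DPT.fst.comp DPT.snd)
  have hw : DPT fun b : Str × (EmbedCtx × Str) => pairStr b.2.2 b.1 :=
    DPT.pair.comp₂ (DPT.snd.comp DPT.snd) DPT.fst
  have h3 : DPT fun a : (Val × Val) × (Str × (EmbedCtx × Str)) =>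
      (true, (pairStr a.2.2.2 a.2.1, (a.1.1, ((a.2.2.2, a.2.1), a.2.2.1)))) :=
    (DPT.withBool true).comp (DPT.swapIn.comp (((hw.prodMk hrest).second (γ := Val)).comp
      (DPT.fst.first (γ := Str × (EmbedCtx × Str)))))
  have hs : IsQPT fun a : Val × (Str × (EmbedCtx × Str)) =>
      OT.sign a.2.2.1.1 a.1 (pairStr a.2.2.2 a.2.1) := by
    have e : DPT fun a : Val × (Str × (EmbedCtx × Str)) =>
        (a.2.2.1.1, (a.1, pairStr a.2.2.2 a.2.1)) :=
      DPT.swapIn.comp (((DPT.fst.comp (DPT.fst.comp DPT.snd)).prodMk hw).second (γ := Val))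
    exact h.2.2.1.precomp e
  have h4 : IsQPT fun a : (Val × Val) × (Str × (EmbedCtx × Str)) =>
      (OT.sign a.2.2.1.1 a.1.2 (pairStr a.2.2.2 a.2.1)).map fun r =>
        (false, (r.2, (a.1.1, ((a.2.2.2, a.2.1), a.2.2.1)))) := by
    have e : DPT fun a : ((Val × Str) × Val) × (Str × (EmbedCtx × Str)) =>
        (false, (a.1.1.2, (a.1.2, ((a.2.2.2, a.2.1), a.2.2.1)))) :=
      (DPT.withBool false).comp (DPT.assoc.comp ((hrest.second (γ := Str × Val)).comp
        ((DPT.snd.first (γ := Val)).first (γ := Str × (EmbedCtx × Str)))))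
    have := ((hs.onFst (δ := Val)).precomp
      (DPT.swap.first (γ := Str × (EmbedCtx × Str)))).map e
    simpa only [PMF.map_comp, Function.comp_def] using this
  have h5 := (IsQPT.iteCtx (b := fun b : Str × (EmbedCtx × Str) =>
    decide (b.2.1.2.2.1 = b.2.1.2.2.2.1)) (DPT.eq.comp₂
      (DPT.fst.comp (DPT.snd.comp (DPT.snd.comp (DPT.fst.comp DPT.snd))))
      (DPT.fst.comp (DPT.snd.comp (DPT.snd.comp (DPT.snd.comp (DPT.fst.comp DPT.snd))))))
    h3 h4).comp h2
  simp only [PMF.bind_map, Function.comp_def] at h5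
  exact h5

end

/-! ### Strings of polynomial length -/

namespace DPT

theorem ones : DPT fun s : Str => List.replicate s.length true := by
  have h := tail.comp (snd.comp (withSize (α := Str)))
  simpa only [List.drop_replicate, enc_str, Val.size, Nat.add_sub_cancel] using h

theorem mulLength : DPT fun a : Str × Str => List.replicate (a.1.length * a.2.length) true := by
  have e : ∀ (k : ℕ) (b acc : Str), (fun c : Str × Str => (c.1, c.2 ++ c.1))^[k] (b, acc) =
      (b, acc ++ (List.replicate k b).flatten) := by
    intro k
    induction k with
    | zero => simp
    | succ k ih =>
      intro b acc
      rw [Function.iterate_succ_apply, ih, List.replicate_succ, List.flatten_cons, List.append_assoc]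
  have hlen : ∀ (k : ℕ) (b : Str), (List.replicate k b).flatten.length = k * b.length := by
    intro k b
    simp
  have h1 : DPT fun c : Str × Str => (c.1, c.2 ++ c.1) := fst.prodMk (append.comp₂ snd fst)
  have h := (rep h1 (q := fun n => n * n + n) ((polyBounded_id.mul polyBounded_id).add polyBounded_id)
    (fun w a k hk => by
      obtain ⟨b, acc⟩ := a
      have h2 : k * b.length ≤ w.length * b.length := Nat.mul_le_mul_right _ hk
      rw [e]
      simp only [enc_prod, enc_str, Val.size, List.length_append, hlen]
      nlinarith)).comp ((fst (α := Str) (β := Str)).prodMk (snd.prodMk (const [])))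
  simp only [e, List.nil_append] at h
  have h2 := ones.comp (snd.comp h)
  simp only [hlen] at h2
  exact h2

theorem polyLength (P : Polynomial ℕ) : DPT fun s : Str => List.replicate (P.eval s.length) true := by
  induction P using Polynomial.induction_on with
  | C a => simpa using const (α := Str) (List.replicate a true)
  | add p q hp hq => simpa only [Polynomial.eval_add, List.replicate_add] using append.comp₂ hp hq
  | monomial n a h =>
    have h2 := mulLength.comp₂ h ones
    simpa only [Polynomial.eval_mul, Polynomial.eval_C, Polynomial.eval_pow, Polynomial.eval_X,
      List.length_replicate, pow_succ, mul_assoc] using h2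

end DPT

/-! ### Random positions -/

/-- A step of the choice of a random position that is (up to a factor of two) at most the length of
the first string. The third string stands for a random number that is at most the length of the second
one. -/
noncomputable def guessStep (a : Str × (Str × Str)) : PMF (Str × (Str × Str)) :=
  if decide (a.1.drop a.2.1.length = []) then PMF.pure a
  else coin.bind fun c => if c then PMF.pure (a.1, (true :: (a.2.1 ++ a.2.1), true :: (a.2.2 ++ a.2.2)))
    else PMF.pure (a.1, (true :: (a.2.1 ++ a.2.1), a.2.2 ++ a.2.2))

/-- A random position. -/
noncomputable def guess (w : Str) : PMF Str :=
  (iterate guessStep w.length (w, ([], []))).map fun a => a.2.2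

theorem IsQPT.guessStep : IsQPT guessStep := by
  refine IsQPT.ite (b := fun a : Str × (Str × Str) => decide (a.1.drop a.2.1.length = []))
    (DPT.eq.comp₂ (DPT.strDrop.comp₂ (DPT.fst.comp DPT.snd) DPT.fst) (DPT.const [])) DPT.id ?_
  have hd : DPT fun p : (Str × (Str × Str)) × Bool => p.1.2.1 ++ p.1.2.1 :=
    DPT.append.comp₂ (DPT.fst.comp (DPT.snd.comp DPT.fst)) (DPT.fst.comp (DPT.snd.comp DPT.fst))
  have hx : DPT fun p : (Str × (Str × Str)) × Bool => p.1.2.2 ++ p.1.2.2 :=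
    DPT.append.comp₂ (DPT.snd.comp (DPT.snd.comp DPT.fst)) (DPT.snd.comp (DPT.snd.comp DPT.fst))
  exact IsQPT.bind (α := Str × (Str × Str)) (g := fun p : (Str × (Str × Str)) × Bool =>
    if p.2 then PMF.pure (p.1.1, (true :: (p.1.2.1 ++ p.1.2.1), true :: (p.1.2.2 ++ p.1.2.2)))
    else PMF.pure (p.1.1, (true :: (p.1.2.1 ++ p.1.2.1), p.1.2.2 ++ p.1.2.2))) IsQPT.coin
    (IsQPT.ite DPT.snd ((DPT.fst.comp DPT.fst).prodMk ((DPT.consTrue hd).prodMk (DPT.consTrue hx)))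
      ((DPT.fst.comp DPT.fst).prodMk ((DPT.consTrue hd).prodMk hx)))

/-- The last bound is for arbitrary initial strings, because `IsQPT.rep` asks for all of them. When
the process starts with empty strings, it says that the number never exceeds its upper bound. -/
theorem mem_support_iterate_guessStep (a : Str × (Str × Str)) (k : ℕ) :
    ∀ b ∈ (iterate guessStep k a).support, b.1 = a.1 ∧ b.2.1.length ≤ a.2.1.length + 2 * a.1.length ∧
      b.2.2.length + 1 ≤ (a.2.2.length + 1) * (b.2.1.length + 1) := by
  refine iterate_support (J := fun b => b.1 = a.1 ∧ b.2.1.length ≤ a.2.1.length + 2 * a.1.length ∧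
      b.2.2.length + 1 ≤ (a.2.2.length + 1) * (b.2.1.length + 1)) (fun b hb b' hb' => ?_) k a
      ⟨rfl, by omega, by nlinarith⟩
  obtain ⟨h1, h2, h3⟩ := hb
  rw [guessStep] at hb'
  split_ifs at hb' with hd
  · rw [PMF.mem_support_pure_iff] at hb'
    exact hb' ▸ ⟨h1, h2, h3⟩
  · have hlt : b.2.1.length < a.1.length := by
      rw [decide_eq_true_eq, List.drop_eq_nil_iff] at hd
      rw [← h1]; omega
    rw [PMF.mem_support_bind_iff] at hb'
    obtain ⟨c, -, hb'⟩ := hb'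
    split_ifs at hb' <;>
    · rw [PMF.mem_support_pure_iff] at hb'
      subst hb'
      simp only [List.length_cons, List.length_append]
      exact ⟨h1, by omega, by nlinarith⟩

theorem IsQPT.guess : IsQPT guess := by
  have h := IsQPT.rep IsQPT.guessStep (q := fun n => n * (3 * n) + 7 * n)
    ((polyBounded_id.mul ((polyBounded_const 3).mul polyBounded_id)).add
      ((polyBounded_const 7).mul polyBounded_id)) (fun w a k _ b hb => by
      obtain ⟨h1, h2, h3⟩ := mem_support_iterate_guessStep a k b hb
      obtain ⟨q, b0, x0⟩ := a
      obtain ⟨q', b', x'⟩ := b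
      simp only [enc_prod, enc_str, Val.size] at h1 h2 h3 ⊢
      subst h1
      set n := w.length + 1 + (q'.length + 1 + (b0.length + 1 + (x0.length + 1) + 1) + 1) + 1
      have h4 : (x0.length + 1) * (b'.length + 1) ≤ n * (3 * n) :=
        Nat.mul_le_mul (by omega) (by omega)
      omega)
  have h2 := (h.precomp ((DPT.id (α := Str)).prodMk ((DPT.id (α := Str)).prodMk
    ((DPT.const (α := Str) []).prodMk (DPT.const []))))).map (DPT.snd.comp DPT.snd)
  exact h2

theorem coin_bind_apply {α : Type} (f : Bool → PMF α) (a : α) :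
    (coin.bind f) a = 2⁻¹ * (f true a + f false a) := by
  rw [PMF.bind_apply, tsum_bool, coin]
  simp only [PMF.uniformOfFintype_apply, Fintype.card_bool]
  push_cast
  ring

/-- The range already contains all positions, so the process stands still and exactly one summand is
one. -/
theorem le_sum_iterate_guessStep_of_le (w : Str) (i : ℕ) (hi : i ≤ w.length) (k b : ℕ)
    (hwb : w.length ≤ b) (hb : b ≤ 2 * w.length) :
    ((b + 1 : ℕ) : ℝ≥0∞) ≤ (2 * w.length + 1 : ℕ) * ∑ x ∈ Finset.range (b + 1),
      (iterate guessStep k (w, (List.replicate b true, List.replicate x true))).map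
        (fun a => a.2.2) (List.replicate i true) := by
  have hfix : ∀ x, guessStep (w, (List.replicate b true, List.replicate x true)) =
      PMF.pure (w, (List.replicate b true, List.replicate x true)) := by
    intro x
    simp [guessStep, hwb]
  simp only [iterate_eq_of_fixed (hfix _), PMF.pure_map]
  have : ∀ x, PMF.pure (List.replicate x true) (List.replicate i true) =
      if i = x then (1 : ℝ≥0∞) else 0 := fun x => by
    rw [PMF.pure_apply]
    by_cases h : i = x
    · simp [h]
    · rw [if_neg h, if_neg fun e => h (by simpa using congrArg List.length e)]
  simp only [this, Finset.sum_ite_eq, Finset.mem_range]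
  rw [if_pos (by omega), mul_one]
  exact_mod_cast (by omega : b + 1 ≤ 2 * w.length + 1)

/-- Invariant: a number uniform on `{0, …, b}` becomes, with one more random bit, uniform on `{0, …,
2b + 1}`. Since `b` grows until it reaches the length of `w`, it ends at most at twice this length,
and each position keeps a probability of at least `1 / (2|w| + 1)`. -/
theorem le_sum_iterate_guessStep (w : Str) (i : ℕ) (hi : i ≤ w.length) (k b : ℕ)
    (hk : w.length ≤ k + b) (hb : b ≤ 2 * w.length) :
    ((b + 1 : ℕ) : ℝ≥0∞) ≤ (2 * w.length + 1 : ℕ) * ∑ x ∈ Finset.range (b + 1),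
      (iterate guessStep k (w, (List.replicate b true, List.replicate x true))).map
        (fun a => a.2.2) (List.replicate i true) := by
  induction k generalizing b with
  | zero => exact le_sum_iterate_guessStep_of_le w i hi 0 b (by omega) hb
  | succ k ih =>
    by_cases hwb : w.length ≤ b
    · exact le_sum_iterate_guessStep_of_le w i hi (k + 1) b hwb hb
    have hstep : ∀ x, guessStep (w, (List.replicate b true, List.replicate x true)) =
        coin.bind fun c => if c then PMF.pure (w, (List.replicate (2 * b + 1) true,
          List.replicate (2 * x + 1) true)) else PMF.pure (w, (List.replicate (2 * b + 1) true,
          List.replicate (2 * x) true)) := by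
      intro x
      rw [guessStep]
      simp [hwb, ← List.replicate_succ, two_mul]
    let F : ℕ → ℝ≥0∞ := fun y => (iterate guessStep k (w, (List.replicate (2 * b + 1) true,
      List.replicate y true))).map (fun a => a.2.2) (List.replicate i true)
    have hF : ∀ x, (iterate guessStep (k + 1) (w, (List.replicate b true,
        List.replicate x true))).map (fun a => a.2.2) (List.replicate i true) =
        2⁻¹ * (F (2 * x + 1) + F (2 * x)) := by
      intro x
      simp only [iterate, PMF.monad_bind_eq_bind, hstep, PMF.bind_bind, PMF.map_bind]
      rw [coin_bind_apply]
      simp only [if_true, Bool.false_eq_true, if_false, PMF.pure_bind, F]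
    have hsum : ∀ n, ∑ x ∈ Finset.range n, (F (2 * x + 1) + F (2 * x)) =
        ∑ y ∈ Finset.range (2 * n), F y := by
      intro n
      induction n with
      | zero => simp
      | succ n ihn =>
        rw [Finset.sum_range_succ, ihn, Nat.mul_succ, Finset.sum_range_succ, Finset.sum_range_succ]
        ring
    simp only [hF]
    rw [← Finset.mul_sum, hsum, mul_left_comm]
    have h1 := ih (2 * b + 1) (by omega) (by omega)
    -- The numbers `2x` and `2x + 1` for `x ≤ b` are exactly those below `2(b + 1)`, each with
    -- weight one half.
    rw [show 2 * b + 1 + 1 = 2 * (b + 1) by ring] at h1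
    calc ((b + 1 : ℕ) : ℝ≥0∞) = 2⁻¹ * (2 * (b + 1 : ℕ) : ℕ) := by
          rw [Nat.cast_mul, ← mul_assoc, Nat.cast_ofNat,
            ENNReal.inv_mul_cancel two_ne_zero ENNReal.ofNat_ne_top, one_mul]
      _ ≤ _ := by gcongr

theorem le_guess (w : Str) (i : ℕ) (hi : i ≤ w.length) :
    1 ≤ ((2 * w.length + 1 : ℕ) : ℝ≥0∞) * guess w (List.replicate i true) := by
  have h := le_sum_iterate_guessStep w i hi w.length 0 (by omega) (by omega)
  simp only [zero_add, Finset.sum_range_one, Nat.cast_one, List.replicate_zero] at h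
  exact h

/-! ### The chain with an embedded key -/

/-- The deterministic case of `run_bind_oracle`. -/
theorem run_map_oracle {Θ₁ Θ₂ : Type} (O₁ : Oracle Θ₁) (O₂ : Oracle Θ₂) (e : Θ₁ → Θ₂)
    (h : ∀ θ w, (O₁ θ w).map (fun r => (e r.1, r.2)) = O₂ (e θ) w) (c : Cmd) (θ : Θ₁) (s : Mem) :
    (run O₁ c (θ, s)).map (fun p => (e p.1, p.2)) = run O₂ c (e θ, s) := by
  have := run_bind_oracle O₁ O₂ (fun θ => PMF.pure (e θ)) (fun θ w => by
    simp only [PMF.pure_map, PMF.pure_bind]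
    exact h θ w) c θ s
  simp only [PMF.pure_map, PMF.pure_bind] at this
  exact this

section

variable (OT : DSRKey)

/-- The signing oracle of the chain construction, in the structured form. -/
noncomputable def chainOracle (pp : Str) : Oracle ChainState := fun g m =>
  (chainStep OT pp g m).map fun g' => (g', encodeChain g'.links)

/-- The record of the queries is redundant: it is the list of the messages in the chain, both with
the newest first. -/
theorem run_chainOracle_map (pp : Str) (c : Cmd) (g : ChainState) (s : Mem) :
    (run (chainOracle OT pp) c (g, s)).map
      (fun p => ((p.1.key, p.1.links.map Link.msg), p.2)) =
    run ((chainScheme OT).signOracle pp) c ((g.key, g.links.map Link.msg), s) := by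
  refine run_map_oracle _ _ (fun g : ChainState => (g.key, g.links.map Link.msg)) (fun g m => ?_) c g s
  simp only [chainOracle, DSRKey.signOracle, chainScheme_sign, PMF.map_comp, PMF.monad_bind_eq_bind,
    PMF.monad_pure_eq_pure, PMF.bind_map]
  simp only [chainStep, PMF.map_bind, PMF.bind_bind, PMF.map_comp, PMF.bind_map]
  rfl

/-- The signing oracle of the chain construction, where the key at one position belongs to another
signing oracle. -/
noncomputable def embedOracle {Θ : Type} (O : Oracle Θ) : Oracle (Θ × (Val × EmbedCtx)) :=
  fun θ m => (embedPre OT (θ.2, m)).bind fun r =>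
    (if r.1 then O θ.1 r.2.1 else PMF.pure (θ.1, r.2.1)).map fun p =>
      ((p.1, (embedPost (p.2, r.2.2)).1), (embedPost (p.2, r.2.2)).2)

theorem run_embedOracle_map {Θ : Type} (O : Oracle Θ) (pre post : Cmd)
    (hpre : ∀ a, (pre.sem (Enc.enc a)).map Prod.fst = (embedPre OT a).map Enc.enc)
    (hpost : ∀ a, (post.sem (Enc.enc a)).map Prod.fst = PMF.pure (Enc.enc (embedPost a)))
    (c : Cmd) (θ : Θ) (a : Val × EmbedCtx) (s : Mem) :
    (run (embedOracle OT O) c ((θ, a), s)).map (fun p => ((p.1.1, (Enc.enc p.1.2 : Val)), p.2)) =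
      run (answerOracle O pre post) c ((θ, Enc.enc a), s) := by
  refine run_map_oracle _ _ (fun θ : Θ × (Val × EmbedCtx) => (θ.1, (Enc.enc θ.2 : Val)))
    (fun θ m => ?_) c (θ, a) s
  have e1 : Val.node (Enc.enc θ.2) (.str m) = Enc.enc (θ.2, m) := rfl
  simp only [answerOracle, embedOracle]
  rw [e1, hpre, PMF.bind_map, PMF.map_bind]
  congr 1
  funext r
  have e2 : ∀ s, Val.node (.str s) (Enc.enc r.2.2) = Enc.enc (s, r.2.2) := fun _ => rfl
  have e3 : (Enc.enc r : Val).right.right = Enc.enc r.2.2 := rfl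
  have e4 : (Enc.enc r : Val).right.left = .str r.2.1 := rfl
  have e5 : (Enc.enc r : Val).left.toStr.head? = some r.1 := rfl
  simp only [Function.comp_def, e3, e4, e5, Option.some.injEq]
  split_ifs
  · simp only [PMF.bind_map, Function.comp_def, e2, PMF.map_comp, Val.toStr_str]
    rw [← PMF.bind_pure_comp]
    congr 1
    funext p
    have := congrArg (PMF.map fun v : Val => ((p.1, v.left), v.right.toStr)) (hpost (p.2, r.2.2))
    rw [PMF.map_comp, PMF.pure_map] at this
    exact this.symm
  · simp only [PMF.pure_map, PMF.pure_bind, e2, hpost]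
    rfl

/-- The key at the position which is `d` steps behind the current one, and the strings that it has
signed. -/
def ChainState.past (g : ChainState) : ℕ → Val × List Str
  | 0 => (g.cur, [])
  | d + 1 => (g.used.getD d (.str []),
      [pairStr (g.links.getD d ⟨[], [], []⟩).msg (g.links.getD d ⟨[], [], []⟩).vk])

/-- The state of the reduction, for an embedded key with the given verification key. -/
def ChainState.toEmbed (g : ChainState) (pp vk : Str) (i : ℕ) (cur : Val) : Val × EmbedCtx :=
  (cur, (pp, (vk, (List.replicate i true, (List.replicate g.links.length true,
    encodeChain g.links)))))

/-- The joint state of the oracle for the embedded key and of the reduction; a key that has not yet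
been embedded is independent of the chain. -/
noncomputable def embedKernel (pp : Str) (i : ℕ) (g : ChainState) :
    PMF ((Val × List Str) × (Val × EmbedCtx)) :=
  if g.links.length < i then
    (OT.keyGen pp).map fun k => ((k.1, []), g.toEmbed pp k.2 i g.cur)
  else PMF.pure (g.past (g.links.length - i),
    g.toEmbed pp (tipVk g.vk₀ (g.links.drop (g.links.length - i))) i
      (if g.links.length = i then .str [] else g.cur))

/-- The perfect simulation of one query, by the place of the embedded key relative to the chain.
Until it is reached it is independent of the chain; on being reached it takes the role of the newly
generated key; when it is current, the oracle makes the signature; later it is a used key with one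
signed string. -/
theorem embedKernel_oracle (pp : Str) (i : ℕ) (g : ChainState) (m : Str) :
    (chainOracle OT pp g m).bind (fun r => (embedKernel OT pp i r.1).map fun θ => (θ, r.2)) =
      (embedKernel OT pp i g).bind fun θ => embedOracle OT (OT.signOracle pp) θ m := by
  have hdec : ∀ a b : ℕ, decide (List.replicate a true = List.replicate b true) = decide (a = b) :=
    fun a b => by
      congr 1
      simp
  simp only [chainOracle, chainStep, PMF.bind_map, PMF.map_bind, PMF.bind_bind, Function.comp_def,
    PMF.map_comp]
  rcases lt_trichotomy (g.links.length + 1) i with h | h | h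
  · have h1 : g.links.length < i := by omega
    have h2 : ¬ i = g.links.length + 1 := by omega
    have h3 : ¬ i = g.links.length := by omega
    simp only [embedKernel, List.length_cons, h, h1, h2, h3, if_true, PMF.bind_map, embedOracle,
      embedPre, embedKey, ChainState.toEmbed, ← List.replicate_succ, hdec, Function.comp_def,
      PMF.map_comp, decide_false, Bool.false_eq_true, if_false, PMF.bind_bind, PMF.pure_map]
    -- Two independent key pairs are exchanged: the one waiting to be embedded and the new one of
    -- the chain.
    rw [PMF.bind_comm (OT.keyGen pp) (OT.keyGen pp)]
    congr 1
    funext k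
    rw [PMF.bind_comm (OT.keyGen pp)]
    rfl
  · have h1 : g.links.length < i := by omega
    have h2 : ¬ g.links.length + 1 < i := by omega
    have h3 : ¬ i = g.links.length := by omega
    -- The next key is the embedded one: the waiting key pair is identified with the newly generated
    -- one, and the reduction knows only its verification key.
    subst h
    simp only [embedKernel, List.length_cons, h1, h2, h3, if_true, PMF.bind_map, embedOracle,
      embedPre, embedKey, ChainState.toEmbed, ← List.replicate_succ, hdec, Function.comp_def,
      decide_false, Bool.false_eq_true, if_false, PMF.bind_bind, PMF.pure_map,
      Nat.sub_self, List.drop_zero, ChainState.past, tipVk, decide_true, PMF.pure_bind]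
    rfl
  · have h1 : ¬ g.links.length < i := by omega
    have h2 : ¬ g.links.length + 1 < i := by omega
    have h3 : ¬ i = g.links.length + 1 := by omega
    have h4 : ¬ g.links.length + 1 = i := by omega
    have h5 : g.links.length + 1 - i = (g.links.length - i) + 1 := by omega
    rcases eq_or_ne i g.links.length with rfl | h6
    · simp only [embedKernel, List.length_cons, h1, h2, h3, h4, h5, if_true, embedOracle,
        embedPre, embedKey, ChainState.toEmbed, ← List.replicate_succ, hdec,
        decide_false, Bool.false_eq_true, if_false, PMF.bind_bind, PMF.pure_map,
        Nat.sub_self, List.drop_zero, ChainState.past, tipVk, decide_true, PMF.pure_bind,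
        List.drop_succ_cons, DSRKey.signOracle, PMF.monad_bind_eq_bind, PMF.monad_pure_eq_pure,
        List.getD_cons_zero, PMF.map_bind]
      rfl
    · obtain ⟨d, hd⟩ : ∃ d, g.links.length - i = d + 1 := ⟨g.links.length - i - 1, by omega⟩
      simp only [embedKernel, List.length_cons, h1, h2, h3, h4, h5, h6, h6.symm, PMF.bind_map,
        embedOracle, embedPre, embedKey, ChainState.toEmbed, ← List.replicate_succ, hdec,
        Function.comp_def, decide_false, Bool.false_eq_true, if_false, PMF.bind_bind,
        PMF.pure_map, ChainState.past, PMF.pure_bind, List.drop_succ_cons, hd,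
        List.getD_cons_succ]
      rfl

end

/-! ### The simulated experiment -/

namespace DSRKey

/-- The end of the forgery experiment, from the queries, the output and the running time of the
adversary. -/
noncomputable def forgeryOutcome (D : DSRKey) (pp vk : Str) (r : List Str × Val × ℕ) :
    PMF ForgeryOutcome :=
  (D.ver pp vk r.2.1.left.toStr r.2.1.right.toStr).map fun b =>
    ⟨r.2.2, r.1, b && decide (r.2.1.left.toStr ∉ r.1)⟩

theorem forgeryGame_eq (D : DSRKey) (A : Cmd) (n : ℕ) : D.forgeryGame A n =
    (D.setup n).bind fun a => (D.keyGen a.1).bind fun k =>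
      (run (D.signOracle a.1) A ((k.1, []), Mem.start (Enc.enc (n, (a.1, k.2))))).bind fun p =>
        D.forgeryOutcome a.1 k.2 (p.1.2, (p.2.reg 0, p.2.steps)) := by
  simp only [forgeryGame, PMF.monad_bind_eq_bind, PMF.monad_pure_eq_pure, forgeryOutcome]
  rfl

/-- The probability of winning with given queries and a given output. -/
noncomputable def forgeWin (D : DSRKey) (pp vk : Str) (log : List Str) (v : Val) : ℝ≥0∞ :=
  if v.left.toStr ∉ log then D.ver pp vk v.left.toStr v.right.toStr true else 0

theorem expVal_forgeryOutcome (D : DSRKey) (pp vk : Str) (r : List Str × Val × ℕ) :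
    ((D.forgeryOutcome pp vk r).expVal fun o => if o.win = true then 1 else 0) =
      D.forgeWin pp vk r.1 r.2.1 := by
  simp only [forgeryOutcome, PMF.expVal_map, forgeWin]
  by_cases hm : r.2.1.left.toStr ∈ r.1
  · simp [hm, PMF.expVal]
  · simp only [hm, PMF.expVal, tsum_bool]
    simp

theorem mem_support_forgeryOutcome {D : DSRKey} {pp vk : Str} {r : List Str × Val × ℕ}
    {o : ForgeryOutcome} (h : o ∈ (D.forgeryOutcome pp vk r).support) :
    o.steps = r.2.2 ∧ o.queries = r.1 := by
  rw [forgeryOutcome, PMF.mem_support_map_iff] at h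
  obtain ⟨b, -, rfl⟩ := h
  exact ⟨rfl, rfl⟩

end DSRKey

section

variable (OT : DSRKey)

/-- The context of the reduction at the start. -/
def embedStart (pp vk i : Str) : EmbedCtx := (pp, (vk, (i, ([], []))))

/-- The start of the reduction: the position of the embedded key is chosen, and the adversary gets the
first verification key. -/
noncomputable def embedIni (P : Polynomial ℕ) (a : Str × (Str × Str)) :
    PMF ((Val × EmbedCtx) × (Str × (Str × Str))) :=
  (guess (List.replicate (P.eval a.1.length) true)).bind fun i =>
    (embedKey OT ([], embedStart a.2.1 a.2.2 i)).map fun k =>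
      ((k.1, embedStart a.2.1 a.2.2 i), (a.1, (a.2.1, k.2)))

variable {OT}

theorem IsQPT.embedIni (h : OT.QPT) (P : Polynomial ℕ) : IsQPT (embedIni OT P) := by
  have h1 : IsQPT fun a : Str × (Str × Str) =>
      _root_.guess (List.replicate (P.eval a.1.length) true) :=
    IsQPT.guess.precomp ((DPT.polyLength P).comp DPT.fst)
  have hpp : DPT fun a : (Str × (Str × Str)) × Str => a.1.2.1 := DPT.fst.comp (DPT.snd.comp DPT.fst)
  have hvk : DPT fun a : (Str × (Str × Str)) × Str => a.1.2.2 := DPT.snd.comp (DPT.snd.comp DPT.fst)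
  have hc : DPT fun a : (Str × (Str × Str)) × Str => embedStart a.1.2.1 a.1.2.2 a.2 :=
    hpp.prodMk (hvk.prodMk (DPT.snd.prodMk ((DPT.const []).prodMk (DPT.const []))))
  have h2 : IsQPT fun a : (Str × (Str × Str)) × Str =>
      _root_.embedKey OT ([], embedStart a.1.2.1 a.1.2.2 a.2) :=
    (IsQPT.embedKey h).precomp ((DPT.const []).prodMk hc)
  have h3 : DPT fun a : ((Str × (Str × Str)) × Str) × Str =>
      (embedStart a.1.1.2.1 a.1.1.2.2 a.1.2, (a.1.1.1, (a.1.1.2.1, a.2))) :=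
    (hc.comp DPT.fst).prodMk ((DPT.fst.comp (DPT.fst.comp DPT.fst)).prodMk
      ((hpp.comp DPT.fst).prodMk DPT.snd))
  have h4 : DPT fun a : ((Str × (Str × Str)) × Str) × (Val × Str) =>
      ((a.2.1, embedStart a.1.1.2.1 a.1.1.2.2 a.1.2), (a.1.1.1, (a.1.1.2.1, a.2.2))) :=
    DPT.assocInv.comp ((h3.second (γ := Val)).comp DPT.swapIn)
  exact h1.bind (h2.bind h4)

variable (OT)

/-- The experiment of the reduction with the adversary, for a fixed position of the embedded key. -/
noncomputable def embedRun (A : Cmd) (n pp : Str) (i : ℕ) :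
    PMF (((Val × List Str) × (Val × EmbedCtx)) × Mem) :=
  (OT.keyGen pp).bind fun k =>
    (embedKey OT ([], embedStart pp k.2 (List.replicate i true))).bind fun k₀ =>
      run (embedOracle OT (OT.signOracle pp)) A
        (((k.1, []), (k₀.1, embedStart pp k.2 (List.replicate i true))),
          Mem.start (Enc.enc (n, (pp, k₀.2))))

/-- The simulation can be sampled by running the real experiment and drawing the state of the
reduction afterwards. In particular, the memory of the adversary has the same law in both
experiments. -/
theorem embedRun_eq (A : Cmd) (n pp : Str) (i : ℕ) : embedRun OT A n pp i =
    (chainInit OT pp).bind fun g =>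
      (run (chainOracle OT pp) A (g, Mem.start (Enc.enc (n, (pp, g.vk₀))))).bind fun p =>
        (embedKernel OT pp i p.1).map fun θ => (θ, p.2) := by
  simp only [run_bind_oracle _ _ (embedKernel OT pp i) (embedKernel_oracle OT pp i)]
  simp only [chainInit, PMF.bind_map, Function.comp_def, embedRun, embedKey, embedKernel,
    List.length_nil]
  rcases Nat.eq_zero_or_pos i with rfl | hi
  · simp [embedStart, ChainState.past, ChainState.toEmbed, tipVk]
    rfl
  · have h1 : ¬ List.replicate i true = [] := by simp; omega
    simp only [hi, if_true, PMF.bind_map, Function.comp_def, embedStart, h1, decide_false,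
      Bool.false_eq_true, if_false]
    rw [PMF.bind_comm]
    rfl

/-! ### The position of the forgery -/

theorem Val.left_node (a b : Val) : (Val.node a b).left = a := rfl

theorem Val.right_node (a b : Val) : (Val.node a b).right = b := rfl

/-- Compare the chains from the oldest link on. Equal links are dropped, and the forged chain cannot
end in an equal link, since its last message was never signed. The value `i = R.length` is the case
where the genuine chain ends first; the key there has signed nothing. -/
theorem exists_forged_position (pp vk : Str) (R : List Link) (F : List Str) (hF : F ≠ [])
    (hR : ∀ g ∈ R, g.msg ≠ (decodeLink (F.getLast hF)).msg) :
    ∃ i, i ≤ R.length ∧ (∀ h : i < R.length,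
      pairStr R[i].msg R[i].vk ≠ Walk.signed ((F.drop i).headD [])) ∧
      verProb OT pp vk (F.map decodeLink) ≤
        OT.ver pp (tipVk vk (R.take i).reverse) (Walk.signed ((F.drop i).headD []))
          (decodeLink ((F.drop i).headD [])).sig true := by
  induction F generalizing vk R with
  | nil => exact absurd rfl hF
  | cons f F ih =>
    have h0 : verProb OT pp vk ((f :: F).map decodeLink) ≤
        OT.ver pp vk (Walk.signed f) (decodeLink f).sig true := by
      simp only [List.map_cons, verProb, Walk.signed]
      exact mul_le_of_le_one_right' (Walk.verProb_le_one OT pp _ _)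
    cases R with
    | nil => exact ⟨0, le_rfl, by simp, by simpa [tipVk] using h0⟩
    | cons g R =>
      by_cases hd : pairStr g.msg g.vk = Walk.signed f
      · obtain ⟨h1, h2⟩ := pairStr_injective hd
        have hF' : F ≠ [] := by
          rintro rfl
          exact hR g (by simp) (by simpa using h1)
        obtain ⟨i, hi, hne, hle⟩ := ih g.vk R hF' fun g' hg' => by
          have := hR g' (by simp [hg'])
          rwa [List.getLast_cons hF'] at this
        refine ⟨i + 1, by simpa using hi, fun h => ?_, ?_⟩
        · simpa using hne (by simpa using h)
        · simp only [List.map_cons, verProb, List.take_succ_cons, List.reverse_cons,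
            tipVk_append_singleton, List.drop_succ_cons]
          rw [← h2]
          exact (mul_le_of_le_one_left' (PMF.coe_le_one _ _)).trans hle
      · exact ⟨0, Nat.zero_le _, fun _ => by simpa using hd, by simpa [tipVk] using h0⟩

/-- The position depends on the chain and on the forgery, so the bound is a sum over all positions.
At a position that has been reached, `embedKernel` is a point mass, and the required term of the sum
can be read off. -/
theorem forgeWin_chainScheme_le (pp : Str) (g : ChainState) (out : Val) :
    (chainScheme OT).forgeWin pp g.vk₀ (g.links.map Link.msg) out ≤
      ∑ i ∈ Finset.range (g.links.length + 1), (embedKernel OT pp i g).expVal fun θ =>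
        OT.forgeWin pp θ.2.2.2.1 θ.1.2 (Enc.enc (embedFinal (θ.2, out))) := by
  rw [DSRKey.forgeWin]
  split_ifs with hm
  · exact zero_le
  simp only [chainScheme, decodeChain]
  cases hd : decodeList out.right.toStr with
  | nil => simp [PMF.monad_pure_eq_pure]
  | cons f fs =>
    simp only [List.map_cons]
    split_ifs with hmsg
    swap
    · simp [PMF.monad_pure_eq_pure]
    rw [← List.map_cons (f := decodeLink), verChain_true_eq, ← List.map_reverse]
    have hne : (f :: fs).reverse ≠ [] := by simp
    obtain ⟨i, hi, hlog, hle⟩ := exists_forged_position OT pp g.vk₀ g.links.reverse (f :: fs).reverse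
      hne fun l hl => by
        rw [List.getLast_reverse, List.head_cons, ← hmsg]
        intro he
        exact hm (List.mem_map.mpr ⟨l, by simpa using hl, he⟩)
    rw [List.length_reverse] at hi
    refine hle.trans (le_trans (le_of_eq ?_) (Finset.single_le_sum (f := fun i =>
      (embedKernel OT pp i g).expVal fun θ => OT.forgeWin pp θ.2.2.2.1 θ.1.2
        (Enc.enc (embedFinal (θ.2, out)))) (fun _ _ => zero_le)
      (Finset.mem_range.mpr (Nat.lt_succ_of_le hi))))
    simp only [embedKernel, if_neg (not_lt.mpr hi), PMF.expVal_pure]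
    have e1 : (Enc.enc (embedFinal (g.toEmbed pp (tipVk g.vk₀ (g.links.drop (g.links.length - i))) i
        (if g.links.length = i then .str [] else g.cur), out)) : Val).left.toStr =
        Walk.signed (((f :: fs).reverse.drop i).headD []) := by
      simp only [embedFinal, ChainState.toEmbed, enc_prod, enc_str, Val.left_node, Val.toStr_str, hd,
        List.length_replicate]
    have e2 : (Enc.enc (embedFinal (g.toEmbed pp (tipVk g.vk₀ (g.links.drop (g.links.length - i))) i
        (if g.links.length = i then .str [] else g.cur), out)) : Val).right.toStr =
        (decodeLink (((f :: fs).reverse.drop i).headD [])).sig := by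
      simp only [embedFinal, ChainState.toEmbed, enc_prod, enc_str, Val.right_node, Val.toStr_str, hd,
        List.length_replicate]
    rw [DSRKey.forgeWin, e1, e2, if_pos]
    · rw [List.take_reverse, List.reverse_reverse]
      rfl
    -- The current key has an empty record. An older key has signed one string, which differs from
    -- the forged one by the choice of `i`.
    · rcases Nat.eq_or_lt_of_le hi with rfl | hlt
      · simp [ChainState.past]
      · obtain ⟨d, hdi⟩ : ∃ d, g.links.length - i = d + 1 := ⟨g.links.length - i - 1, by omega⟩
        have := hlog (by simpa using hlt)
        rw [List.getElem_reverse] at this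
        have e3 : g.links.length - 1 - i = d := by omega
        simp only [hdi, ChainState.past, List.mem_singleton]
        rw [List.getD_eq_getElem _ _ (by omega)]
        simp only [e3] at this
        exact this.symm

end

/-! ### The running time of the reduction -/

section

variable {OT : DSRKey}

/-- The current key of the reduction is either a placeholder or the direct output of key generation,
so its size does not accumulate over the queries. -/
theorem mem_support_embedPre {a : (Val × EmbedCtx) × Str}
    {b : Bool × (Str × (Val × ((Str × Str) × EmbedCtx)))} (hb : b ∈ (embedPre OT a).support) :
    b.2.2.2.2 = a.1.2 ∧
      (b.2.2.1 = .str [] ∨ ∃ k ∈ (OT.keyGen a.1.2.1).support, b.2.2.1 = k.1) := by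
  rw [embedPre, PMF.mem_support_bind_iff] at hb
  obtain ⟨k, hk, hb⟩ := hb
  have hk' : k.1 = .str [] ∨ ∃ k' ∈ (OT.keyGen a.1.2.1).support, k.1 = k'.1 := by
    rw [embedKey] at hk
    split_ifs at hk
    · rw [PMF.mem_support_pure_iff] at hk
      exact Or.inl (by rw [hk])
    · exact Or.inr ⟨k, hk, rfl⟩
  split_ifs at hb
  · rw [PMF.mem_support_pure_iff] at hb
    subst hb
    exact ⟨rfl, hk'⟩
  · rw [PMF.mem_support_map_iff] at hb
    obtain ⟨r, -, rfl⟩ := hb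
    exact ⟨rfl, hk'⟩

/-- The size of the state of the reduction after `T` steps of the adversary, if the keys and the other
data have at most size `Z`. -/
def embedSize (Z T : ℕ) : ℕ := 4 * Z + 2 * T + 10

/-- A bound for the time that is needed for a query. -/
def queryCost (p q : ℕ → ℕ) (K Z T : ℕ) : ℕ :=
  p (embedSize Z T + T + 2) + K + (1 + p (embedSize Z T + T + 2) + T) +
    q (T + 2 + p (embedSize Z T + T + 2)) + 9

theorem queryCost_mono {p q : ℕ → ℕ} (hp : Monotone p) (hq : Monotone q) (K Z : ℕ) :
    Monotone (queryCost p q K Z) := by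
  intro T T' h
  have h1 : embedSize Z T + T + 2 ≤ embedSize Z T' + T' + 2 := by
    simp only [embedSize]; omega
  have h2 := hp h1
  have h3 : q (T + 2 + p (embedSize Z T + T + 2)) ≤ q (T' + 2 + p (embedSize Z T' + T' + 2)) :=
    hq (by omega)
  simp only [queryCost]
  omega

/-- The properties of the state of the reduction after `T` steps of the adversary. -/
def EmbedInv {Θ : Type} (pp vk i : Str) (Z k₀ : ℕ) (cost : ℕ → ℕ) (θ : Θ × Val × ℕ) (T : ℕ) : Prop :=
  ∃ a : Val × EmbedCtx, θ.2.1 = Enc.enc a ∧ a.1.size ≤ Z ∧ a.2.1 = pp ∧ a.2.2.1 = vk ∧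
    a.2.2.2.1 = i ∧ a.2.2.2.2.1.length ≤ T ∧ a.2.2.2.2.2.length ≤ T ∧ θ.2.2 ≤ k₀ + T * cost T

theorem EmbedInv.size_le {pp vk i : Str} {Z T : ℕ} {a : Val × EmbedCtx} (h1 : a.1.size ≤ Z)
    (h2 : a.2.1 = pp) (h3 : a.2.2.1 = vk) (h4 : a.2.2.2.1 = i) (h5 : a.2.2.2.2.1.length ≤ T)
    (h6 : a.2.2.2.2.2.length ≤ T) (hpp : pp.length ≤ Z) (hvk : vk.length ≤ Z) (hi : i.length ≤ Z) :
    (Enc.enc a : Val).size ≤ embedSize Z T := by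
  simp only [enc_prod, enc_str, enc_val, Val.size, embedSize, h2, h3, h4]
  omega

/-- The answer is the whole chain, and the adversary is charged for its length; so the chain and the
position counter stay below the adversary's clock. A query advances this clock by at least one,
which pays for one more `queryCost`. -/
theorem embedInv_hookOracle {Θ : Type} (O : Oracle Θ) {pp vk i : Str} {Z k₀ : ℕ} {pre post : Cmd}
    {p q : ℕ → ℕ} (hpm : Monotone p) (hqm : Monotone q)
    (hpre : ∀ a, (pre.sem (Enc.enc a)).map Prod.fst = (embedPre OT a).map Enc.enc)
    (hpres : ∀ a : (Val × EmbedCtx) × Str, ∀ r ∈ (pre.sem (Enc.enc a)).support,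
      r.2 ≤ p (Enc.enc a : Val).size ∧ r.1.size ≤ p (Enc.enc a : Val).size)
    (hpost : ∀ a, (post.sem (Enc.enc a)).map Prod.fst = (PMF.pure (embedPost a)).map Enc.enc)
    (hposts : ∀ a : Str × (Val × ((Str × Str) × EmbedCtx)), ∀ r ∈ (post.sem (Enc.enc a)).support,
      r.2 ≤ q (Enc.enc a : Val).size ∧ r.1.size ≤ q (Enc.enc a : Val).size)
    (hZ : 1 ≤ Z) (hkey : ∀ k ∈ (OT.keyGen pp).support, k.1.size ≤ Z) (hpp : pp.length ≤ Z)
    (hvk : vk.length ≤ Z) (hi : i.length ≤ Z) (θ : Θ × Val × ℕ) (T : ℕ) (m : Str)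
    (h : EmbedInv pp vk i Z k₀ (queryCost p q (pre.bound + post.bound) Z) θ T) :
    ∀ x ∈ (hookOracle O pre post θ m).support,
      EmbedInv pp vk i Z k₀ (queryCost p q (pre.bound + post.bound) Z) x.1
        (T + 1 + m.length + x.2.length) := by
  obtain ⟨a, ha, h1, h2, h3, h4, h5, h6, h7⟩ := h
  intro x hx
  rw [hookOracle, PMF.mem_support_bind_iff] at hx
  obtain ⟨r, hr, hx⟩ := hx
  have e1 : Val.node θ.2.1 (.str m) = Enc.enc (a, m) := by rw [ha]; rfl
  rw [e1] at hr
  obtain ⟨b, hb, hbr⟩ := IsQPT.mem_support_of_sem (hpre (a, m)) hr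
  obtain ⟨hr1, hr2⟩ := hpres _ r hr
  obtain ⟨hb1, hb2⟩ := mem_support_embedPre hb
  simp only at hb1 hb2
  rw [PMF.mem_support_bind_iff] at hx
  obtain ⟨y, hy, hx⟩ := hx
  have e3 : r.1.right.right = Enc.enc b.2.2 := by rw [← hbr]; rfl
  have e4 : r.1.right.left = .str b.2.1 := by rw [← hbr]; rfl
  obtain ⟨s, hys, hyc⟩ : ∃ s, y.2.1 = .str s ∧ y.2.2 ≤ 1 + b.2.1.length + s.length := by
    split_ifs at hy
    · rw [PMF.mem_support_map_iff] at hy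
      obtain ⟨z, -, rfl⟩ := hy
      exact ⟨z.2, rfl, by simp [e4, Val.toStr_str]⟩
    · rw [PMF.mem_support_pure_iff] at hy
      subst hy
      exact ⟨b.2.1, e4, by simp only; omega⟩
  have e2 : Val.node y.2.1 r.1.right.right = Enc.enc (s, b.2.2) := by rw [hys, e3]; rfl
  rw [e2, PMF.mem_support_map_iff] at hx
  obtain ⟨r', hr', rfl⟩ := hx
  obtain ⟨b', hb', hbr'⟩ := IsQPT.mem_support_of_sem
    (f := fun a => PMF.pure (embedPost a)) (hpost (s, b.2.2)) hr'
  rw [PMF.mem_support_pure_iff] at hb'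
  subst hb'
  obtain ⟨hr'1, -⟩ := hposts _ r' hr'
  have e5 : r'.1.left = Enc.enc (embedPost (s, b.2.2)).1 := by rw [← hbr']; rfl
  have e6 : r'.1.right.toStr = (embedPost (s, b.2.2)).2 := by rw [← hbr']; rfl
  simp only [e5, e6]
  set w := (embedPost (s, b.2.2)).2 with hw
  -- The signature obtained for the link is a part of the answer `w`, so the clock bounds it too,
  -- even when it comes from the oracle.
  have hws : s.length ≤ w.length := by
    simp only [hw, embedPost, encodeLink, length_pairStr]
    omega
  set T' := T + 1 + m.length + w.length with hT'
  have hsize := EmbedInv.size_le h1 h2 h3 h4 h5 h6 hpp hvk hi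
  have hX : (Enc.enc (a, m) : Val).size ≤ embedSize Z T' + T' + 2 := by
    rw [enc_prod, enc_str]
    simp only [Val.size, embedSize] at hsize ⊢
    omega
  have hpX := hpm hX
  have hbsize : b.2.1.length + (Enc.enc b.2.2 : Val).size ≤ r.1.size := by
    rw [← hbr]
    simp only [enc_prod, enc_str, Val.size]
    omega
  have hY : (Enc.enc (s, b.2.2) : Val).size ≤ T' + 2 + p (embedSize Z T' + T' + 2) := by
    rw [enc_prod, enc_str]
    simp only [Val.size]
    omega
  have hqY := hqm hY
  refine ⟨(embedPost (s, b.2.2)).1, rfl, ?_, ?_, ?_, ?_, ?_, ?_, ?_⟩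
  · change b.2.2.1.size ≤ Z
    rcases hb2 with hb2 | ⟨k, hk, hb2⟩
    · rw [hb2]; simpa [Val.size] using hZ
    · rw [hb2]
      exact hkey k (h2 ▸ hk)
  · change b.2.2.2.2.1 = pp
    rw [hb1]; exact h2
  · change b.2.2.2.2.2.1 = vk
    rw [hb1]; exact h3
  · change b.2.2.2.2.2.2.1 = i
    rw [hb1]; exact h4
  · change (true :: b.2.2.2.2.2.2.2.1).length ≤ T'
    rw [hb1]
    simp only [List.length_cons]
    omega
  · change w.length ≤ T'
    omega
  · simp only
    have hcost : r.2 + pre.bound + y.2.2 + r'.2 + post.bound + 9 ≤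
        queryCost p q (pre.bound + post.bound) Z T' := by
      simp only [queryCost]
      omega
    have hmono : queryCost p q (pre.bound + post.bound) Z T ≤
        queryCost p q (pre.bound + post.bound) Z T' := queryCost_mono hpm hqm _ _ (by omega)
    have h8 : T * queryCost p q (pre.bound + post.bound) Z T ≤
        T * queryCost p q (pre.bound + post.bound) Z T' := Nat.mul_le_mul_left _ hmono
    have h9 : (T + 1) * queryCost p q (pre.bound + post.bound) Z T' ≤
        T' * queryCost p q (pre.bound + post.bound) Z T' := Nat.mul_le_mul_right _ (by omega)
    rw [Nat.succ_mul] at h9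
    omega

theorem embedInv_mono {Θ : Type} {pp vk i : Str} {Z k₀ : ℕ} {cost : ℕ → ℕ} (hc : Monotone cost)
    (θ : Θ × Val × ℕ) (T T' : ℕ) (hT : T ≤ T') (h : EmbedInv pp vk i Z k₀ cost θ T) :
    EmbedInv pp vk i Z k₀ cost θ T' := by
  obtain ⟨a, ha, h1, h2, h3, h4, h5, h6, h7⟩ := h
  refine ⟨a, ha, h1, h2, h3, h4, h5.trans hT, h6.trans hT, h7.trans ?_⟩
  gcongr
  exact hc hT

end

/-! ### EUF-CMA security -/

theorem PMF.expVal_sum {α ι : Type} (p : PMF α) (s : Finset ι) (f : ι → α → ℝ≥0∞) :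
    (p.expVal fun a => ∑ i ∈ s, f i a) = ∑ i ∈ s, p.expVal (f i) := by
  classical
  induction s using Finset.induction_on with
  | empty => simp [PMF.expVal_const]
  | insert i s hi ih => simp only [Finset.sum_insert hi, PMF.expVal_add, ih]

theorem mem_support_guess {w x : Str} (h : x ∈ (guess w).support) :
    x = List.replicate x.length true ∧ x.length ≤ 2 * w.length := by
  rw [guess, PMF.mem_support_map_iff] at h
  obtain ⟨b, hb, rfl⟩ := h
  obtain ⟨-, h2, h3⟩ := mem_support_iterate_guessStep _ _ b hb
  refine ⟨?_, by simp only [List.length_nil] at h2 h3; omega⟩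
  refine iterate_support (J := fun b : Str × (Str × Str) =>
    b.2.2 = List.replicate b.2.2.length true) (fun c hc c' hc' => ?_) _ _ rfl b hb
  rw [guessStep] at hc'
  have hcc : c.2.2 ++ c.2.2 = List.replicate (c.2.2 ++ c.2.2).length true := by
    rw [List.length_append, List.replicate_add, ← hc]
  split_ifs at hc'
  · rw [PMF.mem_support_pure_iff] at hc'
    exact hc' ▸ hc
  · rw [PMF.mem_support_bind_iff] at hc'
    obtain ⟨d, -, hc'⟩ := hc'
    split_ifs at hc' <;> rw [PMF.mem_support_pure_iff] at hc' <;> subst hc'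
    · simp only [List.length_cons, List.replicate_succ, ← hcc]
    · exact hcc

section

variable (OT : DSRKey)

/-- Every query costs at least one step, so the running time bounds the number of links. -/
theorem mem_support_run_chainOracle {pp : Str} {A : Cmd} {g : ChainState} {v : Val}
    (hg : g.links = []) {x : ChainState × Mem}
    (hx : x ∈ (run (chainOracle OT pp) A (g, Mem.start v)).support) :
    x.1.vk₀ = g.vk₀ ∧ x.1.links.length ≤ x.2.steps := by
  refine (run_invariant (chainOracle OT pp) (fun g' T => g'.vk₀ = g.vk₀ ∧ g'.links.length ≤ T)
    (fun θ k k' hk h => ⟨h.1, h.2.trans hk⟩) (fun θ k q h p hp => ?_) A.bound (v.size + A.bound) A le_rfl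
    (g, Mem.start v) ⟨⟨rfl, by simp [hg]⟩, ?_⟩ x hx).1
  · rw [chainOracle, PMF.mem_support_map_iff] at hp
    obtain ⟨g', hg', rfl⟩ := hp
    obtain ⟨h1, v, s, k, h2, -⟩ := mem_support_chainStep OT hg'
    refine ⟨h1.trans h.1, ?_⟩
    simp only [h2, List.length_cons]
    omega
  · exact (Mem.weight_start_le _ _).trans (Nat.le_add_right _ _)

theorem mem_support_chainInit {pp : Str} {g : ChainState} (hg : g ∈ (chainInit OT pp).support) :
    g.links = [] := by
  rw [chainInit, PMF.mem_support_map_iff] at hg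
  obtain ⟨k, -, rfl⟩ := hg
  rfl

variable {OT}

/-- The assumed bound speaks of outcomes of the complete forgery experiment; each run extends to
such an outcome with the same time. -/
theorem steps_run_chainOracle_le {A : Cmd} {P : Polynomial ℕ}
    (hP : ∀ n, ∀ o ∈ ((chainScheme OT).forgeryGame A n).support, o.steps ≤ P.eval n) {n : ℕ}
    {a : Str × Str} (ha : a ∈ (OT.setup n).support) {g : ChainState}
    (hg : g ∈ (chainInit OT a.1).support) {x : ChainState × Mem}
    (hx : x ∈ (run (chainOracle OT a.1) A (g, Mem.start (Enc.enc (n, (a.1, g.vk₀))))).support) :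
    x.2.steps ≤ P.eval n := by
  obtain ⟨o, ho⟩ := ((chainScheme OT).forgeryOutcome a.1 g.vk₀ (x.1.links.map Link.msg,
    (x.2.reg 0, x.2.steps))).support_nonempty
  have h1 := (DSRKey.mem_support_forgeryOutcome ho).1
  simp only at h1
  rw [← h1]
  refine hP n o ?_
  rw [DSRKey.forgeryGame_eq, PMF.mem_support_bind_iff]
  refine ⟨a, ha, ?_⟩
  rw [PMF.mem_support_bind_iff]
  refine ⟨(g.key, g.vk₀), ?_, ?_⟩
  · rw [chainScheme_keyGen, PMF.mem_support_map_iff]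
    exact ⟨g, hg, rfl⟩
  rw [PMF.mem_support_bind_iff]
  refine ⟨((x.1.key, x.1.links.map Link.msg), x.2), ?_, ho⟩
  have h2 := run_chainOracle_map OT a.1 A g (Mem.start (Enc.enc (n, (a.1, g.vk₀))))
  rw [mem_support_chainInit OT hg] at h2
  rw [show ([] : List Str) = List.map Link.msg [] from rfl, ← h2, PMF.mem_support_map_iff]
  exact ⟨x, hx, rfl⟩

/-- The time bound of the adversary, known for the real experiment, carries over to the simulation
by `embedRun_eq`. The embedded key has signed at most one string in every state that `embedKernel`
produces. -/
theorem mem_support_embedRun {A : Cmd} {P : Polynomial ℕ}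
    (hP : ∀ n, ∀ o ∈ ((chainScheme OT).forgeryGame A n).support, o.steps ≤ P.eval n) {n : ℕ}
    {a : Str × Str} (ha : a ∈ (OT.setup n).support) {i : ℕ}
    {x : ((Val × List Str) × (Val × EmbedCtx)) × Mem}
    (hx : x ∈ (embedRun OT A (List.replicate n true) a.1 i).support) :
    x.2.steps ≤ P.eval n ∧ x.1.1.2.length ≤ 1 := by
  rw [embedRun_eq, PMF.mem_support_bind_iff] at hx
  obtain ⟨g, hg, hx⟩ := hx
  rw [PMF.mem_support_bind_iff] at hx
  obtain ⟨y, hy, hx⟩ := hx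
  rw [PMF.mem_support_map_iff] at hx
  obtain ⟨θ, hθ, rfl⟩ := hx
  refine ⟨steps_run_chainOracle_le hP ha hg hy, ?_⟩
  rw [embedKernel] at hθ
  split_ifs at hθ
  · rw [PMF.mem_support_map_iff] at hθ
    obtain ⟨k, -, rfl⟩ := hθ
    simp
  all_goals
    rw [PMF.mem_support_pure_iff] at hθ
    subst hθ
    cases y.1.links.length - i <;> simp [ChainState.past]

/-- The probability that the reduction wins, given the end of the simulated experiment. -/
noncomputable def embedWin (OT : DSRKey) (pp : Str)
    (y : ((Val × List Str) × (Val × EmbedCtx)) × Mem) : ℝ≥0∞ :=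
  OT.forgeWin pp y.1.2.2.2.1 y.1.1.2 (Enc.enc (embedFinal (y.1.2, y.2.reg 0)))

/-- Combines the bound for each final chain with the perfect simulation. The number of links is at
most the running time, so the positions up to `P.eval n` suffice. -/
theorem chainWin_le_sum {A : Cmd} {P : Polynomial ℕ}
    (hP : ∀ n, ∀ o ∈ ((chainScheme OT).forgeryGame A n).support, o.steps ≤ P.eval n) {n : ℕ}
    {a : Str × Str} (ha : a ∈ (OT.setup n).support) :
    (((chainScheme OT).keyGen a.1).expVal fun k => (run ((chainScheme OT).signOracle a.1) A
      ((k.1, []), Mem.start (Enc.enc (n, (a.1, k.2))))).expVal fun x =>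
        (chainScheme OT).forgeWin a.1 k.2 x.1.2 (x.2.reg 0)) ≤
    ∑ i ∈ Finset.range (P.eval n + 1),
      (embedRun OT A (List.replicate n true) a.1 i).expVal (embedWin OT a.1) := by
  simp only [embedRun_eq, PMF.expVal_bind, ← PMF.expVal_sum]
  rw [chainScheme_keyGen, PMF.expVal_map]
  refine PMF.expVal_mono _ fun g hg => ?_
  have h2 := run_chainOracle_map OT a.1 A g (Mem.start (Enc.enc (n, (a.1, g.vk₀))))
  rw [mem_support_chainInit OT hg, List.map_nil] at h2
  rw [← h2, PMF.expVal_map]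
  refine PMF.expVal_mono _ fun x hx => ?_
  obtain ⟨h3, h4⟩ := mem_support_run_chainOracle OT (mem_support_chainInit OT hg) hx
  have h5 := steps_run_chainOracle_le hP ha hg hx
  simp only
  rw [← h3]
  refine (forgeWin_chainScheme_le OT a.1 x.1 (x.2.reg 0)).trans ?_
  simp only [PMF.expVal_map]
  refine Finset.sum_le_sum_of_subset (fun i hi => ?_)
  rw [Finset.mem_range] at hi ⊢
  omega

theorem sum_le_guess (w : Str) (f : Str → ℝ≥0∞) :
    ∑ i ∈ Finset.range (w.length + 1), f (List.replicate i true) ≤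
      (2 * w.length + 1 : ℕ) * (guess w).expVal f := by
  have hinj : Function.Injective fun i : ℕ => List.replicate i true := fun i j h => by
    simpa using congrArg List.length h
  calc ∑ i ∈ Finset.range (w.length + 1), f (List.replicate i true)
      ≤ ∑ i ∈ Finset.range (w.length + 1), (2 * w.length + 1 : ℕ) *
          (guess w (List.replicate i true) * f (List.replicate i true)) := by
        refine Finset.sum_le_sum fun i hi => ?_
        rw [← mul_assoc]
        exact le_mul_of_one_le_left' (le_guess w i (by rw [Finset.mem_range] at hi; omega))
    _ = (2 * w.length + 1 : ℕ) * ∑ i ∈ Finset.range (w.length + 1),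
          guess w (List.replicate i true) * f (List.replicate i true) := by rw [Finset.mul_sum]
    _ ≤ _ := by
        gcongr
        exact (ENNReal.sum_le_tsum _).trans (ENNReal.tsum_comp_le_tsum_of_injective hinj
          fun s => guess w s * f s)

end

/-- The program computes a randomized map, and its running time and the size of its result are bounded
by the given function of the size of the input. -/
structure Cmd.Computes {α β : Type} [Enc α] [Enc β] (c : Cmd) (p : ℕ → ℕ) (f : α → PMF β) : Prop where
  mono : Monotone p
  sem : ∀ a : α, (c.sem (Enc.enc a)).map Prod.fst = (f a).map (Enc.enc : β → Val)
  le : ∀ a : α, ∀ r ∈ (c.sem (Enc.enc a)).support,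
    r.2 ≤ p (Enc.enc a : Val).size ∧ r.1.size ≤ p (Enc.enc a : Val).size

theorem IsQPT.exists_computes {α β : Type} [Enc α] [Enc β] {f : α → PMF β} (hf : IsQPT f) :
    ∃ (c : Cmd) (p : ℕ → ℕ), PolyBounded p ∧ c.Computes p f := by
  obtain ⟨c, p, hp, hm, h, hs⟩ := hf.exists_sem
  exact ⟨c, p, hp, hm, h, hs⟩

/-! ### The reduction to one-time unforgeability: running time and probability of success. -/

section

variable {OT : DSRKey} {A ini pre post fin : Cmd} {P : Polynomial ℕ} {pI p q pF : ℕ → ℕ}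

/-- A bound for the size of the keys and of the other data of the reduction. -/
def dataSize (s k : ℕ → ℕ) (P : Polynomial ℕ) (n : ℕ) : ℕ :=
  k (s (n + 1)) + s (n + 1) + 2 * P.eval n + 1

/-- A bound for the running time of the reduction, where `Z` is a bound for the size of the data and
`T` is a bound for the running time of the adversary. -/
def reductionTime (pI p q pF : ℕ → ℕ) (bI bA bQ bF n Z T : ℕ) : ℕ :=
  T + (pI (n + 2 * Z + 10) + bI + 1 + T * queryCost p q bQ Z T) + 1 +
    (pF (embedSize Z T + (pI (n + 2 * Z + 10) + bA + 3 * T) + 1) + bF)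

theorem polyBounded_reductionTime {pI p q pF Z T : ℕ → ℕ} (hI : PolyBounded pI) (hp : PolyBounded p)
    (hq : PolyBounded q) (hF : PolyBounded pF) (hZ : PolyBounded Z) (hT : PolyBounded T)
    (bI bA bQ bF : ℕ) :
    PolyBounded fun n => reductionTime pI p q pF bI bA bQ bF n (Z n) (T n) := by
  have c : ∀ k, PolyBounded fun _ => k := polyBounded_const
  have hS : PolyBounded fun n => embedSize (Z n) (T n) :=
    (((c 4).mul hZ).add ((c 2).mul hT)).add (c 10)
  have hX : PolyBounded fun n => p (embedSize (Z n) (T n) + T n + 2) :=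
    hp.comp ((hS.add hT).add (c 2))
  have hC : PolyBounded fun n => queryCost p q bQ (Z n) (T n) :=
    (((hX.add (c bQ)).add (((c 1).add hX).add hT)).add (hq.comp ((hT.add (c 2)).add hX))).add (c 9)
  have hN : PolyBounded fun n => pI (n + 2 * Z n + 10) :=
    hI.comp ((polyBounded_id.add ((c 2).mul hZ)).add (c 10))
  exact ((hT.add (((hN.add (c bI)).add (c 1)).add (hT.mul hC))).add (c 1)).add
    ((hF.comp ((hS.add ((hN.add (c bA)).add ((c 3).mul hT))).add (c 1))).add (c bF))

/-- The state at the end of the simulation. -/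
theorem mem_support_simulation (hI : ini.Computes pI (embedIni OT P))
    (hpre : pre.Computes p (embedPre OT)) (hpost : post.Computes q fun a => PMF.pure (embedPost a))
    (hP : ∀ n, ∀ o ∈ ((chainScheme OT).forgeryGame A n).support, o.steps ≤ P.eval n) {n : ℕ}
    {a : Str × Str} (ha : a ∈ (OT.setup n).support) {Z : ℕ} (hZ : 1 ≤ Z) (hpp : a.1.length ≤ Z)
    (hkey : ∀ k ∈ (OT.keyGen a.1).support, k.1.size ≤ Z ∧ k.2.length ≤ Z)
    (hPZ : 2 * P.eval n ≤ Z) {k : Val × Str} (hk : k ∈ (OT.keyGen a.1).support) {r : Val × ℕ}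
    (hr : r ∈ (ini.sem (Enc.enc (n, (a.1, k.2)))).support)
    {x : ((Val × List Str) × Val × ℕ) × Mem}
    (hx : x ∈ (run (hookOracle (OT.signOracle a.1) pre post) A
      (((k.1, []), (r.1.left, r.2 + ini.bound + 1)), Mem.start r.1.right)).support) :
    x.2.steps ≤ P.eval n ∧ x.1.1.2.length ≤ 1 ∧ ∃ i, i.length ≤ Z ∧
      EmbedInv a.1 k.2 i Z (pI (n + 2 * Z + 10) + ini.bound + 1)
        (queryCost p q (pre.bound + post.bound) Z) x.1 x.2.steps ∧
      (x.2.reg 0).size ≤ pI (n + 2 * Z + 10) + A.bound + 3 * x.2.steps := by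
  have e0 : (Enc.enc (n, (a.1, k.2)) : Val) = Enc.enc ((List.replicate n true : Str), (a.1, k.2)) :=
    rfl
  rw [e0] at hr
  obtain ⟨b, hb, hbr⟩ := IsQPT.mem_support_of_sem (hI.sem _) hr
  obtain ⟨hr1, hr2⟩ := hI.le _ r hr
  have hin : (Enc.enc ((List.replicate n true : Str), (a.1, k.2)) : Val).size ≤ n + 2 * Z + 10 := by
    have := (hkey k hk).2
    simp only [enc_prod, enc_str, Val.size, List.length_replicate]
    omega
  have hpin := hI.mono hin
  rw [embedIni, PMF.mem_support_bind_iff] at hb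
  obtain ⟨i, hi, hb⟩ := hb
  rw [PMF.mem_support_map_iff] at hb
  obtain ⟨k₀, hk₀, rfl⟩ := hb
  -- The guessed position may exceed `P.eval n`, but it is at most twice as large; this is the
  -- reason for the term `2 * P.eval n` in `dataSize`.
  obtain ⟨hi1, hi2⟩ := mem_support_guess hi
  rw [List.length_replicate, List.length_replicate] at hi2
  have hk₀Z : k₀.1.size ≤ Z := by
    rw [embedKey] at hk₀
    split_ifs at hk₀
    · rw [PMF.mem_support_pure_iff] at hk₀
      rw [hk₀]; simpa [Val.size] using hZ
    · exact (hkey k₀ hk₀).1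
  have hleft : r.1.left = Enc.enc (k₀.1, embedStart a.1 k.2 i) := by rw [← hbr]; rfl
  have hright : r.1.right = Enc.enc ((List.replicate n true : Str), (a.1, k₀.2)) := by
    rw [← hbr]; rfl
  have hrs : r.1.right.size ≤ r.1.size := by
    rw [← hbr, enc_prod]
    simp only [Val.right, Val.size]
    omega
  -- The run of the program is mapped to `embedRun` by forgetting the count of steps and the
  -- encodings.
  have hA : x.2.steps ≤ P.eval n ∧ x.1.1.2.length ≤ 1 := by
    have h1 := run_hookOracle_map (OT.signOracle a.1) A pre post
      ((k.1, []), (r.1.left, r.2 + ini.bound + 1)) (Mem.start r.1.right)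
    simp only [hleft] at h1
    rw [← run_embedOracle_map OT (OT.signOracle a.1) pre post hpre.sem
      (fun a => (hpost.sem a).trans (PMF.pure_map _ _))] at h1
    have h2 : ((x.1.1, x.1.2.1), x.2) ∈ ((run (hookOracle (OT.signOracle a.1) pre post) A
        (((k.1, []), (r.1.left, r.2 + ini.bound + 1)), Mem.start r.1.right)).map
          fun p => ((p.1.1, p.1.2.1), p.2)).support := by
      rw [PMF.mem_support_map_iff]
      exact ⟨x, hx, rfl⟩
    rw [hleft, h1, PMF.mem_support_map_iff] at h2
    obtain ⟨y, hy, hyx⟩ := h2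
    simp only [Prod.mk.injEq] at hyx
    have h3 : y ∈ (embedRun OT A (List.replicate n true) a.1 i.length).support := by
      rw [embedRun, PMF.mem_support_bind_iff]
      refine ⟨k, hk, ?_⟩
      rw [← hi1, PMF.mem_support_bind_iff]
      exact ⟨k₀, hk₀, by rwa [hright] at hy⟩
    have h4 := mem_support_embedRun hP ha h3
    rwa [hyx.2, hyx.1.1] at h4
  refine ⟨hA.1, hA.2, i, by omega, ?_⟩
  have hinv := run_invariant (hookOracle (OT.signOracle a.1) pre post)
    (EmbedInv a.1 k.2 i Z (pI (n + 2 * Z + 10) + ini.bound + 1)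
      (queryCost p q (pre.bound + post.bound) Z))
    (embedInv_mono (queryCost_mono hpre.mono hpost.mono _ _))
    (embedInv_hookOracle _ hpre.mono hpost.mono hpre.sem hpre.le hpost.sem hpost.le hZ
      (fun k hk => (hkey k hk).1) hpp (hkey k hk).2 (by omega))
    A.bound (pI (n + 2 * Z + 10) + A.bound) A le_rfl
    (((k.1, []), (r.1.left, r.2 + ini.bound + 1)), Mem.start r.1.right)
    ⟨⟨(k₀.1, embedStart a.1 k.2 i), hleft, hk₀Z, rfl, rfl, rfl, by simp [embedStart],
      by simp [embedStart], by simp only [Mem.start_steps]; omega⟩, by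
      have := Mem.weight_start_le A.bound r.1.right
      simp only
      omega⟩ x hx
  exact ⟨hinv.1, (Mem.size_reg_le_weight A.bound_pos _).trans hinv.2⟩

theorem steps_reduction_le (hI : ini.Computes pI (embedIni OT P))
    (hpre : pre.Computes p (embedPre OT)) (hpost : post.Computes q fun a => PMF.pure (embedPost a))
    (hF : fin.Computes pF fun a => PMF.pure (embedFinal a))
    (hP : ∀ n, ∀ o ∈ ((chainScheme OT).forgeryGame A n).support, o.steps ≤ P.eval n) {n : ℕ}
    {a : Str × Str} (ha : a ∈ (OT.setup n).support) {Z : ℕ} (hZ : 1 ≤ Z) (hpp : a.1.length ≤ Z)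
    (hkey : ∀ k ∈ (OT.keyGen a.1).support, k.1.size ≤ Z ∧ k.2.length ≤ Z)
    (hPZ : 2 * P.eval n ≤ Z) {k : Val × Str} (hk : k ∈ (OT.keyGen a.1).support)
    {y : (Val × List Str) × Mem}
    (hy : y ∈ (run (OT.signOracle a.1) (A.withHook ini pre post fin)
      ((k.1, []), Mem.start (Enc.enc (n, (a.1, k.2))))).support) :
    y.2.steps ≤ reductionTime pI p q pF ini.bound A.bound (pre.bound + post.bound) fin.bound n Z
      (P.eval n) ∧ y.1.2.length ≤ 1 := by
  have h : (y.1, (y.2.reg 0, y.2.steps)) ∈ ((run (OT.signOracle a.1) (A.withHook ini pre post fin)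
      ((k.1, []), Mem.start (Enc.enc (n, (a.1, k.2))))).map
        fun p => (p.1, (p.2.reg 0, p.2.steps))).support := by
    rw [PMF.mem_support_map_iff]
    exact ⟨y, hy, rfl⟩
  rw [run_withHook, PMF.mem_support_bind_iff] at h
  obtain ⟨r, hr, h⟩ := h
  rw [PMF.mem_support_bind_iff] at h
  obtain ⟨x, hx, h⟩ := h
  rw [PMF.mem_support_map_iff] at h
  obtain ⟨r', hr', h⟩ := h
  simp only [Prod.mk.injEq] at h
  obtain ⟨h1, -, h2⟩ := h
  obtain ⟨hs, hl, i, hi, ⟨b, hb, b1, b2, b3, b4, b5, b6, b7⟩, hw⟩ :=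
    mem_support_simulation hI hpre hpost hP ha hZ hpp hkey hPZ hk hr hx
  refine ⟨?_, by rw [← h1]; exact hl⟩
  have e1 : Val.node x.1.2.1 (x.2.reg 0) = Enc.enc (b, x.2.reg 0) := by rw [hb]; rfl
  rw [e1] at hr'
  have h3 := (hF.le _ r' hr').1
  have h4 := EmbedInv.size_le b1 b2 b3 b4 (b5.trans hs) (b6.trans hs) hpp (hkey k hk).2 hi
  have h5 : (Enc.enc (b, x.2.reg 0) : Val).size ≤ embedSize Z (P.eval n) +
      (pI (n + 2 * Z + 10) + A.bound + 3 * P.eval n) + 1 := by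
    rw [enc_prod, enc_val]
    simp only [Val.size]
    omega
  have h6 := hF.mono h5
  have h7 : x.2.steps * queryCost p q (pre.bound + post.bound) Z x.2.steps ≤
      P.eval n * queryCost p q (pre.bound + post.bound) Z (P.eval n) :=
    Nat.mul_le_mul hs (queryCost_mono hpre.mono hpost.mono _ _ hs)
  rw [← h2]
  simp only [reductionTime]
  omega

/-- The sum over positions is at most `2 * P.eval n + 1` times the average over a guessed position,
by `sum_le_guess`; this average is then identified with the success of the actual program
`A.withHook`. -/
theorem chainWin_le_reduction (hI : ini.Computes pI (embedIni OT P))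
    (hpre : pre.Computes p (embedPre OT)) (hpost : post.Computes q fun a => PMF.pure (embedPost a))
    (hF : fin.Computes pF fun a => PMF.pure (embedFinal a))
    (hP : ∀ n, ∀ o ∈ ((chainScheme OT).forgeryGame A n).support, o.steps ≤ P.eval n) {n : ℕ}
    {a : Str × Str} (ha : a ∈ (OT.setup n).support) {Z : ℕ} (hZ : 1 ≤ Z) (hpp : a.1.length ≤ Z)
    (hkey : ∀ k ∈ (OT.keyGen a.1).support, k.1.size ≤ Z ∧ k.2.length ≤ Z)
    (hPZ : 2 * P.eval n ≤ Z) :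
    (((chainScheme OT).keyGen a.1).expVal fun k => (run ((chainScheme OT).signOracle a.1) A
      ((k.1, []), Mem.start (Enc.enc (n, (a.1, k.2))))).expVal fun x =>
        (chainScheme OT).forgeWin a.1 k.2 x.1.2 (x.2.reg 0)) ≤
    (2 * P.eval n + 1 : ℕ) * (OT.keyGen a.1).expVal fun k =>
      (run (OT.signOracle a.1) (A.withHook ini pre post fin)
        ((k.1, []), Mem.start (Enc.enc (n, (a.1, k.2))))).expVal fun y =>
          OT.forgeWin a.1 k.2 y.1.2 (y.2.reg 0) := by
  refine (chainWin_le_sum hP ha).trans ?_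
  have hsum := sum_le_guess (List.replicate (P.eval n) true) fun i =>
    (OT.keyGen a.1).expVal fun k => (embedKey OT ([], embedStart a.1 k.2 i)).expVal fun k₀ =>
      (run (embedOracle OT (OT.signOracle a.1)) A (((k.1, []), (k₀.1, embedStart a.1 k.2 i)),
        Mem.start (Enc.enc ((List.replicate n true : Str), (a.1, k₀.2))))).expVal (embedWin OT a.1)
  rw [List.length_replicate] at hsum
  simp only [embedRun, PMF.expVal_bind]
  refine hsum.trans ?_
  gcongr
  -- The guess and the challenge key are independent; the program draws its guess after receiving
  -- the key.
  rw [PMF.expVal_comm]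
  refine PMF.expVal_mono _ fun k hk => ?_
  -- Here the verification key is read from the state of the reduction, which makes `Φ` a function
  -- of the simulated run alone. By the invariant it is the challenge key.
  let Φ : (Val × List Str) × Val → Val → ℝ≥0∞ := fun θ out =>
    (fin.sem (.node θ.2 out)).expVal fun r' => OT.forgeWin a.1 θ.2.right.right.left.toStr θ.1.2 r'.1
  have hΦ : ∀ θ (b : Val × EmbedCtx) out, Φ (θ, Enc.enc b) out =
      OT.forgeWin a.1 b.2.2.1 θ.2 (Enc.enc (embedFinal (b, out))) := by
    intro θ b out
    have := congrArg (fun p => p.expVal fun v : Val => OT.forgeWin a.1 b.2.2.1 θ.2 v)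
      (hF.sem (b, out))
    simp only [PMF.expVal_map, PMF.expVal_pure] at this
    exact this
  have e1 : ((run (OT.signOracle a.1) (A.withHook ini pre post fin)
      ((k.1, []), Mem.start (Enc.enc (n, (a.1, k.2))))).expVal fun y =>
        OT.forgeWin a.1 k.2 y.1.2 (y.2.reg 0)) =
      (ini.sem (Enc.enc (n, (a.1, k.2)))).expVal fun r =>
        (run (hookOracle (OT.signOracle a.1) pre post) A
          (((k.1, []), (r.1.left, r.2 + ini.bound + 1)), Mem.start r.1.right)).expVal fun x =>
            (fin.sem (.node x.1.2.1 (x.2.reg 0))).expVal fun r' =>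
              OT.forgeWin a.1 k.2 x.1.1.2 r'.1 := by
    have := congrArg (fun p => p.expVal fun y : (Val × List Str) × Val × ℕ =>
      OT.forgeWin a.1 k.2 y.1.2 y.2.1) (run_withHook (OT.signOracle a.1) A ini pre post fin
        (k.1, []) (Enc.enc (n, (a.1, k.2))))
    simp only [PMF.expVal_map, PMF.expVal_bind] at this
    exact this
  have e2 : ∀ r ∈ (ini.sem (Enc.enc (n, (a.1, k.2)))).support,
      ((run (answerOracle (OT.signOracle a.1) pre post) A
        (((k.1, []), r.1.left), Mem.start r.1.right)).expVal fun x => Φ x.1 (x.2.reg 0)) ≤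
      (run (hookOracle (OT.signOracle a.1) pre post) A
        (((k.1, []), (r.1.left, r.2 + ini.bound + 1)), Mem.start r.1.right)).expVal fun x =>
          (fin.sem (.node x.1.2.1 (x.2.reg 0))).expVal fun r' =>
            OT.forgeWin a.1 k.2 x.1.1.2 r'.1 := by
    intro r hr
    have h1 := run_hookOracle_map (OT.signOracle a.1) A pre post
      ((k.1, []), (r.1.left, r.2 + ini.bound + 1)) (Mem.start r.1.right)
    simp only at h1
    rw [← h1, PMF.expVal_map]
    refine PMF.expVal_mono _ fun x hx => ?_
    obtain ⟨-, -, i, -, ⟨b, hb, -, -, b3, -⟩, -⟩ :=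
      mem_support_simulation hI hpre hpost hP ha hZ hpp hkey hPZ hk hr hx
    have e3 : x.1.2.1.right.right.left.toStr = k.2 := by
      rw [hb, ← b3]; rfl
    simp only [Φ, e3, le_refl]
  rw [e1]
  refine le_trans (le_of_eq ?_) (PMF.expVal_mono _ e2)
  have e4 := congrArg (fun p => p.expVal fun v : Val =>
    (run (answerOracle (OT.signOracle a.1) pre post) A
      (((k.1, []), v.left), Mem.start v.right)).expVal fun x => Φ x.1 (x.2.reg 0))
    (hI.sem ((List.replicate n true : Str), (a.1, k.2)))
  simp only [PMF.expVal_map] at e4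
  refine Eq.trans ?_ e4.symm
  simp only [embedIni, PMF.expVal_bind, PMF.expVal_map, List.length_replicate]
  congr 1
  funext i
  congr 1
  funext k₀
  have h5 := run_embedOracle_map OT (OT.signOracle a.1) pre post hpre.sem
    (fun a => (hpost.sem a).trans (PMF.pure_map _ _)) A (k.1, [])
    (k₀.1, embedStart a.1 k.2 i) (Mem.start (Enc.enc ((List.replicate n true : Str), (a.1, k₀.2))))
  have h6 := congrArg (fun p => p.expVal fun x => Φ x.1 (x.2.reg 0)) h5
  simp only [PMF.expVal_map, hΦ] at h6
  exact h6

end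

/-- The one-time adversary is the hooked program. Its time is polynomial by `steps_reduction_le`,
its record never exceeds one query, and the loss in the probability is polynomial. -/
theorem chainScheme_eufcma {OT : DSRKey} (hQPT : OT.QPT) (h : OT.OneTimeEUFCMA) :
    (chainScheme OT).EUFCMA := by
  intro A hA
  obtain ⟨P, hP⟩ := hA
  obtain ⟨ini, pI, hpI, hI⟩ := (IsQPT.embedIni hQPT P).exists_computes
  obtain ⟨pre, p, hp, hpre⟩ := (IsQPT.embedPre hQPT).exists_computes
  obtain ⟨post, q, hq, hpost⟩ := DPT.embedPost.exists_computes
  obtain ⟨fin, pF, hpF, hF⟩ := DPT.embedFinal.exists_computes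
  obtain ⟨s, hs, -, hss⟩ := hQPT.1.size_le
  obtain ⟨κ, hκ, hκm, hκs⟩ := hQPT.2.1.size_le
  have hpp : ∀ n, ∀ a ∈ (OT.setup n).support, a.1.length + 1 ≤ s (n + 1) := by
    intro n a ha
    have := hss n a ha
    simp only [enc_prod, enc_str, enc_nat, Val.size, List.length_replicate] at this
    omega
  have hkey : ∀ n, ∀ a ∈ (OT.setup n).support, ∀ k ∈ (OT.keyGen a.1).support,
      k.1.size ≤ dataSize s κ P n ∧ k.2.length ≤ dataSize s κ P n := by
    intro n a ha k hk
    have h1 := hκs a.1 k hk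
    have h2 := hκm (hpp n a ha)
    simp only [enc_prod, enc_str, enc_val, Val.size] at h1
    simp only [dataSize]
    omega
  have hZ : ∀ n, 1 ≤ dataSize s κ P n := fun n => by simp only [dataSize]; omega
  have hPZ : ∀ n, 2 * P.eval n ≤ dataSize s κ P n := fun n => by simp only [dataSize]; omega
  have hppZ : ∀ n, ∀ a ∈ (OT.setup n).support, a.1.length ≤ dataSize s κ P n := fun n a ha => by
    have := hpp n a ha
    simp only [dataSize]
    omega
  have hB : ∀ n, ∀ o ∈ (OT.forgeryGame (A.withHook ini pre post fin) n).support,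
      o.steps ≤ reductionTime pI p q pF ini.bound A.bound (pre.bound + post.bound) fin.bound n
        (dataSize s κ P n) (P.eval n) ∧ o.queries.length ≤ 1 := by
    intro n o ho
    simp only [DSRKey.forgeryGame_eq, PMF.mem_support_bind_iff] at ho
    obtain ⟨a, ha, k, hk, y, hy, ho⟩ := ho
    obtain ⟨h1, h2⟩ := DSRKey.mem_support_forgeryOutcome ho
    rw [h1, h2]
    exact steps_reduction_le hI hpre hpost hF hP ha (hZ n) (hppZ n a ha) (hkey n a ha) (hPZ n) hk hy
  have hdata : PolyBounded (dataSize s κ P) := by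
    have hs1 : PolyBounded fun n => s (n + 1) := hs.comp (polyBounded_id.add (polyBounded_const 1))
    exact (((hκ.comp hs1).add hs1).add ((polyBounded_const 2).mul P.polyBounded_eval)).add
      (polyBounded_const 1)
  obtain ⟨R, hR⟩ := polyBounded_reductionTime hpI hp hq hpF hdata P.polyBounded_eval ini.bound A.bound
    (pre.bound + post.bound) fin.bound
  have hneg := h (A.withHook ini pre post fin)
    ⟨R, fun n o ho => (hB n o ho).1.trans (hR n)⟩ fun n o ho => (hB n o ho).2
  refine (hneg.polyBounded_mul (fun n => ENNReal.toReal_nonneg) (((polyBounded_const 2).mul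
    P.polyBounded_eval).add (polyBounded_const 1))).mono (fun n => ENNReal.toReal_nonneg) fun n => ?_
  simp only [prob_eq_expVal]
  rw [← ENNReal.toReal_natCast, ← ENNReal.toReal_mul]
  refine ENNReal.toReal_mono (ENNReal.mul_ne_top (ENNReal.natCast_ne_top _) ?_) ?_
  · refine ((PMF.expVal_le_of_le _ fun o _ => ?_).trans_lt ENNReal.one_lt_top).ne
    split_ifs <;> simp
  · have hsetup : (chainScheme OT).setup = OT.setup := rfl
    simp only [DSRKey.forgeryGame_eq, PMF.expVal_bind, DSRKey.expVal_forgeryOutcome, hsetup]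
    rw [← PMF.expVal_const_mul]
    exact PMF.expVal_mono _ fun a ha => chainWin_le_reduction hI hpre hpost hF hP ha (hZ n)
      (hppZ n a ha) (hkey n a ha) (hPZ n)

theorem mainTheorem3 (OT : DSRKey) (hQPT : OT.QPT)
    (hCorrect : OT.OneTimeCorrectness) (hEUF : OT.OneTimeEUFCMA)
    (hDelCorrect : OT.OneTimeDelCorrectness) (hDelSec : OT.OneTimeDelSecurity) :
    (chainScheme OT).QPT ∧
    (chainScheme OT).ManyTimeCorrectness ∧
    (chainScheme OT).EUFCMA ∧
    (chainScheme OT).ManyTimeDelCorrectness ∧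
    (chainScheme OT).DelSecurity := by
  exact ⟨hQPT.chainScheme, chainScheme_correct hCorrect, chainScheme_eufcma hQPT hEUF,
    chainScheme_delCorrect hDelCorrect, chainScheme_delSecurity hQPT hDelSec⟩
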